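/- **Conventions.** $G$ is a locally compact (Hausdorff) abelian group, written additively, with a fixed (regular) Haar measure $ds$, and $\mathbb C$ is regarded as an additive group. A *Young function* is a nonzero convex function $\Phi:[0,\infty)\to[0,\infty]$ with $\Phi(0)=0$ and $\lim_{x\to\infty}\Phi(x)=\infty$; its *complementary function* is $y\mapsto\sup\{xy-\Phi(x):x\ge 0\}$. $L^\Phi(G)$ is the space of (a.e. classes of) measurable $f:G\to\mathbb C$ such that $\int_G\Phi(\alpha|f(s)|)\,ds<\infty$ for some $\alpha>0$. Let $(\Phi,\Psi)$ be a *complementary pair*, i.e. $\Phi$ and $\Psi$ are continuous, strictly increasing Young functions and $\Psi$ is the complementary function of $\Phi$. Then $L^\Phi(G)$ carries the norm $\|f\|_\Phi=\sup\{\int_G|fv|\,ds:\int_G\Psi(|v|)\,ds\le1\}$, and $\mathcal S^\Phi(G)$ is the closure in $L^\Phi(G)$ of the linear space of all step functions in $L^\Phi(G)$. A *weight* is a measurable, locally integrable function $\omega:G\to(0,\infty)$ with $\omega(0)=1$, $1/\omega\in L^\infty(G)$ and $\omega(s+t)\le C\omega(s)\omega(t)$ for all $s,t\in G$ and some constant $C>0$.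 Put $L^\Phi_\omega(G)=\{f:f\omega\in L^\Phi(G)\}$ with norm $\|f\|_{\Phi,\omega}=\|f\omega\|_\Phi$, and $\mathcal S^\Phi_\omega(G)=\{f:f\omega\in\mathcal S^\Phi(G)\}$. We say that $L^\Phi_\omega(G)$ is a *Banach algebra under convolution* if for all $f,g\in L^\Phi_\omega(G)$ the integral $(f*g)(x)=\int_G f(t)g(x-t)\,dt$ converges absolutely for almost every $x$, $f*g\in L^\Phi_\omega(G)$, and $\|f*g\|_{\Phi,\omega}\le K\|f\|_{\Phi,\omega}\|g\|_{\Phi,\omega}$ with a constant $K$. A Banach algebra $A$ (with bounded, not necessarily contractive, product) is *weakly amenable* if every bounded derivation $D:A\to A^*$, i.e. every bounded linear map with $\langle D(ab),c\rangle=\langle D(b),ca\rangle+\langle D(a),bc\rangle$, is inner, i.e. of the form $\langle D(a),c\rangle=\varphi(ca)-\varphi(ac)$ for some $\varphi\in A^*$. Finally $\check h(s)=h(-s)$. **Theorem.** Let $G$ be a locally compact abelian group, $\omega$ a weight on $G$, and $(\Phi,\Psi)$ a complementary pair such that $L^\Phi_\omega(G)$ is a Banach algebra under convolution. Let $\xi:G\to\mathbb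 C$ be a nonzero continuous group homomorphism such that $$\tilde\xi(s):=\frac{\xi(s)}{\omega(s)\,\omega(-s)}\qquad(s\in G)$$ belongs to $L^\infty(G)$. Assume that one of the following holds: (i) $x\mapsto\Psi(\sqrt x)$ is a Young function; (ii) $\tilde\Phi(x):=\Phi(\sqrt x)$ is a Young function and $\tilde\xi\in L^{\tilde\Psi}(G)$, where $\tilde\Psi$ is the complementary function of $\tilde\Phi$. Then $\mathcal S^\Phi_\omega(G)$ is a subalgebra of $L^\Phi_\omega(G)$, and neither $L^\Phi_\omega(G)$ nor $\mathcal S^\Phi_\omega(G)$ is weakly amenable. More precisely, for every compact neighbourhood $U$ of $0$ in $G$ the formula $$\langle D(f),g\rangle=\int_G\bigl(1_U*(\check f\,\check\xi)\bigr)(t)\,g(t)\,dt\qquad(f,g\in L^\Phi_\omega(G)),$$ in which all integrals converge absolutely, defines a bounded derivation $D:L^\Phi_\omega(G)\to L^\Phi_\omega(G)^*$ that is not inner, and restricting $f$ and $g$ to $\mathcal S^\Phi_\omega(G)$ gives a bounded derivation $\mathcal S^\Phi_\omega(G)\to\mathcal S^\Phi_\omega(G)^*$ that is not inner. -/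

import Mathlib

open MeasureTheory Filter Topology
open scoped ENNReal NNReal Convolution

noncomputable section

namespace WeightedOrlicz

/-! ### Young functions -/

/-- A Young function `Φ : [0,∞) → [0,∞]`: nonzero, convex, `Φ 0 = 0`, `Φ x → ∞` as `x → ∞`. -/
structure IsYoung (Φ : ℝ≥0 → ℝ≥0∞) : Prop where
  ne_zero : Φ ≠ 0
  convex : ConvexOn ℝ≥0 Set.univ Φ
  map_zero : Φ 0 = 0
  tendsto_top : Tendsto Φ atTop (𝓝 ∞)

/-- The complementary function `Ψ y = sup {x y - Φ x : x ≥ 0}`. The truncated subtraction of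
`ℝ≥0∞` does no harm here, since the term `x = 0` makes the supremum nonnegative when `Φ 0 = 0`. -/
def complementary (Φ : ℝ≥0 → ℝ≥0∞) (y : ℝ≥0) : ℝ≥0∞ :=
  ⨆ x : ℝ≥0, ((x * y : ℝ≥0) : ℝ≥0∞) - Φ x

/-- A complementary pair of continuous strictly increasing Young functions. -/
structure YoungPair where
  Φ : ℝ≥0 → ℝ≥0∞
  Ψ : ℝ≥0 → ℝ≥0∞
  young_Φ : IsYoung Φ
  young_Ψ : IsYoung Ψ
  compl_eq : Ψ = complementary Φ
  continuous_Φ : Continuous Φ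
  continuous_Ψ : Continuous Ψ
  strictMono_Φ : StrictMono Φ
  strictMono_Ψ : StrictMono Ψ

theorem young_inequality (Φ : ℝ≥0 → ℝ≥0∞) (x y : ℝ≥0) :
    ((x * y : ℝ≥0) : ℝ≥0∞) ≤ Φ x + complementary Φ y :=
  tsub_le_iff_left.1 (le_iSup (fun x : ℝ≥0 => ((x * y : ℝ≥0) : ℝ≥0∞) - Φ x) x)

/-! ### Orlicz spaces -/

section Orlicz

variable {α : Type*} [MeasurableSpace α]

/-- `f ∈ L^Φ(μ)`: `f` is measurable and `∫ Φ(a |f|) dμ < ∞` for some `a > 0`. -/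
def MemOrlicz (Φ : ℝ≥0 → ℝ≥0∞) (f : α → ℂ) (μ : Measure α) : Prop :=
  AEStronglyMeasurable f μ ∧ ∃ a : ℝ≥0, 0 < a ∧ ∫⁻ x, Φ (a * ‖f x‖₊) ∂μ < ∞

/-- The Orlicz norm `sup {∫ |f v| dμ : ∫ Ψ(|v|) dμ ≤ 1}`, with values in `[0,∞]`. -/
def eOrliczNorm (Ψ : ℝ≥0 → ℝ≥0∞) (f : α → ℂ) (μ : Measure α) : ℝ≥0∞ :=
  ⨆ (v : α → ℂ) (_ : AEStronglyMeasurable v μ) (_ : ∫⁻ x, Ψ ‖v x‖₊ ∂μ ≤ 1),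
    ∫⁻ x, ‖f x * v x‖ₑ ∂μ

variable {μ : Measure α}

theorem MemOrlicz.congr {Φ : ℝ≥0 → ℝ≥0∞} {f g : α → ℂ} (h : f =ᵐ[μ] g)
    (hf : MemOrlicz Φ f μ) : MemOrlicz Φ g μ := by
  obtain ⟨hm, a, ha, hi⟩ := hf
  refine ⟨hm.congr h, a, ha, ?_⟩
  rwa [lintegral_congr_ae (g := fun x => Φ (a * ‖f x‖₊))]
  filter_upwards [h] with x hx
  rw [hx]

theorem MemOrlicz.add (P : YoungPair) {f g : α → ℂ} (hf : MemOrlicz P.Φ f μ)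
    (hg : MemOrlicz P.Φ g μ) : MemOrlicz P.Φ (f + g) μ := by
  obtain ⟨hfm, a, ha, hfi⟩ := hf
  obtain ⟨hgm, b, hb, hgi⟩ := hg
  have hmono := P.strictMono_Φ.monotone
  refine ⟨hfm.add hgm, min a b / 2, by positivity, ?_⟩
  have hmeas : AEMeasurable (fun x => P.Φ (a * ‖f x‖₊)) μ :=
    P.continuous_Φ.measurable.comp_aemeasurable (hfm.nnnorm.aemeasurable.const_mul a)
  refine lt_of_le_of_lt (b := ∫⁻ x, (P.Φ (a * ‖f x‖₊) + P.Φ (b * ‖g x‖₊)) ∂μ) ?_ ?_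
  · refine lintegral_mono fun x => ?_
    have h1 : min a b / 2 * ‖(f + g) x‖₊ ≤ max (a * ‖f x‖₊) (b * ‖g x‖₊) := by
      calc min a b / 2 * ‖(f + g) x‖₊
          ≤ min a b / 2 * (‖f x‖₊ + ‖g x‖₊) := by gcongr; exact nnnorm_add_le _ _
        _ = (min a b * ‖f x‖₊ + min a b * ‖g x‖₊) / 2 := by ring
        _ ≤ (a * ‖f x‖₊ + b * ‖g x‖₊) / 2 := by
            gcongr
            · exact min_le_left _ _
            · exact min_le_right _ _
        _ ≤ (max (a * ‖f x‖₊) (b * ‖g x‖₊) + max (a * ‖f x‖₊) (b * ‖g x‖₊)) / 2 := by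
            gcongr
            · exact le_max_left _ _
            · exact le_max_right _ _
        _ = max (a * ‖f x‖₊) (b * ‖g x‖₊) := by rw [add_self_div_two]
    refine (hmono h1).trans ?_
    rcases le_total (a * ‖f x‖₊) (b * ‖g x‖₊) with h | h
    · rw [max_eq_right h]; exact le_add_self
    · rw [max_eq_left h]; exact le_self_add
  · rw [lintegral_add_left' hmeas]
    exact ENNReal.add_lt_top.2 ⟨hfi, hgi⟩

theorem MemOrlicz.const_smul (P : YoungPair) {f : α → ℂ} (c : ℂ) (hf : MemOrlicz P.Φ f μ) :
    MemOrlicz P.Φ (c • f) μ := by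
  obtain ⟨hfm, a, ha, hfi⟩ := hf
  refine ⟨hfm.const_smul c, a / (‖c‖₊ + 1), by positivity, lt_of_le_of_lt ?_ hfi⟩
  refine lintegral_mono fun x => P.strictMono_Φ.monotone ?_
  rw [Pi.smul_apply, nnnorm_smul, ← mul_assoc]
  gcongr
  rw [div_mul_eq_mul_div, div_le_iff₀ (by positivity)]
  gcongr
  exact le_self_add

theorem memOrlicz_zero (P : YoungPair) : MemOrlicz P.Φ (0 : α → ℂ) μ :=
  ⟨aestronglyMeasurable_zero, 1, one_pos, by simp [P.young_Φ.map_zero]⟩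

variable (μ) in
/-- The Orlicz space `L^Φ(μ)`, a space of classes of a.e. equal measurable functions. -/
def OrliczSpace (P : YoungPair) : Submodule ℂ (α →ₘ[μ] ℂ) where
  carrier := {f | MemOrlicz P.Φ f μ}
  add_mem' {f g} hf hg := (hf.add P hg).congr (AEEqFun.coeFn_add f g).symm
  zero_mem' := (memOrlicz_zero P).congr AEEqFun.coeFn_zero.symm
  smul_mem' c f hf := (hf.const_smul P c).congr (AEEqFun.coeFn_smul c f).symm

theorem eOrliczNorm_congr {Ψ : ℝ≥0 → ℝ≥0∞} {f g : α → ℂ} (h : f =ᵐ[μ] g) :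
    eOrliczNorm Ψ f μ = eOrliczNorm Ψ g μ := by
  unfold eOrliczNorm
  refine iSup_congr fun v => iSup_congr fun _ => iSup_congr fun _ => lintegral_congr_ae ?_
  filter_upwards [h] with x hx
  rw [hx]

theorem eOrliczNorm_add_le {Ψ : ℝ≥0 → ℝ≥0∞} {f g : α → ℂ} (hf : AEStronglyMeasurable f μ) :
    eOrliczNorm Ψ (f + g) μ ≤ eOrliczNorm Ψ f μ + eOrliczNorm Ψ g μ := by
  refine iSup_le fun v => iSup_le fun hv => iSup_le fun hvi => ?_
  calc ∫⁻ x, ‖(f + g) x * v x‖ₑ ∂μ ≤ ∫⁻ x, (‖f x * v x‖ₑ + ‖g x * v x‖ₑ) ∂μ := by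
        refine lintegral_mono fun x => ?_
        rw [Pi.add_apply, add_mul]
        exact enorm_add_le _ _
    _ = ∫⁻ x, ‖f x * v x‖ₑ ∂μ + ∫⁻ x, ‖g x * v x‖ₑ ∂μ :=
        lintegral_add_left' (hf.mul hv).enorm _
    _ ≤ _ := by
        gcongr
        · exact le_iSup₂_of_le v hv (le_iSup_of_le hvi le_rfl)
        · exact le_iSup₂_of_le v hv (le_iSup_of_le hvi le_rfl)

theorem eOrliczNorm_const_smul {Ψ : ℝ≥0 → ℝ≥0∞} (c : ℂ) (f : α → ℂ) :
    eOrliczNorm Ψ (c • f) μ = ‖c‖ₑ * eOrliczNorm Ψ f μ := by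
  unfold eOrliczNorm
  simp only [ENNReal.mul_iSup]
  refine iSup_congr fun v => iSup_congr fun _ => iSup_congr fun _ => ?_
  rw [← lintegral_const_mul' _ _ enorm_ne_top]
  refine lintegral_congr fun x => ?_
  rw [Pi.smul_apply, smul_eq_mul, mul_assoc, enorm_mul]

theorem MemOrlicz.eOrliczNorm_lt_top (P : YoungPair) {f : α → ℂ} (hf : MemOrlicz P.Φ f μ) :
    eOrliczNorm P.Ψ f μ < ∞ := by
  obtain ⟨hfm, a, ha, hfi⟩ := hf
  refine lt_of_le_of_lt (b := (a : ℝ≥0∞)⁻¹ * (∫⁻ x, P.Φ (a * ‖f x‖₊) ∂μ + 1)) ?_ ?_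
  · refine iSup_le fun v => iSup_le fun hv => iSup_le fun hvi => ?_
    have ha' : (a : ℝ≥0∞) ≠ 0 := by simpa using ha.ne'
    rw [← ENNReal.mul_le_iff_le_inv ha' ENNReal.coe_ne_top,
      ← lintegral_const_mul' _ _ ENNReal.coe_ne_top]
    have hmeas : AEMeasurable (fun x => P.Φ (a * ‖f x‖₊)) μ :=
      P.continuous_Φ.measurable.comp_aemeasurable (hfm.nnnorm.aemeasurable.const_mul a)
    calc ∫⁻ x, (a : ℝ≥0∞) * ‖f x * v x‖ₑ ∂μ
        ≤ ∫⁻ x, (P.Φ (a * ‖f x‖₊) + P.Ψ ‖v x‖₊) ∂μ := by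
          refine lintegral_mono fun x => ?_
          have h := young_inequality P.Φ (a * ‖f x‖₊) ‖v x‖₊
          rw [← P.compl_eq] at h
          refine le_trans (le_of_eq ?_) h
          rw [enorm_mul, enorm_eq_nnnorm, enorm_eq_nnnorm]
          push_cast
          ring
      _ = ∫⁻ x, P.Φ (a * ‖f x‖₊) ∂μ + ∫⁻ x, P.Ψ ‖v x‖₊ ∂μ := lintegral_add_left' hmeas _
      _ ≤ _ := by gcongr
  · exact ENNReal.mul_lt_top (by simpa using ha)
      (ENNReal.add_lt_top.2 ⟨hfi, ENNReal.one_lt_top⟩)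

theorem MemOrlicz.ae_eq_zero (P : YoungPair) {f : α → ℂ} (hf : MemOrlicz P.Φ f μ)
    (h0 : eOrliczNorm P.Ψ f μ = 0) : f =ᵐ[μ] 0 := by
  obtain ⟨hfm, a, ha, hfi⟩ := hf
  have hmeas : AEMeasurable (fun x => P.Φ (a * ‖f x‖₊)) μ :=
    P.continuous_Φ.measurable.comp_aemeasurable (hfm.nnnorm.aemeasurable.const_mul a)
  have hset : ∀ n : ℕ, μ {x | 1 / ((n : ℝ≥0) + 1) ≤ ‖f x‖₊} = 0 := by
    intro n
    set e : ℝ≥0 := 1 / ((n : ℝ≥0) + 1) with he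
    have hepos : 0 < e := by positivity
    set S := {x | e ≤ ‖f x‖₊} with hS
    have hSm : NullMeasurableSet S μ :=
      nullMeasurableSet_le aemeasurable_const hfm.nnnorm.aemeasurable
    have hae : 0 < P.Φ (a * e) := by
      rw [← P.young_Φ.map_zero]
      exact P.strictMono_Φ (by positivity)
    have hfin : μ S ≠ ∞ := by
      intro htop
      have h1 := mul_meas_ge_le_lintegral₀ hmeas (P.Φ (a * e))
      have h2 : S ⊆ {x | P.Φ (a * e) ≤ P.Φ (a * ‖f x‖₊)} := fun x hx =>
        P.strictMono_Φ.monotone (mul_le_mul_right hx a)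
      have h3 : μ {x | P.Φ (a * e) ≤ P.Φ (a * ‖f x‖₊)} = ∞ :=
        top_le_iff.1 (htop ▸ measure_mono h2)
      rw [h3, ENNReal.mul_top hae.ne'] at h1
      exact absurd hfi (not_lt.2 h1)
    -- a small constant `c` with `Ψ c * μ S ≤ 1`
    obtain ⟨c, hc, hc1⟩ : ∃ c : ℝ≥0, 0 < c ∧ P.Ψ c * μ S ≤ 1 := by
      have ht : Tendsto (fun c => P.Ψ c * μ S) (𝓝 0) (𝓝 (P.Ψ 0 * μ S)) :=
        ENNReal.Tendsto.mul_const (P.continuous_Ψ.tendsto 0) (Or.inr hfin)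
      rw [P.young_Ψ.map_zero, zero_mul] at ht
      have hev := (ht.eventually (gt_mem_nhds (zero_lt_one))).filter_mono
        (nhdsWithin_le_nhds (s := Set.Ioi 0))
      obtain ⟨c, h1, h2⟩ := (hev.and self_mem_nhdsWithin).exists
      exact ⟨c, h2, h1.le⟩
    have hle : ∫⁻ x, ‖f x * S.indicator (fun _ => ((c : ℝ) : ℂ)) x‖ₑ ∂μ ≤ 0 := by
      rw [← h0]
      refine le_iSup₂_of_le (S.indicator (fun _ => ((c : ℝ) : ℂ)))
        (aestronglyMeasurable_const.indicator₀ hSm) (le_iSup_of_le ?_ le_rfl)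
      have : ∀ x, P.Ψ ‖S.indicator (fun _ => ((c : ℝ) : ℂ)) x‖₊
          = S.indicator (fun _ => P.Ψ c) x := by
        intro x
        by_cases hx : x ∈ S
        · have : ‖((c : ℝ) : ℂ)‖₊ = c := by ext; simp
          rw [Set.indicator_of_mem hx, Set.indicator_of_mem hx, this]
        · rw [Set.indicator_of_notMem hx, Set.indicator_of_notMem hx, nnnorm_zero,
            P.young_Ψ.map_zero]
      simp only [this]
      rwa [lintegral_indicator_const₀ hSm]
    have hge : (e * c : ℝ≥0∞) * μ S
        ≤ ∫⁻ x, ‖f x * S.indicator (fun _ => ((c : ℝ) : ℂ)) x‖ₑ ∂μ := by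
      rw [← lintegral_indicator_const₀ hSm]
      refine lintegral_mono fun x => ?_
      by_cases hx : x ∈ S
      · have hcn : ‖((c : ℝ) : ℂ)‖ₑ = c := by
          rw [enorm_eq_nnnorm]; congr 1; ext; simp
        rw [Set.indicator_of_mem hx, Set.indicator_of_mem hx, enorm_mul, hcn]
        gcongr
        rw [enorm_eq_nnnorm]
        exact ENNReal.coe_le_coe.2 hx
      · rw [Set.indicator_of_notMem hx]; exact zero_le
    have hz := le_antisymm (hge.trans hle) (zero_le)
    rcases mul_eq_zero.1 hz with h | h
    · exfalso
      rcases mul_eq_zero.1 h with h | h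
      · exact hepos.ne' (by simpa using h)
      · exact hc.ne' (by simpa using h)
    · exact h
  have hU : μ (⋃ n : ℕ, {x | 1 / ((n : ℝ≥0) + 1) ≤ ‖f x‖₊}) = 0 := measure_iUnion_null hset
  refine measure_mono_null (fun x hx => ?_) hU
  have hx' : 0 < ‖f x‖₊ := by simpa [pos_iff_ne_zero] using hx
  obtain ⟨n, hn⟩ := exists_nat_one_div_lt (K := ℝ) (ε := ‖f x‖) (by simpa using hx)
  refine Set.mem_iUnion.2 ⟨n, ?_⟩
  have : ((1 / ((n : ℝ≥0) + 1) : ℝ≥0) : ℝ) ≤ ‖f x‖ := by push_cast; exact hn.le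
  exact_mod_cast this

instance (P : YoungPair) : Norm (OrliczSpace μ P) where
  norm f := (eOrliczNorm P.Ψ (f : α →ₘ[μ] ℂ) μ).toReal

theorem OrliczSpace.norm_def (P : YoungPair) (f : OrliczSpace μ P) :
    ‖f‖ = (eOrliczNorm P.Ψ (f : α →ₘ[μ] ℂ) μ).toReal := rfl

theorem OrliczSpace.core (P : YoungPair) : NormedSpace.Core ℂ (OrliczSpace μ P) where
  norm_nonneg _ := ENNReal.toReal_nonneg
  norm_smul c f := by
    rw [OrliczSpace.norm_def, OrliczSpace.norm_def, Submodule.coe_smul,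
      eOrliczNorm_congr (AEEqFun.coeFn_smul c (f : α →ₘ[μ] ℂ)), eOrliczNorm_const_smul,
      ENNReal.toReal_mul, toReal_enorm]
  norm_triangle f g := by
    have hf := MemOrlicz.eOrliczNorm_lt_top P f.2
    have hg := MemOrlicz.eOrliczNorm_lt_top P g.2
    rw [OrliczSpace.norm_def, OrliczSpace.norm_def, OrliczSpace.norm_def, Submodule.coe_add,
      eOrliczNorm_congr (AEEqFun.coeFn_add (f : α →ₘ[μ] ℂ) g),
      ← ENNReal.toReal_add hf.ne hg.ne]
    exact ENNReal.toReal_mono (ENNReal.add_lt_top.2 ⟨hf, hg⟩).ne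
      (eOrliczNorm_add_le (AEEqFun.aestronglyMeasurable _))
  norm_eq_zero_iff f := by
    constructor
    · intro h
      rw [OrliczSpace.norm_def, ENNReal.toReal_eq_zero_iff] at h
      rcases h with h | h
      · exact Subtype.ext (AEEqFun.ext
          ((MemOrlicz.ae_eq_zero P f.2 h).trans AEEqFun.coeFn_zero.symm))
      · exact absurd h (MemOrlicz.eOrliczNorm_lt_top P f.2).ne
    · rintro rfl
      rw [OrliczSpace.norm_def, Submodule.coe_zero, eOrliczNorm_congr AEEqFun.coeFn_zero]
      simp [eOrliczNorm]

instance (P : YoungPair) : NormedAddCommGroup (OrliczSpace μ P) :=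
  NormedAddCommGroup.ofCore (OrliczSpace.core P)

instance (P : YoungPair) : NormedSpace ℂ (OrliczSpace μ P) :=
  NormedSpace.ofCore (OrliczSpace.core P)

variable (μ) in
/-- `S^Φ(μ)`: the closure in `L^Φ(μ)` of the linear space of step functions, i.e. of the linear
span of the indicator functions of measurable sets that lie in `L^Φ(μ)`. -/
def StepClosure (P : YoungPair) : Submodule ℂ (OrliczSpace μ P) :=
  (Submodule.span ℂ {f : OrliczSpace μ P | ∃ E : Set α, MeasurableSet E ∧
    (f : α →ₘ[μ] ℂ) =ᵐ[μ] E.indicator (fun _ => (1 : ℂ))}).topologicalClosure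

end Orlicz

/-! ### Weighted Orlicz spaces -/

section Weighted

variable {G : Type*} [AddCommGroup G] [TopologicalSpace G] [MeasurableSpace G]

/-- A weight on the (additively written) group `G`; it is only weakly submultiplicative. -/
structure Weight (μ : Measure G) where
  toFun : G → ℝ
  pos : ∀ s, 0 < toFun s
  aemeasurable : AEMeasurable toFun μ
  locallyIntegrable : LocallyIntegrable toFun μ
  map_zero : toFun 0 = 1
  inv_memLp_top : MemLp (fun s => (toFun s)⁻¹) ∞ μ
  submul : ∃ C : ℝ, 0 < C ∧ ∀ s t, toFun (s + t) ≤ C * (toFun s * toFun t)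

instance (μ : Measure G) : CoeFun (Weight μ) fun _ => G → ℝ := ⟨Weight.toFun⟩

variable {μ : Measure G}

/-- The a.e. class of the complex-valued function `ω`. -/
def Weight.toAEEqFun (ω : Weight μ) : G →ₘ[μ] ℂ :=
  AEEqFun.mk (fun s => (ω s : ℂ))
    (Complex.measurable_ofReal.comp_aemeasurable ω.aemeasurable).aestronglyMeasurable

theorem Weight.coeFn_mul (ω : Weight μ) (f : G →ₘ[μ] ℂ) :
    ω.toAEEqFun * f =ᵐ[μ] fun s => (ω s : ℂ) * f s := by
  filter_upwards [AEEqFun.coeFn_mul ω.toAEEqFun f, AEEqFun.coeFn_mk (fun s => (ω s : ℂ))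
    (Complex.measurable_ofReal.comp_aemeasurable ω.aemeasurable).aestronglyMeasurable] with s h1 h2
  rw [h1, Pi.mul_apply]
  exact congrArg (· * f s) h2

/-- Multiplication by `ω` on classes of measurable functions. -/
def Weight.mulMap (ω : Weight μ) : (G →ₘ[μ] ℂ) →ₗ[ℂ] (G →ₘ[μ] ℂ) where
  toFun f := ω.toAEEqFun * f
  map_add' f g := by
    refine AEEqFun.ext ?_
    filter_upwards [ω.coeFn_mul (f + g), ω.coeFn_mul f, ω.coeFn_mul g, AEEqFun.coeFn_add f g,
      AEEqFun.coeFn_add (ω.toAEEqFun * f) (ω.toAEEqFun * g)] with s h1 h2 h3 h4 h5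
    rw [h1, h5, Pi.add_apply, h2, h3, h4, Pi.add_apply, mul_add]
  map_smul' c f := by
    refine AEEqFun.ext ?_
    filter_upwards [ω.coeFn_mul (c • f), ω.coeFn_mul f, AEEqFun.coeFn_smul c f,
      AEEqFun.coeFn_smul c (ω.toAEEqFun * f)] with s h1 h2 h3 h4
    simp only [RingHom.id_apply]
    rw [h1, h4, Pi.smul_apply, h2, h3, Pi.smul_apply, smul_eq_mul, smul_eq_mul, mul_left_comm]

theorem Weight.mulMap_injective (ω : Weight μ) : Function.Injective ω.mulMap := by
  rw [← LinearMap.ker_eq_bot, LinearMap.ker_eq_bot']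
  intro f hf
  refine AEEqFun.ext ?_
  have h0 : (ω.toAEEqFun * f : G →ₘ[μ] ℂ) =ᵐ[μ] (0 : G →ₘ[μ] ℂ) := by
    have : ω.toAEEqFun * f = 0 := hf
    rw [this]
  filter_upwards [ω.coeFn_mul f, h0, AEEqFun.coeFn_zero (α := G) (β := ℂ) (μ := μ)]
    with s h1 h2 h3
  rw [h1, h3] at h2
  rw [h3]
  rcases mul_eq_zero.1 h2 with h | h
  · exact absurd (Complex.ofReal_eq_zero.1 h) (ω.pos s).ne'
  · exact h

/-- The weighted Orlicz space `L^Φ_ω(G) = {f : f ω ∈ L^Φ(G)}`. -/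
def WeightedOrliczSpace (P : YoungPair) (ω : Weight μ) : Submodule ℂ (G →ₘ[μ] ℂ) :=
  (OrliczSpace μ P).comap ω.mulMap

/-- The map `f ↦ f ω` from `L^Φ_ω(G)` to `L^Φ(G)`. -/
def WeightedOrliczSpace.mulWeight (P : YoungPair) (ω : Weight μ) :
    WeightedOrliczSpace P ω →ₗ[ℂ] OrliczSpace μ P :=
  ω.mulMap.restrict (fun _ hf => hf)

theorem WeightedOrliczSpace.mulWeight_injective (P : YoungPair) (ω : Weight μ) :
    Function.Injective (WeightedOrliczSpace.mulWeight P ω) := fun _ _ h =>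
  Subtype.ext (ω.mulMap_injective (congrArg Subtype.val h))

/-- The norm `‖f‖_{Φ,ω} = ‖f ω‖_Φ`. -/
instance (P : YoungPair) (ω : Weight μ) : NormedAddCommGroup (WeightedOrliczSpace P ω) :=
  NormedAddCommGroup.induced _ _ (WeightedOrliczSpace.mulWeight P ω)
    (WeightedOrliczSpace.mulWeight_injective P ω)

instance (P : YoungPair) (ω : Weight μ) : NormedSpace ℂ (WeightedOrliczSpace P ω) :=
  NormedSpace.induced ℂ _ _ (WeightedOrliczSpace.mulWeight P ω)

/-- `S^Φ_ω(G) = {f : f ω ∈ S^Φ(G)}`, a subspace of `L^Φ_ω(G)`. -/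
def WeightedStepClosure (P : YoungPair) (ω : Weight μ) :
    Submodule ℂ (WeightedOrliczSpace P ω) :=
  (StepClosure μ P).comap (WeightedOrliczSpace.mulWeight P ω)

/-- `L^Φ_ω(G)` is a Banach algebra under convolution, with the bounded bilinear product `m`:
for all `f, g ∈ L^Φ_ω(G)` the convolution integral `∫ f(t) g(x - t) dt` converges absolutely for
almost every `x`, and `m f g` is the class of the function `f * g` so obtained. -/
def IsConvolutionProduct (P : YoungPair) (ω : Weight μ)
    (m : WeightedOrliczSpace P ω →L[ℂ] WeightedOrliczSpace P ω →L[ℂ] WeightedOrliczSpace P ω) :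
    Prop :=
  ∀ f g : WeightedOrliczSpace P ω,
    (∀ᵐ x ∂μ, ConvolutionExistsAt (f : G →ₘ[μ] ℂ) (g : G →ₘ[μ] ℂ) x
      (ContinuousLinearMap.mul ℂ ℂ) μ) ∧
    ((m f g : WeightedOrliczSpace P ω) : G →ₘ[μ] ℂ) =ᵐ[μ]
      ((f : G →ₘ[μ] ℂ) ⋆[ContinuousLinearMap.mul ℂ ℂ, μ] (g : G →ₘ[μ] ℂ))

end Weighted

/-! ### Weak amenability -/

section Amenability

variable {A : Type*} [NormedAddCommGroup A] [NormedSpace ℂ A]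

/-- `D : A → A*` is a derivation of the algebra with product `m`:
`D(ab) = a · D(b) + D(a) · b`, where `(a · φ)(c) = φ(ca)` and `(φ · a)(c) = φ(ac)`. -/
def IsDerivation (m : A →L[ℂ] A →L[ℂ] A) (D : A →L[ℂ] A →L[ℂ] ℂ) : Prop :=
  ∀ a b c : A, D (m a b) c = D b (m c a) + D a (m b c)

/-- `D : A → A*` is inner: `D(a) = a · φ - φ · a` for some `φ ∈ A*`. -/
def IsInner (m : A →L[ℂ] A →L[ℂ] A) (D : A →L[ℂ] A →L[ℂ] ℂ) : Prop :=
  ∃ φ : A →L[ℂ] ℂ, ∀ a c : A, D a c = φ (m c a) - φ (m a c)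

/-- Weak amenability: every bounded derivation `A → A*` is inner. -/
def IsWeaklyAmenable (m : A →L[ℂ] A →L[ℂ] A) : Prop :=
  ∀ D : A →L[ℂ] A →L[ℂ] ℂ, IsDerivation m D → IsInner m D

end Amenability

end WeightedOrlicz

end

/-! Write `F * g` for convolution. Formally the derivation is $\langle D(f),g\rangle=\int_U
(f\xi)*g$. Since $\xi(x)=\xi(r)+\xi(x-r)$ under the convolution integral, $f\mapsto f\xi$ obeys the
product rule $(a*b)\xi=(a\xi)*b+a*(b\xi)$, and integrating against $c$ over $U$ gives the derivation
identity (`IsConvolutionProduct.reflConv_mul`, `IsConvolutionProduct.isDerivation`). The algebra is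
commutative, so inner derivations vanish; it remains to see $D\ne0$, by testing with $\bar\xi$ near
a point where $\xi\ne0$ and with an indicator near the opposite point.

The analytic core is the bound on $\int\!\int_{s+t\in K}|f(s)\xi(s)g(t)|$ for compact $K$. There
$-s=t-(s+t)$, so $\omega(-s)\le C\,\omega(t)\sup_{-K}\omega$, and the integrand is at most a
constant times $|\tilde\xi(s)|\,x\,y$ with $x=|\omega f|(s)$, $y=|\omega g|(t)$. Both growth
hypotheses give $|\tilde\xi(s)|xy\le R(\Phi(x)\Phi(y)+\Phi(x)+h(s)+\Phi(y))$ with $h$ integrable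
(`exists_mul_le_of_case`). The product term is integrated over all $(s,t)$, the others over $s+t\in
K$ at the cost of a factor $\mu(K)$. On the unit ball the modulars $\int\Phi(|\omega f|)$ are at
most 1, because the Orlicz norm dominates the Luxemburg norm (`MemOrlicz.lintegral_Φ_le_one`).
Homogeneity then yields `exists_absForm_le`.

Haar measure need not be σ-finite, and the Borel σ-algebra of $G\times G$ may exceed the product
one, so Fubini needs preparation. Elements of the Orlicz space have σ-finite support, hence Baire
representatives carried by σ-compact sets; for these $(x,t)\mapsto g(x-t)$ is measurable for the
completed product measure on a σ-finite rectangle.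

For $\mathcal S^\Phi_\omega$: bounded functions of compact support form a dense subspace closed
under convolution, so the closure is a subalgebra. The two test functions lie in it, so the
restricted derivation is nonzero as well. -/

noncomputable section

set_option linter.unusedSectionVars false

namespace WeightedOrlicz

open scoped Pointwise

/-! ### Baire representatives of functions with σ-finite support. -/

section Baire

/-- The Baire σ-algebra, generated by the continuous real functions. -/
abbrev baire (X : Type*) [TopologicalSpace X] : MeasurableSpace X :=
  ⨆ φ : C(X, ℝ), (borel ℝ).comap φ

variable {X : Type*} [TopologicalSpace X]

theorem measurable_baire (φ : C(X, ℝ)) : Measurable[baire X] φ := by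
  rw [measurable_iff_comap_le, BorelSpace.measurable_eq (α := ℝ)]
  exact le_iSup (fun φ : C(X, ℝ) => (borel ℝ).comap φ) φ

variable [LocallyCompactSpace X] [T2Space X] [MeasurableSpace X] [BorelSpace X]

/-- A compact set is, up to a null set, a decreasing limit of continuous functions supported in
a fixed compact set. -/
theorem exists_continuous_tendsto_indicator (μ : Measure X) [μ.Regular] {K : Set X}
    (hK : IsCompact K) :
    ∃ (φ : ℕ → C(X, ℝ)) (L : Set X), IsCompact L ∧ (∀ n x, φ n x ∈ Set.Icc (0 : ℝ) 1) ∧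
      (∀ n, ∀ x ∉ L, φ n x = 0) ∧ (∀ n, ∀ x ∈ K, φ n x = 1) ∧
      ∀ᵐ x ∂μ, x ∉ K → ∀ᶠ n in atTop, φ n x = 0 := by
  have hε : ∀ n : ℕ, ((n : ℝ≥0∞) + 1)⁻¹ ≠ 0 := fun n => by simp
  choose V hKV hVo hVt hV using fun n : ℕ =>
    hK.measurableSet.exists_isOpen_sdiff_lt (μ := μ) hK.measure_lt_top.ne (hε n)
  obtain ⟨L, hL, hKL⟩ := exists_compact_superset hK
  -- Intersecting the first $n+1$ neighbourhoods makes one missed $V_k$ enough: a point outside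
  -- $V_k$ is a zero of every `φ n` with $n\ge k$.
  set W : ℕ → Set X := fun n => interior L ∩ ⋂ k ∈ Finset.range (n + 1), V k with hW
  have hWo : ∀ n, IsOpen (W n) := fun n =>
    isOpen_interior.inter (isOpen_biInter_finset fun k _ => hVo k)
  have hKW : ∀ n, K ⊆ W n := fun n => Set.subset_inter hKL (Set.subset_iInter₂ fun k _ => hKV k)
  choose φ h1 h0 _ hI using fun n => exists_continuous_one_zero_of_isCompact hK
    (hWo n).isClosed_compl (Set.disjoint_compl_right_iff_subset.2 (hKW n))
  refine ⟨φ, L, hL, hI, fun n x hx => h0 n fun h => hx (interior_subset h.1),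
    fun n x hx => h1 n hx, ?_⟩
  have hnull : μ (⋂ n, V n \ K) = 0 := by
    refine le_antisymm (ge_of_tendsto' (f := fun n : ℕ => ((n : ℝ≥0∞) + 1)⁻¹) (x := atTop) ?_
      fun n => ((measure_mono (Set.iInter_subset _ n)).trans (hV n).le)) zero_le
    have := (tendsto_add_atTop_iff_nat 1).2 ENNReal.tendsto_inv_nat_nhds_zero
    simpa using this
  filter_upwards [measure_eq_zero_iff_ae_notMem.1 hnull] with x hx hxK
  obtain ⟨k, hk⟩ : ∃ k, x ∉ V k := by
    by_contra! h
    exact hx (Set.mem_iInter.2 fun n => ⟨h n, hxK⟩)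
  filter_upwards [eventually_ge_atTop k] with n hn
  exact h0 n fun h => hk (Set.mem_iInter₂.1 h.2 k (Finset.mem_range.2 (by lia)))

/-- The set where all the approximating functions equal 1 contains $K$ and lies in their common
compact support. At almost every point outside $K$ they are eventually 0, so the excess is null. -/
theorem exists_baire_ae_eq_of_isCompact (μ : Measure X) [μ.Regular] {K : Set X} (hK : IsCompact K) :
    ∃ E L : Set X, MeasurableSet[baire X] E ∧ IsCompact L ∧ E ⊆ L ∧ E =ᵐ[μ] K := by
  obtain ⟨φ, L, hL, -, hφL, h1, h0⟩ := exists_continuous_tendsto_indicator μ hK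
  refine ⟨⋂ n, φ n ⁻¹' {1}, L, ?_, hL, ?_, ?_⟩
  · exact MeasurableSet.iInter fun n => measurable_baire (φ n) (measurableSet_singleton _)
  · intro x hx
    by_contra hxL
    have := Set.mem_iInter.1 hx 0
    simp [hφL 0 x hxL] at this
  · filter_upwards [h0] with x hx
    refine propext ⟨fun h => ?_, fun h => Set.mem_iInter.2 fun n => h1 n x h⟩
    by_contra hxK
    obtain ⟨n, hn⟩ := (hx hxK).exists
    have h2 : φ n x = 1 := Set.mem_iInter.1 h n
    rw [hn] at h2
    exact zero_ne_one h2

/-- By inner regularity, countably many compact subsets exhaust $A$ up to a null set; the union of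
their Baire versions does the rest. -/
theorem exists_baire_ae_eq_of_measure_ne_top (μ : Measure X) [μ.Regular] {A : Set X}
    (hA : MeasurableSet A) (hμA : μ A ≠ ∞) :
    ∃ E S : Set X, MeasurableSet[baire X] E ∧ IsSigmaCompact S ∧ E ⊆ S ∧ E =ᵐ[μ] A := by
  have hε : ∀ n : ℕ, ((n : ℝ≥0∞) + 1)⁻¹ ≠ 0 := fun n => by simp
  choose K hKA hK hlt using fun n : ℕ => hA.exists_isCompact_sdiff_lt (μ := μ) hμA (hε n)
  choose E L hE hL hEL hEK using fun n => exists_baire_ae_eq_of_isCompact μ (hK n)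
  refine ⟨⋃ n, E n, ⋃ n, L n, MeasurableSet.iUnion hE,
    isSigmaCompact_iUnion_of_isCompact L hL, Set.iUnion_mono hEL, ?_⟩
  refine (Filter.EventuallyEq.countable_iUnion hEK).trans ?_
  have hnull : μ (A \ ⋃ n, K n) = 0 := by
    refine le_antisymm (ge_of_tendsto' (f := fun n : ℕ => ((n : ℝ≥0∞) + 1)⁻¹) (x := atTop) ?_
      fun n => (measure_mono (Set.sdiff_subset_sdiff_right (Set.subset_iUnion K n))).trans
        (hlt n).le) zero_le
    have := (tendsto_add_atTop_iff_nat 1).2 ENNReal.tendsto_inv_nat_nhds_zero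
    simpa using this
  filter_upwards [measure_eq_zero_iff_ae_notMem.1 hnull] with x hx
  refine propext ⟨fun h => Set.iUnion_subset hKA h, fun h => ?_⟩
  by_contra h'
  exact hx ⟨h, h'⟩

/-- A measurable function with σ-finite support agrees almost everywhere with a Baire function
supported in a σ-compact set. -/
theorem exists_baire_rep (μ : Measure X) [μ.Regular] {f : X → ℂ}
    (hf : AEFinStronglyMeasurable f μ) :
    ∃ (g : X → ℂ) (S : Set X), Measurable[baire X] g ∧ IsSigmaCompact S ∧ (∀ x ∉ S, g x = 0) ∧
      f =ᵐ[μ] g := by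
  obtain ⟨f', ⟨s, hs, hlim⟩, hff'⟩ := hf
  have key : ∀ n, ∃ (g : X → ℂ) (S : Set X), Measurable[baire X] g ∧ IsSigmaCompact S ∧
      (∀ x ∉ S, g x = 0) ∧ s n =ᵐ[μ] g := by
    intro n
    have hfin : ∀ y : ℂ, y ≠ 0 → μ (s n ⁻¹' {y}) ≠ ∞ := fun y hy =>
      ((measure_mono fun x (hx : s n x = y) => by
        rw [Function.mem_support, hx]; exact hy).trans_lt (hs n)).ne
    choose! E S hE hS hES hEs using fun (y : ℂ) (hy : y ≠ 0) =>
      exists_baire_ae_eq_of_measure_ne_top μ ((s n).measurableSet_preimage {y}) (hfin y hy)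
    -- The value 0 is left out, since its fibre may have infinite measure.
    set R := (s n).range.filter (· ≠ 0) with hR
    refine ⟨fun x => ∑ y ∈ R, (E y).indicator (fun _ => y) x, ⋃ y ∈ (R : Set ℂ), S y, ?_, ?_, ?_, ?_⟩
    · refine Finset.measurable_sum R fun y hy => ?_
      exact Measurable.indicator measurable_const (hE y (Finset.mem_filter.1 hy).2)
    · exact isSigmaCompact_biUnion R.countable_toSet fun y hy => hS y (Finset.mem_filter.1 hy).2
    · intro x hx
      refine Finset.sum_eq_zero fun y hy => Set.indicator_of_notMem (fun h => hx ?_) _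
      exact Set.mem_biUnion (Finset.mem_coe.2 hy) (hES y (Finset.mem_filter.1 hy).2 h)
    · have : ∀ᵐ x ∂μ, ∀ y ∈ R, (x ∈ E y ↔ s n x = y) := by
        rw [Finset.eventually_all]
        intro y hy
        filter_upwards [hEs y (Finset.mem_filter.1 hy).2] with x hx
        exact iff_of_eq hx
      filter_upwards [this] with x hx
      by_cases h0 : s n x = 0
      · rw [h0, eq_comm]
        refine Finset.sum_eq_zero fun y hy => Set.indicator_of_notMem (fun h => ?_) _
        exact (Finset.mem_filter.1 hy).2 (((hx y hy).1 h).symm.trans h0)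
      · have hmem : s n x ∈ R := Finset.mem_filter.2 ⟨SimpleFunc.mem_range_self _ _, h0⟩
        rw [Finset.sum_eq_single (s n x)]
        · rw [Set.indicator_of_mem ((hx _ hmem).2 rfl)]
        · exact fun y hy hne => Set.indicator_of_notMem (fun h => hne ((hx y hy).1 h).symm) _
        · exact fun h => absurd hmem h
  choose g S hg hS hgS hsg using key
  -- The approximants converge only almost everywhere. The convergence set is itself Baire, so
  -- cutting them off outside it gives a limit at every point that is still Baire measurable.
  set C := {x | ∃ c, Tendsto (fun n => g n x) atTop (𝓝 c)} with hC
  have hCm : MeasurableSet[baire X] C := @measurableSet_exists_tendsto _ ℂ X (baire X) _ _ _ _ _ _ _ _ _ hg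
  have hlim' : ∀ x, ∃ c, Tendsto (fun n => C.indicator (g n) x) atTop (𝓝 c) := by
    intro x
    by_cases hx : x ∈ C
    · obtain ⟨c, hc⟩ := hx
      exact ⟨c, by simpa only [Set.indicator_of_mem (show x ∈ C from ⟨c, hc⟩)] using hc⟩
    · exact ⟨0, by simp only [Set.indicator_of_notMem hx, tendsto_const_nhds]⟩
  choose h hh using hlim'
  refine ⟨h, ⋃ n, S n, ?_, isSigmaCompact_iUnion S hS, ?_, ?_⟩
  · exact @measurable_of_tendsto_metrizable X ℂ (baire X) _ _ _ _ _ _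
      (fun n => (hg n).indicator hCm) (tendsto_pi_nhds.2 hh)
  · intro x hx
    refine tendsto_nhds_unique (hh x) ?_
    have : ∀ n, C.indicator (g n) x = 0 := fun n => by
      exact Set.indicator_apply_eq_zero.2 fun _ => hgS n x fun hn => hx (Set.mem_iUnion.2 ⟨n, hn⟩)
    simp only [this, tendsto_const_nhds]
  · filter_upwards [hff', ae_all_iff.2 hsg] with x hx hsx
    rw [hx]
    have hx2 : Tendsto (fun n => g n x) atTop (𝓝 (f' x)) := by
      simpa only [hsx] using hlim x
    have hxC : x ∈ C := ⟨_, hx2⟩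
    refine tendsto_nhds_unique hx2 ?_
    simpa only [Set.indicator_of_mem hxC] using hh x

end Baire

/-! ### Tonelli and Fubini for convolutions without σ-finiteness of Haar measure. -/

section Fubini

variable {G : Type*} [AddCommGroup G] [TopologicalSpace G] [IsTopologicalAddGroup G]
  [LocallyCompactSpace G] [T2Space G] [MeasurableSpace G] [BorelSpace G]

theorem measurableSet_of_isSigmaCompact {S : Set G} (hS : IsSigmaCompact S) : MeasurableSet S := by
  obtain ⟨K, hK, rfl⟩ := hS
  exact MeasurableSet.iUnion fun n => (hK n).measurableSet

theorem sigmaFinite_restrict_of_isSigmaCompact (μ : Measure G) [μ.Regular] {S : Set G}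
    (hS : IsSigmaCompact S) : SigmaFinite (μ.restrict S) := by
  obtain ⟨K, hK, rfl⟩ := hS
  have hm : MeasurableSet (⋃ n, K n) := MeasurableSet.iUnion fun n => (hK n).measurableSet
  -- The complement is null for the restricted measure; it is added only so that the sets cover the
  -- whole group.
  refine ⟨⟨⟨fun n => K n ∪ (⋃ n, K n)ᶜ, fun _ => trivial, fun n => ?_, ?_⟩⟩⟩
  · rw [Measure.restrict_apply' hm]
    refine (measure_mono ?_).trans_lt (hK n).measure_lt_top
    rintro x ⟨h | h, h'⟩
    · exact h
    · exact absurd h' h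
  · rw [← Set.iUnion_union, Set.union_compl_self]

/-- A continuous function on $G\times G$ need not be measurable for the product σ-algebra, but one
of compact support is. Cut-offs that equal 1 on growing compact squares reduce to that case, and
these squares exhaust $S\times S$. -/
theorem continuous_aemeasurable_prod_restrict (μ : Measure G) [μ.Regular] {S : Set G}
    (hS : IsSigmaCompact S) {φ : G × G → ℝ} (hφ : Continuous φ) :
    AEMeasurable φ ((μ.restrict S).prod (μ.restrict S)) := by
  have := sigmaFinite_restrict_of_isSigmaCompact μ hS
  have hSm := measurableSet_of_isSigmaCompact hS
  obtain ⟨K, hK, hKS⟩ := hS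
  have hK' : ∀ n, IsCompact (⋃ k ∈ Set.Iic n, K k) := fun n =>
    (Set.finite_Iic n).isCompact_biUnion fun k _ => hK k
  choose ψ h1 _ hc _ using fun n => exists_continuous_one_zero_of_isCompact (hK' n)
    isClosed_empty (Set.disjoint_empty _)
  refine aemeasurable_of_tendsto_metrizable_ae atTop
    (f := fun n p => ψ n p.1 * ψ n p.2 * φ p) (fun n => ?_) ?_
  · refine (HasCompactSupport.stronglyMeasurable_of_prod (by fun_prop) ?_).measurable.aemeasurable
    refine HasCompactSupport.intro ((hc n).prod (hc n)) fun p hp => ?_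
    by_cases h : p.1 ∈ tsupport (ψ n)
    · have h2 : p.2 ∉ tsupport (ψ n) := fun h2 => hp ⟨h, h2⟩
      rw [image_eq_zero_of_notMem_tsupport h2, mul_zero, zero_mul]
    · rw [image_eq_zero_of_notMem_tsupport h, zero_mul, zero_mul]
  · have hae : ∀ᵐ p ∂((μ.restrict S).prod (μ.restrict S)), p ∈ S ×ˢ S := by
      filter_upwards [Measure.quasiMeasurePreserving_fst.ae (ae_restrict_mem hSm),
        Measure.quasiMeasurePreserving_snd.ae (ae_restrict_mem hSm)] with p h1 h2
      exact ⟨h1, h2⟩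
    filter_upwards [hae] with p hp
    rw [← hKS] at hp
    obtain ⟨⟨_, ⟨i, rfl⟩, hi⟩, ⟨_, ⟨j, rfl⟩, hj⟩⟩ := hp
    refine tendsto_const_nhds.congr' ?_
    filter_upwards [eventually_ge_atTop (max i j)] with n hn
    have hin : p.1 ∈ ⋃ k ∈ Set.Iic n, K k :=
      Set.mem_biUnion (show i ∈ Set.Iic n from (le_max_left i j).trans hn) hi
    have hjn : p.2 ∈ ⋃ k ∈ Set.Iic n, K k :=
      Set.mem_biUnion (show j ∈ Set.Iic n from (le_max_right i j).trans hn) hj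
    rw [h1 n hin, h1 n hjn]
    simp

/-- The sets whose preimage under $(x,t)\mapsto x-t$ is null-measurable form a σ-algebra. It
contains the generators of the Baire σ-algebra, since $\varphi(x-t)$ is continuous whenever
$\varphi$ is. -/
theorem aestronglyMeasurable_comp_sub_of_baire (μ : Measure G) [μ.Regular] {S : Set G}
    (hS : IsSigmaCompact S) {g : G → ℂ} (hg : Measurable[baire G] g) :
    AEStronglyMeasurable (fun p : G × G => g (p.1 - p.2))
      ((μ.restrict S).prod (μ.restrict S)) := by
  refine (NullMeasurable.aemeasurable (fun s hs => ?_)).aestronglyMeasurable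
  have hle : baire G ≤ MeasurableSpace.map (fun p : G × G => p.1 - p.2)
      (inferInstanceAs (MeasurableSpace
        (NullMeasurableSpace (G × G) ((μ.restrict S).prod (μ.restrict S))))) := by
    refine iSup_le fun φ => ?_
    rw [← BorelSpace.measurable_eq (α := ℝ)]
    rintro _ ⟨t, ht, rfl⟩
    have hc : Continuous fun p : G × G => φ (p.1 - p.2) := by fun_prop
    exact (continuous_aemeasurable_prod_restrict μ hS hc).nullMeasurable ht
  exact hle _ (hg hs)

/-- Representatives of `f` and `g` for which `(x, t) ↦ f t * g (x - t)` is measurable for the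
product σ-algebra and carried by a σ-finite rectangle. -/
theorem exists_convolution_rep (μ : Measure G) [μ.Regular] {f g : G → ℂ}
    (hf : AEFinStronglyMeasurable f μ) (hg : AEFinStronglyMeasurable g μ) :
    ∃ (f' g' : G → ℂ) (S : Set G), IsSigmaCompact S ∧ f =ᵐ[μ] f' ∧ g =ᵐ[μ] g' ∧
      (∀ t ∉ S, f' t = 0) ∧ (∀ x ∉ S, ∀ t, f' t * g' (x - t) = 0) ∧
      AEStronglyMeasurable (fun p : G × G => g' (p.1 - p.2))
        ((μ.restrict S).prod (μ.restrict S)) := by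
  obtain ⟨f', A, -, hA, hfA, hff⟩ := exists_baire_rep μ hf
  obtain ⟨g', B, hg', hB, hgB, hgg⟩ := exists_baire_rep μ hg
  -- If $f'(t)g'(x-t)\ne0$, then $t\in A$ and $x-t\in B$, so $x\in A+B$. Hence one σ-compact set
  -- $A\cup(A+B)$ can carry both variables.
  have hAB : IsSigmaCompact (A + B) := by
    obtain ⟨K, hK, rfl⟩ := hA
    obtain ⟨L, hL, rfl⟩ := hB
    rw [Set.iUnion_add]
    refine isSigmaCompact_iUnion _ fun i => ?_
    rw [Set.add_iUnion]
    exact isSigmaCompact_iUnion_of_isCompact _ fun j => (hK i).add (hL j)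
  have hS : IsSigmaCompact (A ∪ (A + B)) := by
    rw [Set.union_eq_iUnion]
    exact isSigmaCompact_iUnion _ fun b => by cases b <;> assumption
  refine ⟨f', g', A ∪ (A + B), hS, hff, hgg, fun t ht => hfA t fun h => ht (Or.inl h), ?_,
    aestronglyMeasurable_comp_sub_of_baire μ hS hg'⟩
  intro x hx t
  by_cases ht : t ∈ A
  · rw [hgB (x - t) fun h => hx (Or.inr ⟨t, ht, x - t, h, add_sub_cancel _ _⟩), mul_zero]
  · rw [hfA t ht, zero_mul]

variable (μ : Measure G) [μ.IsAddHaarMeasure] [μ.Regular]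

theorem ae_comp_sub_left {p : G → Prop} (h : ∀ᵐ x ∂μ, p x) (x : G) : ∀ᵐ t ∂μ, p (x - t) :=
  (Measure.measurePreserving_sub_left μ x).quasiMeasurePreserving.ae h

theorem ae_comp_add_right {p : G → Prop} (h : ∀ᵐ x ∂μ, p x) (x : G) : ∀ᵐ t ∂μ, p (t + x) :=
  (measurePreserving_add_right μ x).quasiMeasurePreserving.ae h

/-- Tonelli on the rectangle carrying the Baire representatives, after the translation $x\mapsto
x-t$ for fixed $t$. No σ-finite support is asked of $k$, since the rectangle already confines $x$.
-/
theorem lintegral_mul_lconvolution {k : G → ℝ≥0∞} (hk : AEMeasurable k μ) {f g : G → ℂ}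
    (hf : AEFinStronglyMeasurable f μ) (hg : AEFinStronglyMeasurable g μ) :
    ∫⁻ x, k x * ∫⁻ t, ‖f t‖ₑ * ‖g (x - t)‖ₑ ∂μ ∂μ
      = ∫⁻ t, ‖f t‖ₑ * ∫⁻ x, k (x + t) * ‖g x‖ₑ ∂μ ∂μ := by
  obtain ⟨f', g', S, hS, hff, hgg, hfS, hfgS, hm⟩ := exists_convolution_rep μ hf hg
  have hSm := measurableSet_of_isSigmaCompact hS
  have := sigmaFinite_restrict_of_isSigmaCompact μ hS
  have hfm : AEMeasurable (fun t => ‖f' t‖ₑ) (μ.restrict S) :=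
    (hf.aemeasurable.congr hff).enorm.restrict
  have hgm : AEMeasurable (fun t => ‖g' t‖ₑ) μ := (hg.aemeasurable.congr hgg).enorm
  have h1 : ∫⁻ x, k x * ∫⁻ t, ‖f t‖ₑ * ‖g (x - t)‖ₑ ∂μ ∂μ
      = ∫⁻ x in S, ∫⁻ t in S, k x * (‖f' t‖ₑ * ‖g' (x - t)‖ₑ) ∂μ ∂μ := by
    have hin : ∀ x, ∫⁻ t, ‖f t‖ₑ * ‖g (x - t)‖ₑ ∂μ
        = ∫⁻ t in S, ‖f' t‖ₑ * ‖g' (x - t)‖ₑ ∂μ := by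
      intro x
      rw [← lintegral_indicator hSm]
      refine lintegral_congr_ae ?_
      filter_upwards [hff, ae_comp_sub_left μ hgg x] with t h1 h2
      rw [h1, h2]
      by_cases ht : t ∈ S
      · rw [Set.indicator_of_mem ht]
      · rw [Set.indicator_of_notMem ht, hfS t ht, enorm_zero, zero_mul]
    simp only [hin]
    rw [← lintegral_indicator hSm]
    refine lintegral_congr fun x => ?_
    by_cases hx : x ∈ S
    · rw [Set.indicator_of_mem hx, lintegral_const_mul'' _]
      refine hfm.mul ?_
      exact (hgm.comp_quasiMeasurePreserving
        (Measure.measurePreserving_sub_left μ x).quasiMeasurePreserving).restrict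
    · rw [Set.indicator_of_notMem hx]
      have : ∀ t, ‖f' t‖ₑ * ‖g' (x - t)‖ₑ = 0 := fun t => by
        rw [← enorm_mul, hfgS x hx t, enorm_zero]
      simp [this]
  have h2 : ∫⁻ t, ‖f t‖ₑ * ∫⁻ x, k (x + t) * ‖g x‖ₑ ∂μ ∂μ
      = ∫⁻ t in S, ∫⁻ x in S, k x * (‖f' t‖ₑ * ‖g' (x - t)‖ₑ) ∂μ ∂μ := by
    rw [← lintegral_indicator hSm]
    refine lintegral_congr_ae ?_
    filter_upwards [hff] with t ht
    by_cases htS : t ∈ S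
    · rw [Set.indicator_of_mem htS, ht, ← lintegral_indicator hSm]
      rw [← lintegral_const_mul' _ _ enorm_ne_top]
      rw [← lintegral_sub_right_eq_self _ t]
      refine lintegral_congr_ae ?_
      have hgt : ∀ᵐ x ∂μ, g (x - t) = g' (x - t) :=
        (measurePreserving_sub_right μ t).quasiMeasurePreserving.ae hgg
      filter_upwards [hgt] with x hx
      rw [sub_add_cancel, hx]
      by_cases hxS : x ∈ S
      · rw [Set.indicator_of_mem hxS, mul_left_comm]
      · rw [Set.indicator_of_notMem hxS, mul_left_comm, ← enorm_mul, hfgS x hxS t, enorm_zero,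
          mul_zero]
    · rw [Set.indicator_of_notMem htS, ht, hfS t htS, enorm_zero, zero_mul]
  rw [h1, h2]
  refine lintegral_lintegral_swap ?_
  exact hk.restrict.comp_fst.mul (hfm.comp_snd.mul hm.enorm)

/-- The Fubini counterpart of `lintegral_mul_lconvolution`. The finiteness assumption says nothing
about the inner integral where $k$ vanishes, hence the restriction $k(x)\ne0$ in the first
conclusion. -/
theorem integral_mul_convolution {k f g : G → ℂ} (hk : AEStronglyMeasurable k μ)
    (hf : AEFinStronglyMeasurable f μ) (hg : AEFinStronglyMeasurable g μ)
    (hfin : ∫⁻ x, ‖k x‖ₑ * ∫⁻ t, ‖f t‖ₑ * ‖g (x - t)‖ₑ ∂μ ∂μ < ∞) :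
    (∀ᵐ x ∂μ, k x ≠ 0 → Integrable (fun t => f t * g (x - t)) μ) ∧
    Integrable (fun t => f t * ∫ x, k (x + t) * g x ∂μ) μ ∧
    Integrable (fun x => k x * ∫ t, f t * g (x - t) ∂μ) μ ∧
    ∫ x, k x * ∫ t, f t * g (x - t) ∂μ ∂μ = ∫ t, f t * ∫ x, k (x + t) * g x ∂μ ∂μ := by
  obtain ⟨f', g', S, hS, hff, hgg, hfS, hfgS, hm⟩ := exists_convolution_rep μ hf hg
  have hSm := measurableSet_of_isSigmaCompact hS
  have := sigmaFinite_restrict_of_isSigmaCompact μ hS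
  have hfm : AEStronglyMeasurable f' μ := (hf.aemeasurable.congr hff).aestronglyMeasurable
  have hgm : AEStronglyMeasurable g' μ := (hg.aemeasurable.congr hgg).aestronglyMeasurable
  have hin : ∀ x, (fun t => f t * g (x - t)) =ᵐ[μ] fun t => f' t * g' (x - t) := by
    intro x
    filter_upwards [hff, ae_comp_sub_left μ hgg x] with t h1 h2
    rw [h1, h2]
  have hzero : ∀ x, ∀ t ∉ S, f' t * g' (x - t) = 0 := fun x t ht => by rw [hfS t ht, zero_mul]
  have hFm : AEStronglyMeasurable (Function.uncurry fun x t => k x * (f' t * g' (x - t)))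
      ((μ.restrict S).prod (μ.restrict S)) :=
    hk.restrict.comp_fst.mul (hfm.restrict.comp_snd.mul hm)
  have hFi : Integrable (Function.uncurry fun x t => k x * (f' t * g' (x - t)))
      ((μ.restrict S).prod (μ.restrict S)) := by
    refine ⟨hFm, ?_⟩
    rw [hasFiniteIntegral_iff_enorm, lintegral_prod _ hFm.enorm]
    refine lt_of_le_of_lt ?_ hfin
    refine (setLIntegral_le_lintegral S _).trans (lintegral_mono fun x => ?_)
    simp only [Function.uncurry_apply_pair, enorm_mul]
    rw [lintegral_const_mul' _ _ enorm_ne_top]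
    gcongr ‖k x‖ₑ * ?_
    refine (setLIntegral_le_lintegral S _).trans (le_of_eq (lintegral_congr_ae ?_))
    filter_upwards [hin x] with t ht
    rw [← enorm_mul, ← enorm_mul, ht]
  have hx1 : ∀ x, k x * ∫ t, f t * g (x - t) ∂μ
      = S.indicator (fun x => ∫ t in S, k x * (f' t * g' (x - t)) ∂μ) x := by
    intro x
    rw [integral_congr_ae (hin x)]
    by_cases hx : x ∈ S
    · rw [Set.indicator_of_mem hx, integral_const_mul,
        setIntegral_eq_integral_of_forall_compl_eq_zero (hzero x)]
    · rw [Set.indicator_of_notMem hx]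
      simp [hfgS x hx]
  have ht1 : (fun t => f t * ∫ x, k (x + t) * g x ∂μ)
      =ᵐ[μ] S.indicator (fun t => ∫ x in S, k x * (f' t * g' (x - t)) ∂μ) := by
    filter_upwards [hff] with t ht
    have hgt : ∀ᵐ x ∂μ, g (x - t) = g' (x - t) :=
      (measurePreserving_sub_right μ t).quasiMeasurePreserving.ae hgg
    have e1 : f t * ∫ x, k (x + t) * g x ∂μ = ∫ x, k x * (f' t * g' (x - t)) ∂μ := by
      rw [← integral_const_mul, ← integral_sub_right_eq_self _ t]
      refine integral_congr_ae ?_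
      filter_upwards [hgt] with x hx
      rw [sub_add_cancel, hx, ht, mul_left_comm]
    rw [e1]
    by_cases htS : t ∈ S
    · rw [Set.indicator_of_mem htS, setIntegral_eq_integral_of_forall_compl_eq_zero]
      exact fun x hx => by rw [hfgS x hx, mul_zero]
    · rw [Set.indicator_of_notMem htS]
      simp [hfS t htS]
  refine ⟨?_, ?_, ?_, ?_⟩
  · have h1 := hFi.prod_right_ae
    rw [ae_restrict_iff' hSm] at h1
    filter_upwards [h1] with x hx hkx
    refine (integrable_congr (hin x)).2 ?_
    by_cases hxS : x ∈ S
    · have h2 := (hx hxS).const_mul (k x)⁻¹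
      simp only [Function.uncurry_apply_pair, inv_mul_cancel_left₀ hkx] at h2
      exact (integrableOn_iff_integrable_of_support_subset fun t ht => by
        by_contra h; exact ht (hzero x t h)).1 h2
    · simp [hfgS x hxS]
  · refine (integrable_congr ht1).2 ((integrable_indicator_iff hSm).2 ?_)
    exact hFi.integral_prod_right
  · refine (integrable_congr (Eventually.of_forall hx1)).2 ((integrable_indicator_iff hSm).2 ?_)
    exact hFi.integral_prod_left
  · rw [integral_congr_ae ht1, integral_congr_ae (Eventually.of_forall hx1),
      integral_indicator hSm, integral_indicator hSm]
    exact integral_integral_swap hFi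

end Fubini

/-! ### Pointwise inequalities for a complementary pair. -/

section YoungPair

variable (P : YoungPair)

theorem YoungPair.Φ_ne_top (x : ℝ≥0) : P.Φ x ≠ ∞ :=
  ((P.strictMono_Φ (lt_add_one x)).trans_le le_top).ne

theorem YoungPair.Ψ_ne_top (x : ℝ≥0) : P.Ψ x ≠ ∞ :=
  ((P.strictMono_Ψ (lt_add_one x)).trans_le le_top).ne

theorem YoungPair.young (x y : ℝ≥0) : ((x * y : ℝ≥0) : ℝ≥0∞) ≤ P.Φ x + P.Ψ y := by
  have h := young_inequality P.Φ x y
  rwa [← P.compl_eq] at h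

/-- The extension of $\Phi$ by 0 to the negative axis is convex, being a monotone convex function of
the positive part. On $\mathbb R$ the theory of one-sided derivatives of convex functions then
applies. -/
theorem YoungPair.convexOn_real :
    ConvexOn ℝ Set.univ fun r : ℝ => (P.Φ r.toNNReal).toReal := by
  refine ⟨convex_univ, fun x _ y _ a b ha hb hab => ?_⟩
  lift a to ℝ≥0 using ha
  lift b to ℝ≥0 using hb
  have hab' : a + b = 1 := by exact_mod_cast hab
  have h1 := P.young_Φ.convex.2 (Set.mem_univ x.toNNReal) (Set.mem_univ y.toNNReal)
    (zero_le (a := a)) (zero_le (a := b)) hab'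
  have h2 : ((a : ℝ) • x + (b : ℝ) • y).toNNReal ≤ a • x.toNNReal + b • y.toNNReal := by
    rw [Real.toNNReal_le_iff_le_coe]
    simp only [smul_eq_mul, NNReal.coe_add, NNReal.coe_mul]
    gcongr <;> exact Real.le_coe_toNNReal _
  have h3 := (P.strictMono_Φ.monotone h2).trans h1
  have hx := P.Φ_ne_top x.toNNReal
  have hy := P.Φ_ne_top y.toNNReal
  have htop : a • P.Φ x.toNNReal + b • P.Φ y.toNNReal ≠ ∞ := by
    simp only [ENNReal.smul_def, smul_eq_mul]
    exact ENNReal.add_ne_top.2 ⟨ENNReal.mul_ne_top ENNReal.coe_ne_top hx,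
      ENNReal.mul_ne_top ENNReal.coe_ne_top hy⟩
  have h4 := ENNReal.toReal_mono htop h3
  refine h4.trans (le_of_eq ?_)
  simp only [ENNReal.smul_def, smul_eq_mul]
  rw [ENNReal.toReal_add (ENNReal.mul_ne_top ENNReal.coe_ne_top hx)
      (ENNReal.mul_ne_top ENNReal.coe_ne_top hy), ENNReal.toReal_mul, ENNReal.toReal_mul]
  simp

/-- Equality is attained in Young's inequality. -/
theorem YoungPair.exists_young_eq (x : ℝ≥0) :
    ∃ y : ℝ≥0, P.Φ x + P.Ψ y ≤ ((x * y : ℝ≥0) : ℝ≥0∞) := by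
  set φ : ℝ → ℝ := fun r => (P.Φ r.toNNReal).toReal with hφ
  have hc : ConvexOn ℝ Set.univ φ := P.convexOn_real
  have hmono : Monotone φ := fun r s hrs =>
    ENNReal.toReal_mono (P.Φ_ne_top _) (P.strictMono_Φ.monotone (Real.toNNReal_mono hrs))
  have hxi : (x : ℝ) ∈ interior (Set.univ : Set ℝ) := by simp
  -- The right derivative at $x$ is the slope of a supporting line; this slope is the required $y$.
  set c := derivWithin φ (Set.Ioi (x : ℝ)) x with hcdef
  have hsub : ∀ z : ℝ, φ x + c * (z - x) ≤ φ z := by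
    intro z
    rcases lt_trichotomy (x : ℝ) z with h | h | h
    · have := hc.rightDeriv_le_slope_of_mem_interior hxi (Set.mem_univ z) h
      rw [slope_def_field, le_div_iff₀ (sub_pos.2 h)] at this
      linarith
    · rw [← h]; simp
    · have h1 := hc.slope_le_leftDeriv_of_mem_interior (Set.mem_univ z) hxi h
      have h2 := hc.leftDeriv_le_rightDeriv_of_mem_interior hxi
      have := h1.trans h2
      rw [slope_def_field, div_le_iff₀ (sub_pos.2 h)] at this
      linarith
  have hc0 : 0 ≤ c := by
    have h1 := hsub (x - 1)
    have h2 := hmono (show (x : ℝ) - 1 ≤ x by linarith)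
    linarith
  lift c to ℝ≥0 using hc0 with y hy
  refine ⟨y, ?_⟩
  rw [P.compl_eq, complementary, ENNReal.add_iSup]
  refine iSup_le fun z => ?_
  have h1 := hsub z
  simp only [hφ, Real.toNNReal_coe] at h1
  obtain ⟨p, hp⟩ : ∃ r : ℝ≥0, (r : ℝ≥0∞) = P.Φ x :=
    ⟨_, ENNReal.coe_toNNReal (P.Φ_ne_top x)⟩
  obtain ⟨q, hq⟩ : ∃ r : ℝ≥0, (r : ℝ≥0∞) = P.Φ z :=
    ⟨_, ENNReal.coe_toNNReal (P.Φ_ne_top z)⟩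
  rw [← hp, ← hq] at h1 ⊢
  simp only [ENNReal.coe_toReal] at h1
  norm_cast
  -- Where the subtraction in the supremum is truncated to 0, the claim becomes $\Phi(x)\le xy$,
  -- which is the supporting line inequality at 0.
  rcases le_total (z * y) q with h | h
  · rw [tsub_eq_zero_of_le h, add_zero, ← NNReal.coe_le_coe]
    have h' : (z * y : ℝ) ≤ q := by exact_mod_cast h
    have h0 := hsub 0
    simp only [hφ, Real.toNNReal_coe, Real.toNNReal_zero, P.young_Φ.map_zero, ← hp,
      ENNReal.coe_toReal, ENNReal.toReal_zero] at h0
    push_cast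
    linarith
  · rw [← NNReal.coe_le_coe]
    push_cast [NNReal.coe_sub h]
    linarith

/-- Convexity of $\Psi(\sqrt\cdot)$ gives $\Psi(y)\le cy^2$ on $[0,1]$ with $c=\Psi(1)$. Young's
inequality for $x$ and $\kappa y$ then reads $\kappa xy\le\Phi(x)+c\kappa^2y^2$; take $y=x$ if
$x\le1$ and $y=1$ otherwise. -/
theorem YoungPair.exists_min_sq_le (h : IsYoung fun x => P.Ψ (NNReal.sqrt x)) :
    ∃ C : ℝ≥0, ∀ x : ℝ≥0, ((min x (x ^ 2) : ℝ≥0) : ℝ≥0∞) ≤ C * P.Φ x := by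
  obtain ⟨c, hc⟩ : ∃ r : ℝ≥0, (r : ℝ≥0∞) = P.Ψ 1 :=
    ⟨_, ENNReal.coe_toNNReal (P.Ψ_ne_top 1)⟩
  have hsq : ∀ y : ℝ≥0, y ≤ 1 → P.Ψ y ≤ ((y ^ 2 * c : ℝ≥0) : ℝ≥0∞) := by
    intro y hy
    have hy2 : y ^ 2 ≤ 1 := pow_le_one₀ zero_le hy
    have h1 := h.convex.2 (Set.mem_univ (1 : ℝ≥0)) (Set.mem_univ (0 : ℝ≥0))
      (zero_le (a := y ^ 2)) (zero_le (a := 1 - y ^ 2)) (add_tsub_cancel_of_le hy2)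
    simp only [smul_eq_mul, mul_one, mul_zero, add_zero, NNReal.sqrt_sq, NNReal.sqrt_one,
      NNReal.sqrt_zero, P.young_Ψ.map_zero, smul_zero] at h1
    rw [← hc] at h1
    simpa [ENNReal.smul_def] using h1
  -- This choice makes $c\kappa^2\le\kappa/2$, so the quadratic term absorbs at most half of the
  -- left-hand side, and $\kappa\le1$ keeps $\kappa y$ in $[0,1]$.
  set κ : ℝ≥0 := (2 * c + 1)⁻¹ with hκ
  have hκ0 : 0 < κ := by positivity
  have hκ1 : κ ≤ 1 := inv_le_one_of_one_le₀ (by simp)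
  have hκc : κ * (2 * c + 1) = 1 := inv_mul_cancel₀ (by positivity)
  refine ⟨2 / κ, fun x => ?_⟩
  obtain ⟨p, hp⟩ : ∃ r : ℝ≥0, (r : ℝ≥0∞) = P.Φ x :=
    ⟨_, ENNReal.coe_toNNReal (P.Φ_ne_top x)⟩
  have hcκ : (κ : ℝ) * (2 * c + 1) = 1 := by exact_mod_cast hκc
  have hκ0' : (0 : ℝ) < κ := by exact_mod_cast hκ0
  have hc0 : (0 : ℝ) ≤ c := c.2
  have key : ∀ y : ℝ≥0, y ≤ 1 → (x * (κ * y) : ℝ) ≤ p + (κ * y) ^ 2 * c := by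
    intro y hy
    have h1 := (P.young x (κ * y)).trans (add_le_add_right
      (hsq (κ * y) (mul_le_one' hκ1 hy)) _)
    rw [← hp] at h1
    exact_mod_cast h1
  have hκ2c : (κ : ℝ) ^ 2 * c ≤ κ / 2 := by nlinarith
  rw [← hp]
  norm_cast
  rw [div_mul_eq_mul_div, le_div_iff₀ hκ0, ← NNReal.coe_le_coe]
  rcases le_total x 1 with hx | hx
  · have h1 := key x hx
    have h2 : (min x (x ^ 2) : ℝ≥0) ≤ x ^ 2 := min_le_right _ _
    have h3 : ((min x (x ^ 2) : ℝ≥0) : ℝ) ≤ (x : ℝ) ^ 2 := by exact_mod_cast h2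
    push_cast at h3 ⊢
    nlinarith [mul_le_mul_of_nonneg_right hκ2c (sq_nonneg (x : ℝ))]
  · have h1 := key 1 le_rfl
    have h2 : (min x (x ^ 2) : ℝ≥0) ≤ x := min_le_left _ _
    have h3 : ((min x (x ^ 2) : ℝ≥0) : ℝ) ≤ (x : ℝ) := by exact_mod_cast h2
    have hx' : (1 : ℝ) ≤ x := by exact_mod_cast hx
    push_cast at h1 h3 ⊢
    nlinarith

end YoungPair

/-! ### Orlicz norm, modular, and dominated convergence. -/

section OrliczNorm

variable {α : Type*} [MeasurableSpace α] {μ : Measure α} (P : YoungPair)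

/-- Young's inequality for $a|f|$ and the test function. With $a$ large it turns convergence of
modulars into convergence in norm. -/
theorem eOrliczNorm_le_modular {f : α → ℂ} (hf : AEStronglyMeasurable f μ) {a : ℝ≥0}
    (ha : 0 < a) :
    eOrliczNorm P.Ψ f μ ≤ (a : ℝ≥0∞)⁻¹ * (∫⁻ x, P.Φ (a * ‖f x‖₊) ∂μ + 1) := by
  refine iSup_le fun v => iSup_le fun hv => iSup_le fun hvi => ?_
  have ha' : (a : ℝ≥0∞) ≠ 0 := by simpa using ha.ne'
  rw [← ENNReal.mul_le_iff_le_inv ha' ENNReal.coe_ne_top,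
    ← lintegral_const_mul' _ _ ENNReal.coe_ne_top]
  have hmeas : AEMeasurable (fun x => P.Φ (a * ‖f x‖₊)) μ :=
    P.continuous_Φ.measurable.comp_aemeasurable (hf.nnnorm.aemeasurable.const_mul a)
  calc ∫⁻ x, (a : ℝ≥0∞) * ‖f x * v x‖ₑ ∂μ
      ≤ ∫⁻ x, (P.Φ (a * ‖f x‖₊) + P.Ψ ‖v x‖₊) ∂μ := by
        refine lintegral_mono fun x => ?_
        refine le_trans (le_of_eq ?_) (P.young (a * ‖f x‖₊) ‖v x‖₊)
        rw [enorm_mul, enorm_eq_nnnorm, enorm_eq_nnnorm]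
        push_cast
        ring
    _ = ∫⁻ x, P.Φ (a * ‖f x‖₊) ∂μ + ∫⁻ x, P.Ψ ‖v x‖₊ ∂μ := lintegral_add_left' hmeas _
    _ ≤ _ := by gcongr

theorem lintegral_mul_le_eOrliczNorm {Ψ : ℝ≥0 → ℝ≥0∞} {f : α → ℂ} {v : α → ℝ≥0}
    (hv : Measurable v) (hvi : ∫⁻ x, Ψ (v x) ∂μ ≤ 1) :
    ∫⁻ x, ‖f x‖ₑ * v x ∂μ ≤ eOrliczNorm Ψ f μ := by
  have hn : ∀ x, ‖((v x : ℝ) : ℂ)‖₊ = v x := fun x => by ext; simp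
  have h1 : ∫⁻ x, ‖f x‖ₑ * v x ∂μ = ∫⁻ x, ‖f x * ((v x : ℝ) : ℂ)‖ₑ ∂μ := by
    refine lintegral_congr fun x => ?_
    rw [enorm_mul, enorm_eq_nnnorm ((v x : ℝ) : ℂ), hn]
  rw [h1]
  refine le_iSup₂_of_le (fun x => ((v x : ℝ) : ℂ)) ?_ (le_iSup_of_le ?_ le_rfl)
  · exact (Complex.measurable_ofReal.comp hv.coe_nnreal_real).aestronglyMeasurable
  · simpa only [hn] using hvi

theorem YoungPair.Ψ_div_le {N : ℝ≥0} (hN : 1 ≤ N) (y : ℝ≥0) :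
    P.Ψ (y / N) ≤ (N : ℝ≥0∞)⁻¹ * P.Ψ y := by
  have hN0 : N ≠ 0 := (zero_lt_one.trans_le hN).ne'
  have hN1 : N⁻¹ ≤ 1 := inv_le_one_of_one_le₀ hN
  have h := P.young_Ψ.convex.2 (Set.mem_univ y) (Set.mem_univ (0 : ℝ≥0))
    (zero_le (a := N⁻¹)) (zero_le (a := 1 - N⁻¹)) (add_tsub_cancel_of_le hN1)
  simp only [smul_eq_mul, mul_zero, add_zero, P.young_Ψ.map_zero, smul_zero, ENNReal.smul_def] at h
  rwa [ENNReal.coe_inv hN0, mul_comm, ← div_eq_mul_inv] at h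

/-- Take $y(s)$ with equality in Young's inequality, so
$\int\Phi(s)+\int\Psi(y(s))\le\int|f|\,y(s)$, and let $N=\int\Psi(y(s))$. If $N\le1$, then $y(s)$ is
an admissible test function and the right side is at most 1. If $N\ge1$, then $y(s)/N$ is
admissible, the right side is at most $N$, and cancelling leaves $\int\Phi(s)\le0$. Simplicity and
finite support make $N$ finite. -/
theorem lintegral_Φ_simpleFunc_le_one {f : α → ℂ} (hn : eOrliczNorm P.Ψ f μ ≤ 1)
    {s : SimpleFunc α ℝ≥0} (hs : ∀ᵐ x ∂μ, s x ≤ ‖f x‖₊) (hfin : s.FinMeasSupp μ) :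
    ∫⁻ x, P.Φ (s x) ∂μ ≤ 1 := by
  choose y hy using P.exists_young_eq
  have hy0 : P.Ψ (y 0) = 0 := by
    have h := hy 0
    rw [zero_mul, ENNReal.coe_zero] at h
    exact le_antisymm (le_add_self.trans h) zero_le
  have hNtop : ∫⁻ x, P.Ψ (y (s x)) ∂μ < ∞ := by
    have h1 : ((s.map fun r => P.Ψ (y r)).lintegral μ) < ∞ :=
      (hfin.map hy0).lintegral_lt_top (Eventually.of_forall fun x => P.Ψ_ne_top _)
    rwa [← SimpleFunc.lintegral_eq_lintegral] at h1
  have hmΦ : AEMeasurable (fun x => P.Φ (s x)) μ :=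
    (P.continuous_Φ.measurable.comp s.measurable).aemeasurable
  have hsum : ∫⁻ x, P.Φ (s x) ∂μ + ∫⁻ x, P.Ψ (y (s x)) ∂μ
      ≤ ∫⁻ x, ‖f x‖ₑ * y (s x) ∂μ := by
    rw [← lintegral_add_left' hmΦ]
    refine lintegral_mono_ae ?_
    filter_upwards [hs] with x hx
    refine (hy (s x)).trans ?_
    rw [enorm_eq_nnnorm, ← ENNReal.coe_mul]
    exact ENNReal.coe_le_coe.2 (by gcongr)
  rcases le_total (∫⁻ x, P.Ψ (y (s x)) ∂μ) 1 with h1 | h1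
  · have h2 := lintegral_mul_le_eOrliczNorm (f := f) (s.map y).measurable h1
    exact le_self_add.trans (hsum.trans (h2.trans hn))
  · lift ∫⁻ x, P.Ψ (y (s x)) ∂μ to ℝ≥0 using hNtop.ne with N hN
    have hN1 : 1 ≤ N := by exact_mod_cast h1
    have hN0 : N ≠ 0 := (zero_lt_one.trans_le hN1).ne'
    have h2 : ∫⁻ x, P.Ψ (y (s x) / N) ∂μ ≤ 1 := by
      calc ∫⁻ x, P.Ψ (y (s x) / N) ∂μ ≤ ∫⁻ x, (N : ℝ≥0∞)⁻¹ * P.Ψ (y (s x)) ∂μ :=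
            lintegral_mono fun x => P.Ψ_div_le hN1 _
        _ = (N : ℝ≥0∞)⁻¹ * N := by
            rw [lintegral_const_mul' _ _ (ENNReal.inv_ne_top.2 (by exact_mod_cast hN0)), hN]
        _ = 1 := ENNReal.inv_mul_cancel (by exact_mod_cast hN0) ENNReal.coe_ne_top
    have h3 := (lintegral_mul_le_eOrliczNorm (f := f) (s.map fun r => y r / N).measurable h2).trans
      hn
    have h4 : ∫⁻ x, ‖f x‖ₑ * y (s x) ∂μ ≤ N := by
      calc ∫⁻ x, ‖f x‖ₑ * y (s x) ∂μ
          = ∫⁻ x, N * (‖f x‖ₑ * ((s.map fun r => y r / N) x : ℝ≥0)) ∂μ := by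
            refine lintegral_congr fun x => ?_
            rw [SimpleFunc.map_apply, mul_left_comm, ← ENNReal.coe_mul, mul_div_cancel₀ _ hN0]
        _ ≤ N * 1 := by
            rw [lintegral_const_mul' _ _ ENNReal.coe_ne_top]
            gcongr
        _ = N := mul_one _
    have h5 : ∫⁻ x, P.Φ (s x) ∂μ + N ≤ 0 + N := by
      rw [zero_add]; exact hsum.trans h4
    exact ((ENNReal.add_le_add_iff_right ENNReal.coe_ne_top).1 h5).trans zero_le_one

/-- The Orlicz norm dominates the Luxemburg norm. -/
theorem MemOrlicz.lintegral_Φ_le_one {f : α → ℂ} (hf : MemOrlicz P.Φ f μ)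
    (hn : eOrliczNorm P.Ψ f μ ≤ 1) : ∫⁻ x, P.Φ ‖f x‖₊ ∂μ ≤ 1 := by
  obtain ⟨hfm, a, ha, hfi⟩ := hf
  have hum : AEMeasurable (fun x => ‖f x‖₊) μ := hfm.nnnorm.aemeasurable
  set u := hum.mk with hu
  have huf : (fun x => ‖f x‖₊) =ᵐ[μ] u := hum.ae_eq_mk
  have hu' : Measurable fun x => (u x : ℝ≥0∞) := hum.measurable_mk.coe_nnreal_ennreal
  set s : ℕ → SimpleFunc α ℝ≥0 := fun n =>
    (SimpleFunc.eapprox (fun x => (u x : ℝ≥0∞)) n).map ENNReal.toNNReal with hsdef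
  have hsu : ∀ n x, s n x ≤ u x := fun n x => by
    have h : SimpleFunc.eapprox (fun x => (u x : ℝ≥0∞)) n x ≤ u x := by
      rw [← SimpleFunc.iSup_eapprox_apply hu' x]
      exact le_iSup (fun n => SimpleFunc.eapprox (fun x => (u x : ℝ≥0∞)) n x) n
    exact ENNReal.toNNReal_mono ENNReal.coe_ne_top h
  have hmono : ∀ x, Monotone fun n => s n x := fun x n k hnk =>
    ENNReal.toNNReal_mono (SimpleFunc.eapprox_lt_top _ _ _).ne
      (SimpleFunc.monotone_eapprox _ hnk x)
  have hlim : ∀ x, Tendsto (fun n => s n x) atTop (𝓝 (u x)) := fun x =>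
    (ENNReal.tendsto_toNNReal ENNReal.coe_ne_top).comp (SimpleFunc.tendsto_eapprox hu' x)
  have hsf : ∀ n, ∀ᵐ x ∂μ, s n x ≤ ‖f x‖₊ := fun n => by
    filter_upwards [huf] with x hx
    rw [hx]; exact hsu n x
  have hle : ∀ n, ∫⁻ x, P.Φ (s n x) ∂μ ≤ 1 := by
    intro n
    refine lintegral_Φ_simpleFunc_le_one P hn (hsf n) ?_
    -- Finite support of the approximants comes from the finite modular of $a|f|$, since
    -- $\Phi(ar)>0$ for $r>0$.
    have h1 : ((s n).map fun r => P.Φ (a * r)).lintegral μ ≠ ∞ := by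
      rw [← SimpleFunc.lintegral_eq_lintegral]
      refine ((lintegral_mono_ae ?_).trans_lt hfi).ne
      filter_upwards [hsf n] with x hx
      exact P.strictMono_Φ.monotone (by gcongr)
    refine (SimpleFunc.FinMeasSupp.of_lintegral_ne_top h1).of_map fun r hr => ?_
    by_contra h0
    have h2 : P.Φ 0 < P.Φ (a * r) := P.strictMono_Φ (by positivity)
    rw [hr] at h2
    exact not_lt_zero h2
  have hΦlim : Tendsto (fun n => ∫⁻ x, P.Φ (s n x) ∂μ) atTop (𝓝 (∫⁻ x, P.Φ (u x) ∂μ)) := by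
    refine lintegral_tendsto_of_tendsto_of_monotone
      (fun n => (P.continuous_Φ.measurable.comp (s n).measurable).aemeasurable) ?_ ?_
    · exact Eventually.of_forall fun x => P.strictMono_Φ.monotone.comp (hmono x)
    · exact Eventually.of_forall fun x => (P.continuous_Φ.tendsto _).comp (hlim x)
  rw [lintegral_congr_ae (g := fun x => P.Φ (u x))]
  · exact le_of_tendsto' hΦlim hle
  · filter_upwards [huf] with x hx
    rw [hx]

theorem memOrlicz_of_bounded {f : α → ℂ} (hf : AEStronglyMeasurable f μ) {E : Set α}
    (hE : MeasurableSet E) (hμE : μ E ≠ ∞) {M : ℝ≥0}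
    (hM : ∀ᵐ x ∂μ, ‖f x‖₊ ≤ E.indicator (fun _ => M) x) : MemOrlicz P.Φ f μ := by
  refine ⟨hf, 1, one_pos, ?_⟩
  calc ∫⁻ x, P.Φ (1 * ‖f x‖₊) ∂μ ≤ ∫⁻ x, E.indicator (fun _ => P.Φ M) x ∂μ := by
        refine lintegral_mono_ae ?_
        filter_upwards [hM] with x hx
        rw [one_mul]
        by_cases h : x ∈ E
        · rw [Set.indicator_of_mem h] at hx ⊢
          exact P.strictMono_Φ.monotone hx
        · rw [Set.indicator_of_notMem h] at hx ⊢
          rw [le_antisymm hx zero_le, P.young_Φ.map_zero]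
    _ < ∞ := by
        rw [lintegral_indicator_const hE]
        exact ENNReal.mul_lt_top (P.Φ_ne_top M).lt_top hμE.lt_top

/-- Dominated convergence on a set of finite measure. -/
theorem OrliczSpace.tendsto_of_dominated {f : ℕ → OrliczSpace μ P} {g : OrliczSpace μ P}
    {E : Set α} (hE : MeasurableSet E) (hμE : μ E ≠ ∞) {M : ℝ≥0}
    (hM : ∀ n, ∀ᵐ x ∂μ, ‖(f n : α →ₘ[μ] ℂ) x - (g : α →ₘ[μ] ℂ) x‖₊ ≤ E.indicator (fun _ => M) x)
    (hlim : ∀ᵐ x ∂μ, Tendsto (fun n => (f n : α →ₘ[μ] ℂ) x) atTop (𝓝 ((g : α →ₘ[μ] ℂ) x))) :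
    Tendsto f atTop (𝓝 g) := by
  rw [tendsto_iff_norm_sub_tendsto_zero]
  set d : ℕ → α → ℂ := fun n x => (f n : α →ₘ[μ] ℂ) x - (g : α →ₘ[μ] ℂ) x with hd
  have hdm : ∀ n, AEStronglyMeasurable (d n) μ := fun n =>
    (AEEqFun.aestronglyMeasurable _).sub (AEEqFun.aestronglyMeasurable _)
  have hnorm : ∀ n, ‖f n - g‖ = (eOrliczNorm P.Ψ (d n) μ).toReal := fun n => by
    rw [OrliczSpace.norm_def, Submodule.coe_sub, eOrliczNorm_congr (AEEqFun.coeFn_sub _ _)]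
    rfl
  simp only [hnorm]
  rw [← ENNReal.toReal_zero]
  refine (ENNReal.tendsto_toReal ENNReal.zero_ne_top).comp ?_
  rw [ENNReal.tendsto_nhds_zero]
  intro ε hε
  -- As soon as the modular of $a|f_n-g|$ is at most 1, the norm is at most
  -- $a^{-1}(1+1)\le\varepsilon$.
  obtain ⟨a, ha⟩ := ENNReal.exists_nat_gt (r := 2 / ε) (ENNReal.div_ne_top (by simp) hε.ne')
  have ha0 : 0 < (a : ℝ≥0) := by
    have : (0 : ℝ≥0∞) < a := zero_le.trans_lt ha
    exact_mod_cast this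
  have hmod : Tendsto (fun n => ∫⁻ x, P.Φ (a * ‖d n x‖₊) ∂μ) atTop (𝓝 (∫⁻ _, 0 ∂μ)) := by
    refine tendsto_lintegral_of_dominated_convergence' (E.indicator fun _ => P.Φ (a * M))
      (fun n => P.continuous_Φ.measurable.comp_aemeasurable
        ((hdm n).nnnorm.aemeasurable.const_mul _)) (fun n => ?_) ?_ ?_
    · filter_upwards [hM n] with x hx
      change ‖d n x‖₊ ≤ _ at hx
      by_cases h : x ∈ E
      · rw [Set.indicator_of_mem h] at hx ⊢
        exact P.strictMono_Φ.monotone (by gcongr)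
      · rw [Set.indicator_of_notMem h] at hx ⊢
        rw [le_antisymm hx zero_le, mul_zero, P.young_Φ.map_zero]
    · rw [lintegral_indicator_const hE]
      exact ENNReal.mul_ne_top (P.Φ_ne_top _) hμE
    · filter_upwards [hlim] with x hx
      have h1 : Tendsto (fun n => d n x) atTop (𝓝 0) := by
        simpa [hd] using hx.sub_const ((g : α →ₘ[μ] ℂ) x)
      have h2 : Tendsto (fun n => (a : ℝ≥0) * ‖d n x‖₊) atTop (𝓝 (a * ‖(0 : ℂ)‖₊)) :=
        h1.nnnorm.const_mul _
      have h3 := (P.continuous_Φ.tendsto _).comp h2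
      simpa [P.young_Φ.map_zero, Function.comp_def] using h3
  rw [lintegral_zero] at hmod
  filter_upwards [hmod.eventually (gt_mem_nhds (zero_lt_one))] with n hn
  refine (eOrliczNorm_le_modular P (hdm n) ha0).trans ?_
  calc ((a : ℝ≥0) : ℝ≥0∞)⁻¹ * (∫⁻ x, P.Φ (a * ‖d n x‖₊) ∂μ + 1)
      ≤ ((a : ℝ≥0) : ℝ≥0∞)⁻¹ * (1 + 1) := by gcongr
    _ ≤ ε := by
        rw [one_add_one_eq_two, mul_comm, ← div_eq_mul_inv]
        refine ENNReal.div_le_of_le_mul ?_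
        rw [mul_comm]
        refine (ENNReal.div_le_iff_le_mul (Or.inl hε.ne') (Or.inr (by simpa using ha0.ne'))).1 ?_
        simpa using ha.le

/-- The class in `L^Φ(μ)` of a function. -/
def OrliczSpace.ofFun {f : α → ℂ} (hf : MemOrlicz P.Φ f μ) : OrliczSpace μ P :=
  ⟨AEEqFun.mk f hf.1, hf.congr (AEEqFun.coeFn_mk f hf.1).symm⟩

theorem OrliczSpace.coe_ofFun {f : α → ℂ} (hf : MemOrlicz P.Φ f μ) :
    (OrliczSpace.ofFun P hf : α →ₘ[μ] ℂ) =ᵐ[μ] f :=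
  AEEqFun.coeFn_mk f hf.1

theorem memOrlicz_indicator {E : Set α} (hE : MeasurableSet E) (hμE : μ E ≠ ∞) :
    MemOrlicz P.Φ (E.indicator fun _ => (1 : ℂ)) μ := by
  refine memOrlicz_of_bounded P (aestronglyMeasurable_const.indicator hE) hE hμE (M := 1) ?_
  refine Eventually.of_forall fun x => ?_
  by_cases h : x ∈ E <;> simp [h]

theorem MemOrlicz.measure_ne_top {E : Set α} (hE : MeasurableSet E)
    (h : MemOrlicz P.Φ (E.indicator fun _ => (1 : ℂ)) μ) : μ E ≠ ∞ := by
  obtain ⟨-, a, ha, hi⟩ := h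
  have h1 : ∀ x, P.Φ (a * ‖E.indicator (fun _ => (1 : ℂ)) x‖₊) = E.indicator (fun _ => P.Φ a) x := by
    intro x
    by_cases hx : x ∈ E <;> simp [hx, P.young_Φ.map_zero]
  simp only [h1] at hi
  rw [lintegral_indicator_const hE] at hi
  intro htop
  have h2 : P.Φ 0 < P.Φ a := P.strictMono_Φ ha
  rw [P.young_Φ.map_zero] at h2
  rw [htop, ENNReal.mul_top h2.ne'] at hi
  exact lt_irrefl _ hi

theorem indicator_mem_stepClosure {E : Set α} (hE : MeasurableSet E) (hμE : μ E ≠ ∞) :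
    OrliczSpace.ofFun P (memOrlicz_indicator (μ := μ) P hE hμE) ∈ StepClosure μ P :=
  Submodule.le_topologicalClosure _ (Submodule.subset_span ⟨E, hE, OrliczSpace.coe_ofFun P _⟩)

theorem coeFn_finset_sum {ι : Type*} (s : Finset ι) (f : ι → α →ₘ[μ] ℂ) :
    (∑ i ∈ s, f i : α →ₘ[μ] ℂ) =ᵐ[μ] fun x => ∑ i ∈ s, f i x := by
  classical
  induction s using Finset.induction_on with
  | empty =>
    filter_upwards [AEEqFun.coeFn_zero (α := α) (β := ℂ) (μ := μ)] with x hx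
    simpa using hx
  | insert i s hi ih =>
    rw [Finset.sum_insert hi]
    filter_upwards [AEEqFun.coeFn_add (f i) (∑ i ∈ s, f i), ih] with x h1 h2
    rw [h1, Pi.add_apply, h2, Finset.sum_insert hi]

/-- A bounded function carried by a set of finite measure belongs to `S^Φ(μ)`. -/
theorem mem_stepClosure_of_bounded (g : OrliczSpace μ P) {E : Set α} (hE : MeasurableSet E)
    (hμE : μ E ≠ ∞) {M : ℝ≥0}
    (hM : ∀ᵐ x ∂μ, ‖(g : α →ₘ[μ] ℂ) x‖₊ ≤ E.indicator (fun _ => M) x) :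
    g ∈ StepClosure μ P := by
  have hgm : StronglyMeasurable (g : α →ₘ[μ] ℂ) := AEEqFun.stronglyMeasurable _
  set s := hgm.approxBounded (M : ℝ) with hs
  have hsE : ∀ n (y : ℂ), MeasurableSet (s n ⁻¹' {y} ∩ E) := fun n y =>
    ((s n).measurableSet_fiber y).inter hE
  have hμ : ∀ n (y : ℂ), μ (s n ⁻¹' {y} ∩ E) ≠ ∞ := fun n y =>
    ((measure_mono Set.inter_subset_right).trans_lt hμE.lt_top).ne
  set f : ℕ → OrliczSpace μ P := fun n => ∑ y ∈ (s n).range,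
    y • OrliczSpace.ofFun P (memOrlicz_indicator (μ := μ) P (hsE n y) (hμ n y)) with hf
  have hfe : ∀ n, (f n : α →ₘ[μ] ℂ) =ᵐ[μ] E.indicator (s n) := by
    intro n
    rw [hf]
    simp only [Submodule.coe_sum]
    refine (coeFn_finset_sum _ _).trans ?_
    have h1 : ∀ᵐ x ∂μ, ∀ y ∈ (s n).range,
        ((y • OrliczSpace.ofFun P (memOrlicz_indicator (μ := μ) P (hsE n y) (hμ n y)) :
          OrliczSpace μ P) : α →ₘ[μ] ℂ) x
          = y * (s n ⁻¹' {y} ∩ E).indicator (fun _ => (1 : ℂ)) x := by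
      rw [Finset.eventually_all]
      intro y _
      filter_upwards [AEEqFun.coeFn_smul y (OrliczSpace.ofFun P
        (memOrlicz_indicator (μ := μ) P (hsE n y) (hμ n y)) : α →ₘ[μ] ℂ),
        OrliczSpace.coe_ofFun P (memOrlicz_indicator (μ := μ) P (hsE n y) (hμ n y))] with x h1 h2
      rw [Submodule.coe_smul, h1, Pi.smul_apply, h2, smul_eq_mul]
    filter_upwards [h1] with x hx
    rw [Finset.sum_congr rfl hx]
    by_cases hxE : x ∈ E
    · rw [Set.indicator_of_mem hxE, Finset.sum_eq_single (s n x)]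
      · rw [Set.indicator_of_mem (show x ∈ s n ⁻¹' {s n x} ∩ E from ⟨rfl, hxE⟩), mul_one]
      · intro y _ hne
        rw [Set.indicator_of_notMem fun h => hne (show s n x = y from h.1).symm, mul_zero]
      · exact fun h => absurd (SimpleFunc.mem_range_self _ _) h
    · rw [Set.indicator_of_notMem hxE]
      refine Finset.sum_eq_zero fun y _ => ?_
      rw [Set.indicator_of_notMem fun h => hxE h.2, mul_zero]
  have hfS : ∀ n, f n ∈ StepClosure μ P := fun n =>
    Submodule.sum_mem _ fun y _ => Submodule.smul_mem _ _ 
      (indicator_mem_stepClosure P (hsE n y) (hμ n y))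
  have hlim : Tendsto f atTop (𝓝 g) := by
    refine OrliczSpace.tendsto_of_dominated P hE hμE (M := M + M) (fun n => ?_) ?_
    · filter_upwards [hfe n, hM] with x h1 h2
      rw [h1]
      by_cases hx : x ∈ E
      · rw [Set.indicator_of_mem hx] at h2 ⊢
        rw [Set.indicator_of_mem hx]
        refine (nnnorm_sub_le _ _).trans (add_le_add ?_ h2)
        exact hgm.norm_approxBounded_le M.2 n x
      · rw [Set.indicator_of_notMem hx] at h2 ⊢
        rw [Set.indicator_of_notMem hx, zero_sub, nnnorm_neg]
        exact h2
    · filter_upwards [ae_all_iff.2 hfe, hM] with x h1 h2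
      simp only [h1]
      by_cases hx : x ∈ E
      · simp only [Set.indicator_of_mem hx] at h2 ⊢
        exact hgm.tendsto_approxBounded_of_norm_le (by exact_mod_cast h2)
      · simp only [Set.indicator_of_notMem hx] at h2 ⊢
        rw [nnnorm_eq_zero.1 (le_antisymm h2 zero_le)]
        exact tendsto_const_nhds
  exact (Submodule.isClosed_topologicalClosure _).mem_of_tendsto hlim
    (Eventually.of_forall hfS)

end OrliczNorm

/-! ### Weighted Orlicz functions and local boundedness of weights. -/

section WeightedSpace

/-- A function of finite integral vanishes off a σ-finite set, and $f$ vanishes with it. Applied to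
$q=\Phi(a|\omega f|)$, this supplies the σ-finite supports that the Fubini lemmas require. -/
theorem aefinStronglyMeasurable_of_lintegral {α : Type*} [MeasurableSpace α] {μ : Measure α}
    {f : α → ℂ} (hf : AEStronglyMeasurable f μ) {q : α → ℝ≥0∞} (hq : AEMeasurable q μ)
    (hqi : ∫⁻ x, q x ∂μ ≠ ∞) (h : ∀ᵐ x ∂μ, q x = 0 → f x = 0) :
    AEFinStronglyMeasurable f μ := by
  have h1 := (integrable_toReal_of_lintegral_ne_top hq hqi).aefinStronglyMeasurable
  set t := h1.sigmaFiniteSet with ht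
  have h2 := h1.ae_eq_zero_compl
  rw [EventuallyEq, ae_restrict_iff' h1.measurableSet.compl] at h2
  refine ⟨t.indicator (hf.mk f), ?_, ?_⟩
  · exact (hf.stronglyMeasurable_mk.indicator h1.measurableSet).finStronglyMeasurable_of_set_sigmaFinite
      h1.measurableSet (fun x hx => Set.indicator_of_notMem hx _) h1.sigmaFinite_restrict
  · filter_upwards [h2, h, hf.ae_eq_mk, ae_lt_top' hq hqi] with x h2 h3 h4 h5
    by_cases hx : x ∈ t
    · rw [Set.indicator_of_mem hx, h4]
    · rw [Set.indicator_of_notMem hx]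
      rcases (ENNReal.toReal_eq_zero_iff _).1 (h2 hx) with h6 | h6
      · exact h3 h6
      · exact absurd h6 h5.ne

theorem MemOrlicz.aefinStronglyMeasurable {α : Type*} [MeasurableSpace α] {μ : Measure α}
    (P : YoungPair) {f : α → ℂ} (hf : MemOrlicz P.Φ f μ) {g : α → ℂ}
    (hg : AEStronglyMeasurable g μ) (hfg : ∀ᵐ x ∂μ, f x = 0 → g x = 0) :
    AEFinStronglyMeasurable g μ := by
  obtain ⟨hm, a, ha, hi⟩ := hf
  refine aefinStronglyMeasurable_of_lintegral hg (P.continuous_Φ.measurable.comp_aemeasurable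
    (hm.nnnorm.aemeasurable.const_mul a)) hi.ne ?_
  filter_upwards [hfg] with x hx h0
  refine hx ?_
  by_contra hne
  have h2 : P.Φ 0 < P.Φ (a * ‖f x‖₊) :=
    P.strictMono_Φ (mul_pos ha (nnnorm_pos.2 hne))
  rw [show P.Φ (a * ‖f x‖₊) = 0 from h0] at h2
  exact not_lt_zero h2

variable {G : Type*} [AddCommGroup G] [TopologicalSpace G] [MeasurableSpace G] {μ : Measure G}

theorem Weight.exists_inv_le (ω : Weight μ) : ∃ M : ℝ≥0, ∀ᵐ x ∂μ, (ω x)⁻¹ ≤ M := by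
  have h := ω.inv_memLp_top.2
  rw [eLpNorm_exponent_top] at h
  refine ⟨(eLpNormEssSup (fun s => (ω s)⁻¹) μ).toNNReal, ?_⟩
  filter_upwards [ae_le_eLpNormEssSup (f := fun s => (ω s)⁻¹) (μ := μ)] with x hx
  have h1 := ENNReal.toReal_mono h.ne hx
  rw [toReal_enorm, Real.norm_of_nonneg (inv_nonneg.2 (ω.pos x).le)] at h1
  exact h1

theorem Weight.aestronglyMeasurable_ofReal (ω : Weight μ) :
    AEStronglyMeasurable (fun s => (ω s : ℂ)) μ :=
  (Complex.measurable_ofReal.comp_aemeasurable ω.aemeasurable).aestronglyMeasurable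

theorem Weight.nnnorm_ofReal (ω : Weight μ) (s : G) : ‖(ω s : ℂ)‖₊ = (ω s).toNNReal := by
  ext
  rw [coe_nnnorm, Complex.norm_real, Real.norm_of_nonneg (ω.pos s).le,
    Real.coe_toNNReal _ (ω.pos s).le]

variable {P : YoungPair} {ω : Weight μ}

theorem WeightedOrliczSpace.coe_mulWeight (f : WeightedOrliczSpace P ω) :
    (WeightedOrliczSpace.mulWeight P ω f : G →ₘ[μ] ℂ)
      =ᵐ[μ] fun s => (ω s : ℂ) * (f : G →ₘ[μ] ℂ) s :=
  ω.coeFn_mul f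

theorem WeightedOrliczSpace.norm_eq (f : WeightedOrliczSpace P ω) :
    ‖f‖ = ‖WeightedOrliczSpace.mulWeight P ω f‖ := rfl

theorem WeightedOrliczSpace.memOrlicz (f : WeightedOrliczSpace P ω) :
    MemOrlicz P.Φ (fun s => (ω s : ℂ) * (f : G →ₘ[μ] ℂ) s) μ :=
  MemOrlicz.congr (WeightedOrliczSpace.coe_mulWeight f) (WeightedOrliczSpace.mulWeight P ω f).2

theorem WeightedOrliczSpace.eOrliczNorm_eq (f : WeightedOrliczSpace P ω) :
    eOrliczNorm P.Ψ (fun s => (ω s : ℂ) * (f : G →ₘ[μ] ℂ) s) μ = ENNReal.ofReal ‖f‖ := by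
  rw [WeightedOrliczSpace.norm_eq, OrliczSpace.norm_def,
    eOrliczNorm_congr (WeightedOrliczSpace.coe_mulWeight f),
    ENNReal.ofReal_toReal (MemOrlicz.eOrliczNorm_lt_top P (WeightedOrliczSpace.memOrlicz f)).ne]

theorem WeightedOrliczSpace.lintegral_Φ_le_one {f : WeightedOrliczSpace P ω} (hf : ‖f‖ ≤ 1) :
    ∫⁻ s, P.Φ ‖(ω s : ℂ) * (f : G →ₘ[μ] ℂ) s‖₊ ∂μ ≤ 1 := by
  refine MemOrlicz.lintegral_Φ_le_one P (WeightedOrliczSpace.memOrlicz f) ?_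
  rw [WeightedOrliczSpace.eOrliczNorm_eq]
  exact ENNReal.ofReal_le_one.2 hf

/-- The class in `L^Φ_ω(G)` of a function. -/
def WeightedOrliczSpace.ofFun {f : G → ℂ} (hf : AEStronglyMeasurable f μ)
    (h : MemOrlicz P.Φ (fun s => (ω s : ℂ) * f s) μ) : WeightedOrliczSpace P ω :=
  ⟨AEEqFun.mk f hf, by
    refine MemOrlicz.congr ?_ h
    filter_upwards [ω.coeFn_mul (AEEqFun.mk f hf), AEEqFun.coeFn_mk f hf] with s h1 h2
    exact (h1.trans (by rw [h2])).symm⟩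

theorem WeightedOrliczSpace.coe_ofFun {f : G → ℂ} (hf : AEStronglyMeasurable f μ)
    (h : MemOrlicz P.Φ (fun s => (ω s : ℂ) * f s) μ) :
    (WeightedOrliczSpace.ofFun (P := P) (ω := ω) hf h : G →ₘ[μ] ℂ) =ᵐ[μ] f :=
  AEEqFun.coeFn_mk f hf

theorem WeightedOrliczSpace.aefinStronglyMeasurable_mul (f : WeightedOrliczSpace P ω) {g : G → ℂ}
    (hg : AEStronglyMeasurable g μ) :
    AEFinStronglyMeasurable (fun s => (f : G →ₘ[μ] ℂ) s * g s) μ := by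
  refine MemOrlicz.aefinStronglyMeasurable P (WeightedOrliczSpace.memOrlicz f)
    ((AEEqFun.aestronglyMeasurable _).mul hg) (Eventually.of_forall fun s hs => ?_)
  rcases mul_eq_zero.1 hs with h | h
  · exact absurd (Complex.ofReal_eq_zero.1 h) (ω.pos s).ne'
  · rw [h, zero_mul]

theorem WeightedOrliczSpace.aefinStronglyMeasurable (f : WeightedOrliczSpace P ω) :
    AEFinStronglyMeasurable (f : G →ₘ[μ] ℂ) μ := by
  simpa using WeightedOrliczSpace.aefinStronglyMeasurable_mul f (aestronglyMeasurable_const (b := (1 : ℂ)))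

/-- The class of `|f|`. -/
theorem WeightedOrliczSpace.exists_norm (f : WeightedOrliczSpace P ω) :
    ∃ g : WeightedOrliczSpace P ω,
      (g : G →ₘ[μ] ℂ) =ᵐ[μ] fun s => ((‖(f : G →ₘ[μ] ℂ) s‖ : ℝ) : ℂ) := by
  have hm : AEStronglyMeasurable (fun s => ((‖(f : G →ₘ[μ] ℂ) s‖ : ℝ) : ℂ)) μ :=
    Complex.continuous_ofReal.comp_aestronglyMeasurable (AEEqFun.aestronglyMeasurable _).norm
  refine ⟨WeightedOrliczSpace.ofFun hm ?_, WeightedOrliczSpace.coe_ofFun hm _⟩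
  obtain ⟨-, a, ha, hi⟩ := (WeightedOrliczSpace.memOrlicz f)
  refine ⟨ω.aestronglyMeasurable_ofReal.mul hm, a, ha, ?_⟩
  simpa only [nnnorm_mul, Complex.nnnorm_real, nnnorm_norm] using hi

variable [IsTopologicalAddGroup G] [LocallyCompactSpace G] [T2Space G] [BorelSpace G]

/-- Young's inequality against the constant 1 gives $a|\omega f|\le\Phi(a|\omega f|)+\Psi(1)$, and
$|f|\le M|\omega f|$ because $1/\omega$ is essentially bounded. -/
theorem WeightedOrliczSpace.locallyIntegrable [IsFiniteMeasureOnCompacts μ]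
    (f : WeightedOrliczSpace P ω) : LocallyIntegrable (f : G →ₘ[μ] ℂ) μ := by
  rw [locallyIntegrable_iff]
  intro K hK
  refine ⟨(AEEqFun.aestronglyMeasurable _).restrict, ?_⟩
  rw [hasFiniteIntegral_iff_enorm]
  obtain ⟨M, hM⟩ := ω.exists_inv_le
  obtain ⟨hm, a, ha, hi⟩ := (WeightedOrliczSpace.memOrlicz f)
  have hmeas : AEMeasurable
      (fun s => P.Φ (a * ‖(ω s : ℂ) * (f : G →ₘ[μ] ℂ) s‖₊)) (μ.restrict K) :=
    (P.continuous_Φ.measurable.comp_aemeasurable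
      (hm.nnnorm.aemeasurable.const_mul a)).restrict
  calc ∫⁻ s in K, ‖(f : G →ₘ[μ] ℂ) s‖ₑ ∂μ
      ≤ ∫⁻ s in K, (M / a : ℝ≥0) *
          (P.Φ (a * ‖(ω s : ℂ) * (f : G →ₘ[μ] ℂ) s‖₊) + P.Ψ 1) ∂μ := by
        refine lintegral_mono_ae (ae_restrict_of_ae ?_)
        filter_upwards [hM] with s hs
        refine le_trans ?_ (mul_le_mul_right (P.young _ 1) _)
        rw [enorm_eq_nnnorm, ← ENNReal.coe_mul]
        refine ENNReal.coe_le_coe.2 ?_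
        rw [nnnorm_mul, ω.nnnorm_ofReal, mul_one, ← mul_assoc, ← mul_assoc,
          div_mul_cancel₀ _ ha.ne']
        refine le_mul_of_one_le_left zero_le ?_
        rw [← NNReal.coe_le_coe]
        push_cast
        rw [Real.coe_toNNReal _ (ω.pos s).le]
        rwa [inv_le_iff_one_le_mul₀ (ω.pos s)] at hs
    _ = (M / a : ℝ≥0) * (∫⁻ s in K, P.Φ (a * ‖(ω s : ℂ) * (f : G →ₘ[μ] ℂ) s‖₊) ∂μ
          + P.Ψ 1 * μ K) := by
        rw [lintegral_const_mul' _ _ ENNReal.coe_ne_top, lintegral_add_left' hmeas]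
        simp
    _ < ∞ := by
        refine ENNReal.mul_lt_top ENNReal.coe_lt_top (ENNReal.add_lt_top.2 ⟨?_, ?_⟩)
        · exact (setLIntegral_le_lintegral _ _).trans_lt hi
        · exact ENNReal.mul_lt_top (P.Ψ_ne_top 1).lt_top hK.measure_lt_top

theorem WeightedOrliczSpace.locallyIntegrable_mul [IsFiniteMeasureOnCompacts μ]
    (f : WeightedOrliczSpace P ω) {g : G → ℂ} (hg : Continuous g) :
    LocallyIntegrable (fun s => (f : G →ₘ[μ] ℂ) s * g s) μ := by
  rw [locallyIntegrable_iff]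
  intro K hK
  exact ((WeightedOrliczSpace.locallyIntegrable f).integrableOn_isCompact hK).mul_continuousOn hg.continuousOn hK

variable [μ.IsAddHaarMeasure] [μ.Regular]

/-- A weight is bounded on compact sets. -/
theorem Weight.exists_le_of_isCompact (ω : Weight μ) {K : Set G} (hK : IsCompact K) :
    ∃ M : ℝ≥0, ∀ x ∈ K, ω x ≤ M := by
  obtain ⟨C, hC, hsub⟩ := ω.submul
  obtain ⟨W, hW, hW0⟩ := exists_compact_mem_nhds (0 : G)
  have hneg : AEMeasurable (fun x => ω (-x)) μ :=
    ω.aemeasurable.comp_quasiMeasurePreserving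
      (Measure.measurePreserving_neg μ).quasiMeasurePreserving
  -- Both $\omega(x)$ and $\omega(-x)$ are controlled, because $\omega(s-t)\le C\omega(s)\omega(-t)$
  -- will be applied to differences. These sets exhaust $W$, so one of them has positive measure.
  set A : ℕ → Set G := fun n => W ∩ ({x | ω x ≤ n} ∩ {x | ω (-x) ≤ n}) with hA
  have hAm : ∀ n, NullMeasurableSet (A n) μ := fun n =>
    hW.measurableSet.nullMeasurableSet.inter
      ((nullMeasurableSet_le ω.aemeasurable aemeasurable_const).inter
        (nullMeasurableSet_le hneg aemeasurable_const))
  obtain ⟨n, hn⟩ : ∃ n, 0 < μ (A n) := by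
    by_contra! h
    have h0 : μ (⋃ n, A n) = 0 := measure_iUnion_null fun n => le_antisymm (h n) zero_le
    have hWA : W ⊆ ⋃ n, A n := fun x hx => by
      obtain ⟨i, hi⟩ := exists_nat_ge (max (ω x) (ω (-x)))
      exact Set.mem_iUnion.2 ⟨i, hx, (le_max_left _ _).trans hi, (le_max_right _ _).trans hi⟩
    exact (Measure.measure_pos_of_mem_nhds μ hW0).ne' (measure_mono_null hWA h0)
  obtain ⟨E, hEA, hEm, hEe⟩ := (hAm n).exists_measurable_subset_ae_eq
  have hμE : μ E = μ (A n) := measure_congr hEe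
  have hEfin : μ E ≠ ∞ :=
    ((measure_mono (hEA.trans Set.inter_subset_left)).trans_lt hW.measure_lt_top).ne
  -- Steinhaus: the differences fill a neighbourhood of 0, on which $\omega\le Cn^2$. Finitely many
  -- translates of it cover the compact set.
  have hV : E - E ∈ 𝓝 (0 : G) :=
    Measure.sub_mem_nhds_zero_of_addHaar_pos_ne_top μ E hEm (hμE ▸ hn) hEfin
  have hVb : ∀ x ∈ E - E, ω x ≤ C * (n * n) := by
    rintro _ ⟨s, hs, t, ht, rfl⟩
    change ω (s - t) ≤ _
    rw [sub_eq_add_neg]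
    refine (hsub s (-t)).trans ?_
    gcongr
    · exact (ω.pos _).le
    · exact (hEA hs).2.1
    · exact (hEA ht).2.2
  have hreal : ∃ M : ℝ, ∀ x ∈ K, ω x ≤ M := by
    refine hK.induction_on (p := fun s => ∃ M : ℝ, ∀ x ∈ s, ω x ≤ M) ⟨0, by simp⟩ ?_ ?_ ?_
    · rintro s t hst ⟨M, hM⟩
      exact ⟨M, fun x hx => hM x (hst hx)⟩
    · rintro s t ⟨M, hM⟩ ⟨N, hN⟩
      refine ⟨max M N, ?_⟩
      rintro x (hx | hx)
      · exact (hM x hx).trans (le_max_left _ _)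
      · exact (hN x hx).trans (le_max_right _ _)
    · intro x _
      refine ⟨(fun y => y - x) ⁻¹' (E - E), mem_nhdsWithin_of_mem_nhds ?_,
        C * (ω x * (C * (n * n))), fun y hy => ?_⟩
      · refine (continuous_id.sub continuous_const).continuousAt.preimage_mem_nhds ?_
        simpa using hV
      · have h1 := hsub x (y - x)
        rw [add_sub_cancel] at h1
        refine h1.trans ?_
        have := (ω.pos x).le
        gcongr
        exact hVb _ hy
  obtain ⟨M, hM⟩ := hreal
  exact ⟨M.toNNReal, fun x hx => (hM x hx).trans (Real.le_coe_toNNReal M)⟩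

end WeightedSpace

/-! ### Density of bounded functions of compact support, and the subalgebra $\mathcal
S^\Phi_\omega$. -/

section BoundedCompact

variable {G : Type*} [AddCommGroup G] [TopologicalSpace G] [IsTopologicalAddGroup G]
  [LocallyCompactSpace G] [T2Space G] [MeasurableSpace G] [BorelSpace G] {μ : Measure G}

/-- The bounded functions of compact support in `L^Φ_ω(G)`. -/
def boundedCompact (P : YoungPair) (ω : Weight μ) : Submodule ℂ (WeightedOrliczSpace P ω) where
  carrier := {f | ∃ (K : Set G) (M : ℝ≥0), IsCompact K ∧
    ∀ᵐ x ∂μ, ‖(f : G →ₘ[μ] ℂ) x‖₊ ≤ K.indicator (fun _ => M) x}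
  add_mem' := by
    rintro f g ⟨K, M, hK, hf⟩ ⟨L, N, hL, hg⟩
    refine ⟨K ∪ L, M + N, hK.union hL, ?_⟩
    filter_upwards [hf, hg, AEEqFun.coeFn_add (f : G →ₘ[μ] ℂ) g] with x h1 h2 h3
    rw [Submodule.coe_add, h3, Pi.add_apply]
    refine (nnnorm_add_le _ _).trans ((add_le_add h1 h2).trans ?_)
    by_cases hx : x ∈ K <;> by_cases hx' : x ∈ L <;> simp [hx, hx']
  zero_mem' := by
    refine ⟨∅, 0, isCompact_empty, ?_⟩
    filter_upwards [AEEqFun.coeFn_zero (α := G) (β := ℂ) (μ := μ)] with x hx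
    rw [Submodule.coe_zero, hx]
    simp
  smul_mem' := by
    rintro c f ⟨K, M, hK, hf⟩
    refine ⟨K, ‖c‖₊ * M, hK, ?_⟩
    filter_upwards [hf, AEEqFun.coeFn_smul c (f : G →ₘ[μ] ℂ)] with x h1 h2
    rw [Submodule.coe_smul, h2, Pi.smul_apply, nnnorm_smul]
    refine (mul_le_mul_right h1 _).trans ?_
    by_cases hx : x ∈ K <;> simp [hx]

variable [μ.IsAddHaarMeasure] [μ.Regular] {P : YoungPair} {ω : Weight μ}

theorem Weight.nnnorm_mul_le_of_bounded {f : G → ℂ} {K : Set G} {M N : ℝ≥0}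
    (hN : ∀ x ∈ K, ω x ≤ N) (hf : ∀ᵐ x ∂μ, ‖f x‖₊ ≤ K.indicator (fun _ => M) x) :
    ∀ᵐ x ∂μ, ‖(ω x : ℂ) * f x‖₊ ≤ K.indicator (fun _ => N * M) x := by
  filter_upwards [hf] with x hx
  rw [nnnorm_mul, ω.nnnorm_ofReal]
  by_cases h : x ∈ K
  · rw [Set.indicator_of_mem h] at hx ⊢
    gcongr
    exact Real.toNNReal_le_iff_le_coe.2 (hN x h)
  · rw [Set.indicator_of_notMem h] at hx ⊢
    rw [le_antisymm hx zero_le, mul_zero]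

theorem boundedCompact_le_weightedStepClosure :
    boundedCompact P ω ≤ WeightedStepClosure P ω := by
  rintro f ⟨K, M, hK, hf⟩
  obtain ⟨N, hN⟩ := ω.exists_le_of_isCompact hK
  refine mem_stepClosure_of_bounded P _ hK.measurableSet hK.measure_lt_top.ne (M := N * M) ?_
  filter_upwards [WeightedOrliczSpace.coe_mulWeight f, Weight.nnnorm_mul_le_of_bounded hN hf]
    with x h1 h2
  rwa [h1]

theorem exists_boundedCompact {f : G → ℂ} (hf : AEStronglyMeasurable f μ) {K : Set G}
    (hK : IsCompact K) {M : ℝ≥0} (hM : ∀ᵐ x ∂μ, ‖f x‖₊ ≤ K.indicator (fun _ => M) x) :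
    ∃ g ∈ boundedCompact P ω, (g : G →ₘ[μ] ℂ) =ᵐ[μ] f := by
  obtain ⟨N, hN⟩ := ω.exists_le_of_isCompact hK
  have hmem : MemOrlicz P.Φ (fun s => (ω s : ℂ) * f s) μ :=
    memOrlicz_of_bounded P (ω.aestronglyMeasurable_ofReal.mul hf) hK.measurableSet
      hK.measure_lt_top.ne (Weight.nnnorm_mul_le_of_bounded hN hM)
  refine ⟨WeightedOrliczSpace.ofFun hf hmem, ⟨K, M, hK, ?_⟩, WeightedOrliczSpace.coe_ofFun hf hmem⟩
  filter_upwards [hM, WeightedOrliczSpace.coe_ofFun hf hmem] with x h1 h2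
  rwa [h2]

/-- Exhaust $E$ by increasing compact sets $L_n$. The functions $\omega^{-1}1_{L_n}$ are bounded,
since $1/\omega$ is, and multiplication by $\omega$ sends them to $1_{L_n}\to1_E$. -/
theorem indicator_mem_closure_boundedCompact (g : OrliczSpace μ P) {E : Set G}
    (hE : MeasurableSet E) (hg : (g : G →ₘ[μ] ℂ) =ᵐ[μ] E.indicator fun _ => (1 : ℂ)) :
    g ∈ ((boundedCompact P ω).map (WeightedOrliczSpace.mulWeight P ω)).topologicalClosure := by
  have hμE : μ E ≠ ∞ := MemOrlicz.measure_ne_top P hE (g.2.congr hg)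
  have hε : ∀ n : ℕ, ((n : ℝ≥0∞) + 1)⁻¹ ≠ 0 := fun n => by simp
  choose K hKE hK hlt using fun n : ℕ => hE.exists_isCompact_sdiff_lt (μ := μ) hμE (hε n)
  set L : ℕ → Set G := fun n => ⋃ k ∈ Set.Iic n, K k with hLdef
  have hL : ∀ n, IsCompact (L n) := fun n => (Set.finite_Iic n).isCompact_biUnion fun k _ => hK k
  have hLE : ∀ n, L n ⊆ E := fun n => Set.iUnion₂_subset fun k _ => hKE k
  have hnull : μ (E \ ⋃ n, K n) = 0 := by
    refine le_antisymm (ge_of_tendsto' (f := fun n : ℕ => ((n : ℝ≥0∞) + 1)⁻¹) (x := atTop) ?_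
      fun n => (measure_mono (Set.sdiff_subset_sdiff_right (Set.subset_iUnion K n))).trans
        (hlt n).le) zero_le
    have := (tendsto_add_atTop_iff_nat 1).2 ENNReal.tendsto_inv_nat_nhds_zero
    simpa using this
  obtain ⟨M, hM⟩ := ω.exists_inv_le
  have hexist : ∀ n, ∃ h ∈ boundedCompact P ω,
      (h : G →ₘ[μ] ℂ) =ᵐ[μ] (L n).indicator fun x => ((ω x : ℂ))⁻¹ := by
    intro n
    refine exists_boundedCompact (K := L n) (M := M) ?_ (hL n) ?_
    · exact (Complex.measurable_ofReal.comp_aemeasurable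
        ω.aemeasurable).inv.aestronglyMeasurable.indicator (hL n).measurableSet
    · filter_upwards [hM] with x hx
      by_cases h : x ∈ L n
      · rw [Set.indicator_of_mem h, Set.indicator_of_mem h, nnnorm_inv, ω.nnnorm_ofReal,
          ← NNReal.coe_le_coe]
        push_cast
        rwa [Real.coe_toNNReal _ (ω.pos x).le]
      · rw [Set.indicator_of_notMem h, Set.indicator_of_notMem h, nnnorm_zero]
  choose h hh hhL using hexist
  have hval : ∀ n, (WeightedOrliczSpace.mulWeight P ω (h n) : G →ₘ[μ] ℂ)
      =ᵐ[μ] (L n).indicator fun _ => (1 : ℂ) := by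
    intro n
    filter_upwards [WeightedOrliczSpace.coe_mulWeight (h n), hhL n] with x h1 h2
    rw [h1, h2]
    by_cases hx : x ∈ L n
    · rw [Set.indicator_of_mem hx, Set.indicator_of_mem hx,
        mul_inv_cancel₀ (Complex.ofReal_ne_zero.2 (ω.pos x).ne')]
    · rw [Set.indicator_of_notMem hx, Set.indicator_of_notMem hx, mul_zero]
  have hlim : Tendsto (fun n => WeightedOrliczSpace.mulWeight P ω (h n)) atTop (𝓝 g) := by
    refine OrliczSpace.tendsto_of_dominated P hE hμE (M := 1) (fun n => ?_) ?_
    · filter_upwards [hval n, hg] with x h1 h2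
      rw [h1, h2]
      by_cases hx : x ∈ L n
      · simp [hx, hLE n hx]
      · by_cases hxE : x ∈ E <;> simp [hx, hxE]
    · filter_upwards [ae_all_iff.2 hval, hg, measure_eq_zero_iff_ae_notMem.1 hnull] with x h1 h2 h3
      simp only [h1, h2]
      by_cases hxE : x ∈ E
      · obtain ⟨k, hk⟩ : ∃ k, x ∈ K k := by
          by_contra hne
          exact h3 ⟨hxE, fun hu => hne (Set.mem_iUnion.1 hu)⟩
        refine tendsto_const_nhds.congr' ?_
        filter_upwards [eventually_ge_atTop k] with n hn
        rw [Set.indicator_of_mem hxE, Set.indicator_of_mem]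
        exact Set.mem_biUnion (show k ∈ Set.Iic n from hn) hk
      · have h0 : ∀ n, x ∉ L n := fun n hn => hxE (hLE n hn)
        simp [h0, hxE]
  exact (Submodule.isClosed_topologicalClosure _).mem_of_tendsto hlim
    (Eventually.of_forall fun n => Submodule.le_topologicalClosure _
      (Submodule.mem_map_of_mem (hh n)))

/-- Indicators can be approximated after multiplication by $\omega$, and $f\mapsto f\omega$ is
isometric, so the approximation pulls back. -/
theorem weightedStepClosure_le_closure :
    WeightedStepClosure P ω ≤ (boundedCompact P ω).topologicalClosure := by
  intro f hf
  have h1 : StepClosure μ P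
      ≤ ((boundedCompact P ω).map (WeightedOrliczSpace.mulWeight P ω)).topologicalClosure := by
    refine Submodule.topologicalClosure_minimal _ (Submodule.span_le.2 ?_)
      (Submodule.isClosed_topologicalClosure _)
    rintro g ⟨E, hE, hg⟩
    exact indicator_mem_closure_boundedCompact g hE hg
  have h2 := h1 hf
  have hi : Topology.IsInducing (WeightedOrliczSpace.mulWeight P ω) :=
    (AddMonoidHomClass.isometry_of_norm _ fun _ => rfl).isEmbedding.isInducing
  rw [← SetLike.mem_coe, Submodule.topologicalClosure_coe, Submodule.map_coe] at h2
  rw [← SetLike.mem_coe, Submodule.topologicalClosure_coe, hi.closure_eq_preimage_closure_image]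
  exact h2

theorem isClosed_weightedStepClosure :
    IsClosed (WeightedStepClosure P ω : Set (WeightedOrliczSpace P ω)) := by
  have hi : Isometry (WeightedOrliczSpace.mulWeight P ω) :=
    AddMonoidHomClass.isometry_of_norm _ fun _ => rfl
  exact (Submodule.isClosed_topologicalClosure _).preimage hi.continuous

variable {m : WeightedOrliczSpace P ω →L[ℂ] WeightedOrliczSpace P ω →L[ℂ] WeightedOrliczSpace P ω}

theorem mul_convolution_comm (f g : G → ℂ) (x : G) :
    ∫ t, f t * g (x - t) ∂μ = ∫ t, g t * f (x - t) ∂μ := by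
  rw [← integral_sub_left_eq_self _ μ x]
  simp only [sub_sub_cancel, mul_comm]

theorem IsConvolutionProduct.coe_eq (hm : IsConvolutionProduct P ω m)
    (f g : WeightedOrliczSpace P ω) :
    ((m f g : WeightedOrliczSpace P ω) : G →ₘ[μ] ℂ) =ᵐ[μ]
      fun x => ∫ t, (f : G →ₘ[μ] ℂ) t * (g : G →ₘ[μ] ℂ) (x - t) ∂μ :=
  (hm f g).2

theorem IsConvolutionProduct.comm (hm : IsConvolutionProduct P ω m)
    (f g : WeightedOrliczSpace P ω) : m f g = m g f := by
  refine Subtype.ext (AEEqFun.ext ?_)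
  filter_upwards [hm.coe_eq f g, hm.coe_eq g f] with x h1 h2
  rw [h1, h2, mul_convolution_comm]

theorem IsConvolutionProduct.mul_mem_boundedCompact (hm : IsConvolutionProduct P ω m)
    {f g : WeightedOrliczSpace P ω} (hf : f ∈ boundedCompact P ω) (hg : g ∈ boundedCompact P ω) :
    m f g ∈ boundedCompact P ω := by
  obtain ⟨K, M, hK, hf⟩ := hf
  obtain ⟨L, N, hL, hg⟩ := hg
  refine ⟨K + L, M * N * (μ K).toNNReal, hK.add hL, ?_⟩
  filter_upwards [hm.coe_eq f g] with x hx
  rw [hx]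
  have hle : ∀ᵐ t ∂μ, ‖(f : G →ₘ[μ] ℂ) t * (g : G →ₘ[μ] ℂ) (x - t)‖₊
      ≤ K.indicator (fun _ => M) t * L.indicator (fun _ => N) (x - t) := by
    filter_upwards [hf, ae_comp_sub_left μ hg x] with t h1 h2
    rw [nnnorm_mul]
    gcongr
  by_cases hxKL : x ∈ K + L
  · rw [Set.indicator_of_mem hxKL, ← ENNReal.coe_le_coe, ← enorm_eq_nnnorm]
    refine (enorm_integral_le_lintegral_enorm _).trans ?_
    calc ∫⁻ t, ‖(f : G →ₘ[μ] ℂ) t * (g : G →ₘ[μ] ℂ) (x - t)‖ₑ ∂μ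
        ≤ ∫⁻ t, K.indicator (fun _ => ((M * N : ℝ≥0) : ℝ≥0∞)) t ∂μ := by
          refine lintegral_mono_ae ?_
          filter_upwards [hle] with t ht
          rw [enorm_eq_nnnorm]
          by_cases htK : t ∈ K
          · rw [Set.indicator_of_mem htK] at ht ⊢
            refine ENNReal.coe_le_coe.2 (ht.trans ?_)
            gcongr
            exact Set.indicator_le_self _ _ _
          · rw [Set.indicator_of_notMem htK, zero_mul] at ht
            rw [Set.indicator_of_notMem htK]
            exact_mod_cast ht
      _ = _ := by
          rw [lintegral_indicator_const hK.measurableSet, ENNReal.coe_mul (M * N),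
            ENNReal.coe_toNNReal hK.measure_lt_top.ne]
  · rw [Set.indicator_of_notMem hxKL]
    have h0 : ∀ᵐ t ∂μ, (f : G →ₘ[μ] ℂ) t * (g : G →ₘ[μ] ℂ) (x - t) = 0 := by
      filter_upwards [hle] with t ht
      rw [← nnnorm_eq_zero]
      refine le_antisymm (ht.trans (le_of_eq ?_)) zero_le
      by_cases htK : t ∈ K
      · rw [Set.indicator_of_notMem (s := L), mul_zero]
        exact fun h => hxKL ⟨t, htK, x - t, h, add_sub_cancel _ _⟩
      · rw [Set.indicator_of_notMem htK, zero_mul]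
    rw [integral_eq_zero_of_ae h0, nnnorm_zero]

/-- The convolution of two bounded functions of compact support is again one. Continuity of the
product extends this to the closure, one factor at a time. -/
theorem IsConvolutionProduct.mul_mem_weightedStepClosure (hm : IsConvolutionProduct P ω m)
    {f g : WeightedOrliczSpace P ω} (hf : f ∈ WeightedStepClosure P ω)
    (hg : g ∈ WeightedStepClosure P ω) : m f g ∈ WeightedStepClosure P ω := by
  have hcl := isClosed_weightedStepClosure (P := P) (ω := ω)
  have h1 : ∀ f ∈ boundedCompact P ω, ∀ g ∈ (boundedCompact P ω).topologicalClosure,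
      m f g ∈ WeightedStepClosure P ω := by
    intro f hf g hg
    refine closure_minimal (s := (boundedCompact P ω : Set (WeightedOrliczSpace P ω)))
      (t := (m f) ⁻¹' (WeightedStepClosure P ω : Set (WeightedOrliczSpace P ω))) ?_
      (hcl.preimage (m f).continuous) hg
    exact fun g hg => boundedCompact_le_weightedStepClosure (hm.mul_mem_boundedCompact hf hg)
  refine closure_minimal (s := (boundedCompact P ω : Set (WeightedOrliczSpace P ω)))
    (t := (fun f => m f g) ⁻¹' (WeightedStepClosure P ω : Set (WeightedOrliczSpace P ω))) ?_
    (hcl.preimage (m.continuous.clm_apply continuous_const)) (weightedStepClosure_le_closure hf)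
  exact fun f hf => h1 f hf g (weightedStepClosure_le_closure hg)

/-- The convolution product of `S^Φ_ω(G)`. -/
def IsConvolutionProduct.restrict (hm : IsConvolutionProduct P ω m) :
    WeightedStepClosure P ω →L[ℂ] WeightedStepClosure P ω →L[ℂ] WeightedStepClosure P ω :=
  LinearMap.mkContinuous₂
    (LinearMap.mk₂ ℂ (fun f g : WeightedStepClosure P ω =>
        (⟨m f g, hm.mul_mem_weightedStepClosure f.2 g.2⟩ : WeightedStepClosure P ω))
      (fun _ _ _ => Subtype.ext (by simp)) (fun _ _ _ => Subtype.ext (by simp))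
      (fun _ _ _ => Subtype.ext (by simp)) (fun _ _ _ => Subtype.ext (by simp)))
    ‖m‖ fun f g => m.le_opNorm₂ f g

end BoundedCompact

/-! ### The estimate of the bilinear form. -/

section Bound

theorem complementary_mono (Φ : ℝ≥0 → ℝ≥0∞) : Monotone (complementary Φ) := fun _ _ hyz =>
  iSup_mono fun x => tsub_le_tsub_right (ENNReal.coe_le_coe.2 (mul_le_mul_right hyz x)) _

/-- If both are at most 1, use $xy\le x^2+y^2$; if only one is, $xy$ is at most the other; if
neither is, the product term equals $xy$. The point is the shape: the product term can be integrated
over all of $G\times G$, the single terms only over a strip $s+t\in K$. -/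
theorem mul_le_min_sq (x y : ℝ≥0) :
    x * y ≤ min x (x ^ 2) * min y (y ^ 2) + min x (x ^ 2) + min y (y ^ 2) := by
  have h1 : ∀ z : ℝ≥0, z ≤ 1 → min z (z ^ 2) = z ^ 2 := fun z hz =>
    min_eq_right (pow_le_of_le_one zero_le hz two_ne_zero)
  have h2 : ∀ z : ℝ≥0, 1 ≤ z → min z (z ^ 2) = z := fun z hz =>
    min_eq_left (le_self_pow₀ hz two_ne_zero)
  rcases le_total x 1 with hx | hx <;> rcases le_total y 1 with hy | hy
  · rw [h1 x hx, h1 y hy, ← NNReal.coe_le_coe]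
    push_cast
    nlinarith [sq_nonneg ((x : ℝ) - y), sq_nonneg ((x : ℝ) * y), sq_nonneg (x : ℝ), sq_nonneg (y : ℝ)]
  · rw [h2 y hy]
    exact (mul_le_of_le_one_left zero_le hx).trans le_add_self
  · rw [h2 x hx]
    exact (mul_le_of_le_one_right zero_le hy).trans (le_add_self.trans le_self_add)
  · rw [h2 x hx, h2 y hy]
    exact le_self_add.trans le_self_add

variable {G : Type*} [AddCommGroup G] [TopologicalSpace G] [MeasurableSpace G] {μ : Measure G}
  {P : YoungPair}

/-- Under either growth hypothesis there is the same estimate of `|ξ̃| x y`. -/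
theorem exists_mul_le_of_case {η : G → ℂ} (hη : MemLp η ∞ μ)
    (hcase : IsYoung (fun x => P.Ψ (NNReal.sqrt x)) ∨
      (IsYoung (fun x => P.Φ (NNReal.sqrt x)) ∧
        MemOrlicz (complementary (fun x => P.Φ (NNReal.sqrt x))) η μ)) :
    ∃ (R : ℝ≥0) (h : G → ℝ≥0∞), AEMeasurable h μ ∧ ∫⁻ s, h s ∂μ ≠ ∞ ∧
      ∀ᵐ s ∂μ, ∀ x y : ℝ≥0, ((‖η s‖₊ * x * y : ℝ≥0) : ℝ≥0∞)
        ≤ R * (P.Φ x * P.Φ y + (P.Φ x + h s) + P.Φ y) := by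
  rcases hcase with hΨ | ⟨-, hm, a, ha, hi⟩
  · obtain ⟨C, hC⟩ := P.exists_min_sq_le hΨ
    have htop : eLpNormEssSup η μ ≠ ∞ := by
      rw [← eLpNorm_exponent_top]; exact hη.2.ne
    set M := (eLpNormEssSup η μ).toNNReal with hM
    -- Under (i), $\min(x,x^2)\le C\Phi(x)$: the product term costs $C^2$ and the single terms $C$,
    -- both covered by $C^2+C$.
    refine ⟨M * (C * C + C), fun _ => 0, aemeasurable_const, by simp, ?_⟩
    filter_upwards [ae_le_eLpNormEssSup (f := η) (μ := μ)] with s hs x y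
    have hsM : ‖η s‖₊ ≤ M := by
      rw [← ENNReal.coe_toNNReal htop, enorm_eq_nnnorm] at hs
      exact ENNReal.coe_le_coe.1 hs
    calc ((‖η s‖₊ * x * y : ℝ≥0) : ℝ≥0∞)
        ≤ ((M * (min x (x ^ 2) * min y (y ^ 2) + min x (x ^ 2) + min y (y ^ 2)) : ℝ≥0) : ℝ≥0∞) := by
          rw [mul_assoc]
          exact ENNReal.coe_le_coe.2 (mul_le_mul' hsM (mul_le_min_sq x y))
      _ = M * (((min x (x ^ 2) : ℝ≥0) : ℝ≥0∞) * ((min y (y ^ 2) : ℝ≥0) : ℝ≥0∞)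
            + ((min x (x ^ 2) : ℝ≥0) : ℝ≥0∞) + ((min y (y ^ 2) : ℝ≥0) : ℝ≥0∞)) := by
          rw [ENNReal.coe_mul, ENNReal.coe_add, ENNReal.coe_add, ENNReal.coe_mul]
      _ ≤ M * ((C * P.Φ x) * (C * P.Φ y) + C * P.Φ x + C * P.Φ y) := by
          gcongr
          · exact hC x
          · exact hC y
          · exact hC x
          · exact hC y
      _ ≤ M * ((C * C + C) * (P.Φ x * P.Φ y) + (C * C + C) * P.Φ x + (C * C + C) * P.Φ y) := by
          rw [mul_mul_mul_comm]
          gcongr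
          · exact le_self_add
          · exact le_add_self
          · exact le_add_self
      _ = _ := by push_cast; ring
  -- Under (ii), apply Young's inequality for $\tilde\Phi$ to $xy$ and $a|\eta(s)|$, with
  -- $\Phi(\sqrt{xy})\le\Phi(\max(x,y))\le\Phi(x)+\Phi(y)$. The integrable function $h$ is
  -- $\tilde\Psi(a|\eta|)$.
  · refine ⟨a⁻¹, fun s => complementary (fun x => P.Φ (NNReal.sqrt x)) (a * ‖η s‖₊), ?_, hi.ne, ?_⟩
    · exact (complementary_mono _).measurable.comp_aemeasurable
        (hm.nnnorm.aemeasurable.const_mul a)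
    · refine Eventually.of_forall fun s x y => ?_
      have h1 := young_inequality (fun x => P.Φ (NNReal.sqrt x)) (x * y) (a * ‖η s‖₊)
      have h2 : P.Φ (NNReal.sqrt (x * y)) ≤ P.Φ x + P.Φ y := by
        have h3 : NNReal.sqrt (x * y) ≤ max x y := by
          rw [NNReal.sqrt_le_iff_le_sq, sq]
          exact mul_le_mul' (le_max_left _ _) (le_max_right _ _)
        refine (P.strictMono_Φ.monotone h3).trans ?_
        rcases le_total x y with h | h
        · rw [max_eq_right h]; exact le_add_self
        · rw [max_eq_left h]; exact le_self_add
      calc ((‖η s‖₊ * x * y : ℝ≥0) : ℝ≥0∞)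
          = ((a⁻¹ : ℝ≥0) : ℝ≥0∞) * ((x * y * (a * ‖η s‖₊) : ℝ≥0) : ℝ≥0∞) := by
            rw [← ENNReal.coe_mul]
            congr 1
            field_simp
        _ ≤ ((a⁻¹ : ℝ≥0) : ℝ≥0∞) * (P.Φ x + P.Φ y
              + complementary (fun x => P.Φ (NNReal.sqrt x)) (a * ‖η s‖₊)) := by
            gcongr
            exact h1.trans (by gcongr)
        _ ≤ _ := by
            gcongr ((a⁻¹ : ℝ≥0) : ℝ≥0∞) * ?_
            rw [add_right_comm, add_assoc (P.Φ x * P.Φ y)]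
            exact le_add_self

variable [IsTopologicalAddGroup G] [LocallyCompactSpace G] [T2Space G] [BorelSpace G]
  [μ.IsAddHaarMeasure] [μ.Regular] {ω : Weight μ}

/-- For fixed $s$ the set of $t$ with $s+t\in K$ has measure $\mu(K)$, so this is Tonelli,
legitimate because $p$ is integrable. -/
theorem lintegral_lintegral_indicator_add_le {K : Set G} (hK : IsCompact K) {p : G → ℝ≥0∞}
    (hp : AEMeasurable p μ) (hpi : ∫⁻ s, p s ∂μ ≠ ∞) :
    ∫⁻ t, ∫⁻ s, K.indicator 1 (s + t) * p s ∂μ ∂μ ≤ μ K * ∫⁻ s, p s ∂μ := by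
  -- Coding $p$ as a complex function and reflecting $t$ and $K$ turns the double integral into that
  -- of a convolution, to which `lintegral_mul_lconvolution` applies.
  set c : G → ℂ := fun s => (((p s).toReal : ℝ) : ℂ) with hc
  have hcint : Integrable c μ := (integrable_toReal_of_lintegral_ne_top hp hpi).ofReal
  have hcp : ∀ᵐ s ∂μ, ‖c s‖ₑ = p s := by
    filter_upwards [ae_lt_top' hp hpi] with s hs
    rw [hc, ← ofReal_norm, Complex.norm_real, Real.norm_of_nonneg ENNReal.toReal_nonneg,
      ENNReal.ofReal_toReal hs.ne]
  have hKi : Integrable ((-K).indicator fun _ => (1 : ℂ)) μ :=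
    (integrable_indicator_iff hK.neg.measurableSet).2
      (integrableOn_const hK.neg.measure_lt_top.ne)
  have hind : ∀ x, ‖(-K).indicator (fun _ => (1 : ℂ)) x‖ₑ = (-K).indicator 1 x := fun x => by
    by_cases h : x ∈ -K <;> simp [h]
  have key := lintegral_mul_lconvolution μ (k := fun _ => 1) aemeasurable_const
    hcint.aefinStronglyMeasurable hKi.aefinStronglyMeasurable
  simp only [one_mul, hind] at key
  have hval : ∫⁻ x, (-K).indicator (1 : G → ℝ≥0∞) x ∂μ = μ K := by
    rw [lintegral_indicator_one hK.neg.measurableSet, Measure.measure_neg]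
  rw [hval, lintegral_mul_const'' _ hcint.1.enorm, lintegral_congr_ae hcp, mul_comm] at key
  rw [← key, ← lintegral_neg_eq_self _ (μ := μ)]
  refine le_of_eq (lintegral_congr fun t => lintegral_congr_ae ?_)
  filter_upwards [hcp] with s hs
  rw [hs, mul_comm]
  congr 1
  have : (s + -t ∈ K) ↔ (t - s ∈ -K) := by
    rw [Set.mem_neg, neg_sub, ← sub_eq_add_neg]
  by_cases h : s + -t ∈ K
  · rw [Set.indicator_of_mem h, Set.indicator_of_mem (this.1 h)]; rfl
  · rw [Set.indicator_of_notMem h, Set.indicator_of_notMem (fun h' => h (this.2 h'))]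

/-- The form `∫_K (|f ξ| * |g|)`. -/
def absForm (μ : Measure G) (ξ : G → ℂ) (K : Set G) (f g : G → ℂ) : ℝ≥0∞ :=
  ∫⁻ t, ‖g t‖ₑ * ∫⁻ s, K.indicator 1 (s + t) * ‖f s * ξ s‖ₑ ∂μ ∂μ

theorem measurable_indicator_add {K : Set G} (hK : IsCompact K) (t : G) :
    Measurable fun s => K.indicator (1 : G → ℝ≥0∞) (s + t) :=
  (measurable_one.indicator hK.measurableSet).comp (measurable_add_const t)

/-- On the unit ball the modulars of $\omega f$ and $\omega g$ are at most 1. After integrating the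
pointwise estimate, the product term therefore contributes at most 1, the term in $t$ alone at most
$\mu(K)$, and the terms in $s$ alone at most $\mu(K)(1+\int h)$. -/
theorem exists_absForm_le_of_norm_le_one {ξ : G → ℂ}
    (hbdd : MemLp (fun s => ξ s / ((ω s * ω (-s) : ℝ) : ℂ)) ∞ μ)
    (hcase : IsYoung (fun x => P.Ψ (NNReal.sqrt x)) ∨
      (IsYoung (fun x => P.Φ (NNReal.sqrt x)) ∧
        MemOrlicz (complementary (fun x => P.Φ (NNReal.sqrt x)))
          (fun s => ξ s / ((ω s * ω (-s) : ℝ) : ℂ)) μ)) {K : Set G} (hK : IsCompact K) :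
    ∃ C : ℝ≥0, ∀ f g : WeightedOrliczSpace P ω, ‖f‖ ≤ 1 → ‖g‖ ≤ 1 →
      absForm μ ξ K (f : G →ₘ[μ] ℂ) (g : G →ₘ[μ] ℂ) ≤ C := by
  obtain ⟨R, h, hh, hhi, hR⟩ := exists_mul_le_of_case hbdd hcase
  obtain ⟨c, hc, hsub⟩ := ω.submul
  lift c to ℝ≥0 using hc.le
  obtain ⟨L, hL⟩ := ω.exists_le_of_isCompact hK.neg
  have hμK : μ K ≠ ∞ := hK.measure_lt_top.ne
  set B : ℝ≥0∞ := c * L * R * (1 + μ K * (1 + ∫⁻ s, h s ∂μ) + μ K) with hB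
  have hBtop : B ≠ ∞ := by
    rw [hB]
    refine ENNReal.mul_ne_top (ENNReal.mul_ne_top (ENNReal.mul_ne_top ?_ ?_) ?_) ?_ <;> try simp
    exact ⟨ENNReal.mul_ne_top hμK (by simpa using hhi), hμK⟩
  refine ⟨B.toNNReal, fun f g hf hg => ?_⟩
  rw [ENNReal.coe_toNNReal hBtop]
  set F : G → ℝ≥0 := fun s => ‖(ω s : ℂ) * (f : G →ₘ[μ] ℂ) s‖₊ with hF
  set H : G → ℝ≥0 := fun s => ‖(ω s : ℂ) * (g : G →ₘ[μ] ℂ) s‖₊ with hH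
  have hFi : ∫⁻ s, P.Φ (F s) ∂μ ≤ 1 := WeightedOrliczSpace.lintegral_Φ_le_one hf
  have hHi : ∫⁻ s, P.Φ (H s) ∂μ ≤ 1 := WeightedOrliczSpace.lintegral_Φ_le_one hg
  have hFm : AEMeasurable (fun s => P.Φ (F s)) μ := P.continuous_Φ.measurable.comp_aemeasurable
    (WeightedOrliczSpace.memOrlicz f).1.nnnorm.aemeasurable
  have hHm : AEMeasurable (fun s => P.Φ (H s)) μ := P.continuous_Φ.measurable.comp_aemeasurable
    (WeightedOrliczSpace.memOrlicz g).1.nnnorm.aemeasurable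
  have hpt : ∀ᵐ s ∂μ, ∀ t, ‖(g : G →ₘ[μ] ℂ) t‖ₑ *
      (K.indicator 1 (s + t) * ‖(f : G →ₘ[μ] ℂ) s * ξ s‖ₑ) ≤ c * L * R * K.indicator 1 (s + t) *
        (P.Φ (F s) * P.Φ (H t) + (P.Φ (F s) + h s) + P.Φ (H t)) := by
    filter_upwards [hR] with s hs t
    by_cases hst : s + t ∈ K
    · simp only [Set.indicator_of_mem hst, Pi.one_apply, one_mul, mul_one]
      -- Since $-s=t-(s+t)$ with $-(s+t)\in-K$, the unwanted factor $\omega(-s)$ of $\xi$ is traded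
      -- for the weight $\omega(t)$ that belongs to $g$.
      have hω : ω (-s) ≤ c * (ω t * L) := by
        have h1 := hsub t (-(s + t))
        rw [show t + -(s + t) = -s by abel] at h1
        refine h1.trans ?_
        have := (ω.pos t).le
        gcongr
        exact hL _ (by simpa using hst)
      have hξ : ‖ξ s‖₊ = ‖ξ s / ((ω s * ω (-s) : ℝ) : ℂ)‖₊ * ((ω s).toNNReal * (ω (-s)).toNNReal) := by
        have hne : ((ω s * ω (-s) : ℝ) : ℂ) ≠ 0 :=
          Complex.ofReal_ne_zero.2 (mul_pos (ω.pos s) (ω.pos (-s))).ne'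
        rw [← ω.nnnorm_ofReal, ← ω.nnnorm_ofReal, ← nnnorm_mul, ← nnnorm_mul]
        congr 1
        rw [← Complex.ofReal_mul, div_mul_cancel₀ _ hne]
      have hω' : (ω (-s)).toNNReal ≤ c * ((ω t).toNNReal * L) := by
        rw [Real.toNNReal_le_iff_le_coe]
        push_cast
        rwa [Real.coe_toNNReal _ (ω.pos t).le]
      calc ‖(g : G →ₘ[μ] ℂ) t‖ₑ * ‖(f : G →ₘ[μ] ℂ) s * ξ s‖ₑ
          = ((‖(g : G →ₘ[μ] ℂ) t‖₊ * (‖(f : G →ₘ[μ] ℂ) s‖₊ *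
            (‖ξ s / ((ω s * ω (-s) : ℝ) : ℂ)‖₊ * ((ω s).toNNReal * (ω (-s)).toNNReal))) : ℝ≥0) :
              ℝ≥0∞) := by
            rw [← hξ, enorm_mul]
            simp only [enorm_eq_nnnorm, ENNReal.coe_mul]
        _ ≤ ((‖(g : G →ₘ[μ] ℂ) t‖₊ * (‖(f : G →ₘ[μ] ℂ) s‖₊ *
            (‖ξ s / ((ω s * ω (-s) : ℝ) : ℂ)‖₊ * ((ω s).toNNReal *
              (c * ((ω t).toNNReal * L))))) : ℝ≥0) : ℝ≥0∞) := by
            refine ENNReal.coe_le_coe.2 ?_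
            gcongr
        _ = c * L * ((‖ξ s / ((ω s * ω (-s) : ℝ) : ℂ)‖₊ * F s * H t : ℝ≥0) : ℝ≥0∞) := by
            rw [hF, hH]
            simp only [nnnorm_mul, ω.nnnorm_ofReal]
            rw [← ENNReal.coe_mul, ← ENNReal.coe_mul]
            congr 1
            ring
        _ ≤ c * L * (R * (P.Φ (F s) * P.Φ (H t) + (P.Φ (F s) + h s) + P.Φ (H t))) := by
            gcongr
            exact hs (F s) (H t)
        _ = _ := by ring
    · simp [Set.indicator_of_notMem hst]
  have hinner : ∀ t, ‖(g : G →ₘ[μ] ℂ) t‖ₑ *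
      ∫⁻ s, K.indicator 1 (s + t) * ‖(f : G →ₘ[μ] ℂ) s * ξ s‖ₑ ∂μ
      ≤ c * L * R * ((P.Φ (H t) + μ K * P.Φ (H t))
        + ∫⁻ s, K.indicator 1 (s + t) * (P.Φ (F s) + h s) ∂μ) := by
    intro t
    have hKm := measurable_indicator_add hK t
    have hsm : AEMeasurable
        (fun s => P.Φ (F s) * P.Φ (H t) + K.indicator 1 (s + t) * P.Φ (H t)) μ :=
      (hFm.mul_const _).add (hKm.aemeasurable.mul_const _)
    rw [← lintegral_const_mul' _ _ enorm_ne_top]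
    calc ∫⁻ s, ‖(g : G →ₘ[μ] ℂ) t‖ₑ * (K.indicator 1 (s + t) * ‖(f : G →ₘ[μ] ℂ) s * ξ s‖ₑ) ∂μ
        ≤ ∫⁻ s, c * L * R * ((P.Φ (F s) * P.Φ (H t) + K.indicator 1 (s + t) * P.Φ (H t))
            + K.indicator 1 (s + t) * (P.Φ (F s) + h s)) ∂μ := by
          refine lintegral_mono_ae ?_
          filter_upwards [hpt] with s hs
          refine (hs t).trans ?_
          rw [mul_assoc _ (K.indicator 1 (s + t))]
          gcongr c * L * R * ?_
          -- The indicator is dropped from the product term only; the other terms need it to be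
          -- integrable.
          by_cases hst : s + t ∈ K
          · simp only [Set.indicator_of_mem hst, Pi.one_apply, one_mul]
            exact le_of_eq (add_right_comm _ _ _)
          · simp [Set.indicator_of_notMem hst]
      _ = c * L * R * (((∫⁻ s, P.Φ (F s) ∂μ) * P.Φ (H t)
            + (∫⁻ s, K.indicator 1 (s + t) ∂μ) * P.Φ (H t))
            + ∫⁻ s, K.indicator 1 (s + t) * (P.Φ (F s) + h s) ∂μ) := by
          rw [lintegral_const_mul' _ _ (by
              exact ENNReal.mul_ne_top (ENNReal.mul_ne_top (by simp) (by simp)) (by simp)),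
            lintegral_add_left' hsm,
            lintegral_add_left' (hFm.mul_const _), lintegral_mul_const'' _ hFm,
            lintegral_mul_const'' _ hKm.aemeasurable]
      _ ≤ _ := by
          have hμ : ∫⁻ s, K.indicator (1 : G → ℝ≥0∞) (s + t) ∂μ = μ K := by
            rw [lintegral_add_right_eq_self (fun s => K.indicator (1 : G → ℝ≥0∞) s) t,
              lintegral_indicator_one hK.measurableSet]
          rw [hμ]
          gcongr
          exact mul_le_of_le_one_left zero_le hFi
  have hHm' : AEMeasurable (fun t => P.Φ (H t) + μ K * P.Φ (H t)) μ := hHm.add (hHm.const_mul _)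
  calc absForm μ ξ K (f : G →ₘ[μ] ℂ) (g : G →ₘ[μ] ℂ)
      ≤ ∫⁻ t, c * L * R * ((P.Φ (H t) + μ K * P.Φ (H t))
        + ∫⁻ s, K.indicator 1 (s + t) * (P.Φ (F s) + h s) ∂μ) ∂μ := lintegral_mono hinner
    _ = c * L * R * ((∫⁻ t, P.Φ (H t) ∂μ + μ K * ∫⁻ t, P.Φ (H t) ∂μ)
        + ∫⁻ t, ∫⁻ s, K.indicator 1 (s + t) * (P.Φ (F s) + h s) ∂μ ∂μ) := by
        rw [lintegral_const_mul' _ _ (by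
              exact ENNReal.mul_ne_top (ENNReal.mul_ne_top (by simp) (by simp)) (by simp)),
          lintegral_add_left' hHm', lintegral_add_left' hHm,
          lintegral_const_mul'' _ hHm]
    _ ≤ c * L * R * ((1 + μ K * 1) + μ K * (1 + ∫⁻ s, h s ∂μ)) := by
        have hsum : ∫⁻ s, (P.Φ (F s) + h s) ∂μ ≤ 1 + ∫⁻ s, h s ∂μ := by
          rw [lintegral_add_left' hFm]
          gcongr
        have hle := lintegral_lintegral_indicator_add_le hK (hFm.add hh)
          (hsum.trans_lt (by simpa using hhi.lt_top)).ne
        have hle' := hle.trans (mul_le_mul_right hsum (μ K))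
        gcongr
        exact hle'
    _ = B := by rw [hB]; ring

theorem absForm_smul_smul (ξ : G → ℂ) (K : Set G) (a b : ℂ) (f g : G → ℂ) :
    absForm μ ξ K (fun s => a * f s) (fun s => b * g s) = ‖a‖ₑ * ‖b‖ₑ * absForm μ ξ K f g := by
  unfold absForm
  rw [← lintegral_const_mul' _ _ (ENNReal.mul_ne_top enorm_ne_top enorm_ne_top)]
  refine lintegral_congr fun t => ?_
  have : ∀ s, K.indicator 1 (s + t) * ‖a * f s * ξ s‖ₑ
      = ‖a‖ₑ * (K.indicator 1 (s + t) * ‖f s * ξ s‖ₑ) := fun s => by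
    rw [mul_assoc a, enorm_mul a, mul_left_comm]
  simp only [this]
  rw [lintegral_const_mul' _ _ enorm_ne_top, enorm_mul]
  ring

theorem absForm_congr {ξ : G → ℂ} {K : Set G} {f f' g g' : G → ℂ} (hf : f =ᵐ[μ] f')
    (hg : g =ᵐ[μ] g') : absForm μ ξ K f g = absForm μ ξ K f' g' := by
  unfold absForm
  refine lintegral_congr_ae ?_
  filter_upwards [hg] with t ht
  rw [ht]
  congr 1
  refine lintegral_congr_ae ?_
  filter_upwards [hf] with s hs
  rw [hs]

theorem exists_absForm_le {ξ : G → ℂ}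
    (hbdd : MemLp (fun s => ξ s / ((ω s * ω (-s) : ℝ) : ℂ)) ∞ μ)
    (hcase : IsYoung (fun x => P.Ψ (NNReal.sqrt x)) ∨
      (IsYoung (fun x => P.Φ (NNReal.sqrt x)) ∧
        MemOrlicz (complementary (fun x => P.Φ (NNReal.sqrt x)))
          (fun s => ξ s / ((ω s * ω (-s) : ℝ) : ℂ)) μ)) {K : Set G} (hK : IsCompact K) :
    ∃ C : ℝ≥0, ∀ f g : WeightedOrliczSpace P ω,
      absForm μ ξ K (f : G →ₘ[μ] ℂ) (g : G →ₘ[μ] ℂ) ≤ ENNReal.ofReal (C * ‖f‖ * ‖g‖) := by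
  obtain ⟨C, hC⟩ := exists_absForm_le_of_norm_le_one (P := P) hbdd hcase hK
  refine ⟨C, fun f g => ?_⟩
  have hunit : ∀ f : WeightedOrliczSpace P ω, ∃ f₁ : WeightedOrliczSpace P ω, ‖f₁‖ ≤ 1 ∧
      f = (‖f‖ : ℂ) • f₁ := by
    intro f
    by_cases hf : f = 0
    · exact ⟨0, by simp, by simp [hf]⟩
    · have hne : (‖f‖ : ℂ) ≠ 0 := Complex.ofReal_ne_zero.2 (norm_ne_zero_iff.2 hf)
      refine ⟨(‖f‖ : ℂ)⁻¹ • f, ?_, by rw [smul_inv_smul₀ hne]⟩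
      rw [norm_smul, norm_inv, Complex.norm_real, norm_norm,
        inv_mul_cancel₀ (norm_ne_zero_iff.2 hf)]
  obtain ⟨f₁, hf₁, hf⟩ := hunit f
  obtain ⟨g₁, hg₁, hg⟩ := hunit g
  have hcoe : ∀ {f f₁ : WeightedOrliczSpace P ω}, f = (‖f‖ : ℂ) • f₁ →
      (f : G →ₘ[μ] ℂ) =ᵐ[μ] fun s => (‖f‖ : ℂ) * (f₁ : G →ₘ[μ] ℂ) s := by
    intro f f₁ hf
    have h1 : (f : G →ₘ[μ] ℂ) = (‖f‖ : ℂ) • (f₁ : G →ₘ[μ] ℂ) := congrArg Subtype.val hf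
    filter_upwards [AEEqFun.coeFn_smul (‖f‖ : ℂ) (f₁ : G →ₘ[μ] ℂ)] with s hs
    rw [← smul_eq_mul, ← Pi.smul_apply, ← hs, ← h1]
  rw [absForm_congr (hcoe hf) (hcoe hg), absForm_smul_smul]
  refine (mul_le_mul_right (hC f₁ g₁ hf₁ hg₁) _).trans (le_of_eq ?_)
  rw [← ofReal_norm, ← ofReal_norm, Complex.norm_real, Complex.norm_real,
    norm_norm, norm_norm, ← ENNReal.ofReal_coe_nnreal, ← ENNReal.ofReal_mul (norm_nonneg _),
    ← ENNReal.ofReal_mul (by positivity)]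
  congr 1
  ring

end Bound

/-! ### The bilinear form and the derivation identity. -/

section Derivation

variable {G : Type*} [AddCommGroup G] [TopologicalSpace G] [IsTopologicalAddGroup G]
  [LocallyCompactSpace G] [T2Space G] [MeasurableSpace G] [BorelSpace G]
  {μ : Measure G} [μ.IsAddHaarMeasure] [μ.Regular]

variable (μ) in
/-- The convolution `1_U * F̌`. -/
def reflConv (U : Set G) (F : G → ℂ) : G → ℂ :=
  U.indicator (fun _ => (1 : ℂ)) ⋆[ContinuousLinearMap.mul ℂ ℂ, μ] fun s => F (-s)

theorem reflConv_apply (U : Set G) (F : G → ℂ) (t : G) :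
    reflConv μ U F t = ∫ s, U.indicator (fun _ => (1 : ℂ)) (s + t) * F s ∂μ := by
  rw [reflConv, convolution_def, ← integral_add_right_eq_self _ t]
  refine integral_congr_ae (Eventually.of_forall fun s => ?_)
  simp

theorem reflConv_congr {U : Set G} {F F' : G → ℂ} (h : F =ᵐ[μ] F') :
    reflConv μ U F = reflConv μ U F' := by
  funext t
  rw [reflConv_apply, reflConv_apply]
  refine integral_congr_ae ?_
  filter_upwards [h] with s hs
  rw [hs]

theorem integrable_indicator_add_mul {U : Set G} (hU : IsCompact U) {F : G → ℂ}
    (hF : LocallyIntegrable F μ) (t : G) :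
    Integrable (fun s => U.indicator (fun _ => (1 : ℂ)) (s + t) * F s) μ := by
  have hK : IsCompact ((fun s => s + t) ⁻¹' U) :=
    (Homeomorph.addRight t).isCompact_preimage.2 hU
  refine ((integrable_indicator_iff hK.measurableSet).2 (hF.integrableOn_isCompact hK)).congr
    (Eventually.of_forall fun s => ?_)
  by_cases h : s + t ∈ U
  · simp [h]
  · simp [h]

theorem convolutionExists_indicator {U : Set G} (hU : IsCompact U) {F : G → ℂ}
    (hF : LocallyIntegrable F μ) :
    ConvolutionExists (U.indicator (fun _ => (1 : ℂ))) (fun s => F (-s))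
      (ContinuousLinearMap.mul ℂ ℂ) μ := by
  intro t
  refine ((integrable_indicator_add_mul hU hF t).comp_sub_right t).congr
    (Eventually.of_forall fun u => ?_)
  simp

theorem reflConv_add {U : Set G} (hU : IsCompact U) {F F' : G → ℂ}
    (hF : LocallyIntegrable F μ) (hF' : LocallyIntegrable F' μ) :
    reflConv μ U (fun s => F s + F' s) = fun t => reflConv μ U F t + reflConv μ U F' t := by
  funext t
  simp only [reflConv_apply, mul_add]
  exact integral_add (integrable_indicator_add_mul hU hF t) (integrable_indicator_add_mul hU hF' t)

theorem reflConv_const_mul (U : Set G) (c : ℂ) (F : G → ℂ) :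
    reflConv μ U (fun s => c * F s) = fun t => c * reflConv μ U F t := by
  funext t
  simp only [reflConv_apply]
  rw [← integral_const_mul]
  simp only [mul_left_comm]

/-- Replacing $1_U$ by continuous functions of compact support gives continuous functions of $t$,
which converge at every $t$ by dominated convergence. This bypasses joint measurability of
$1_U(s+t)F(s)$. -/
theorem measurable_reflConv {U : Set G} (hU : IsCompact U) {F : G → ℂ}
    (hFm : AEStronglyMeasurable F μ) (hF : LocallyIntegrable F μ) :
    Measurable (reflConv μ U F) := by
  obtain ⟨φ, L, hL, hφ, hφL, hφ1, hφ0⟩ := exists_continuous_tendsto_indicator μ hU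
  have hcont : ∀ n, Continuous fun t => ∫ s, ((φ n (s + t) : ℝ) : ℂ) * F s ∂μ := by
    intro n
    have hg : Continuous fun s : G => ((φ n (-s) : ℝ) : ℂ) := by fun_prop
    have hgc : HasCompactSupport fun s : G => ((φ n (-s) : ℝ) : ℂ) :=
      HasCompactSupport.intro hL.neg fun s hs => by
        rw [hφL n (-s) fun h => hs (Set.mem_neg.2 h), Complex.ofReal_zero]
    have h1 := (hgc.continuous_convolution_right (ContinuousLinearMap.mul ℂ ℂ) hF hg).comp
      (continuous_neg (G := G))
    refine h1.congr fun t => ?_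
    rw [Function.comp_apply, convolution_def]
    refine integral_congr_ae (Eventually.of_forall fun s => ?_)
    simp only [ContinuousLinearMap.mul_apply']
    rw [mul_comm]
    congr 4
    abel
  refine measurable_of_tendsto_metrizable (fun n => (hcont n).measurable) ?_
  rw [tendsto_pi_nhds]
  intro t
  rw [reflConv_apply]
  refine tendsto_integral_of_dominated_convergence
    (fun s => ‖L.indicator (fun _ => (1 : ℂ)) (s + t) * F s‖) (fun n => ?_)
    (integrable_indicator_add_mul hL hF t).norm (fun n => ?_) ?_
  · have hc : Continuous fun s : G => ((φ n (s + t) : ℝ) : ℂ) := by fun_prop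
    exact hc.aestronglyMeasurable.mul hFm
  · refine Eventually.of_forall fun s => ?_
    rw [norm_mul, norm_mul]
    gcongr
    by_cases h : s + t ∈ L
    · rw [Set.indicator_of_mem h, Complex.norm_real, Real.norm_of_nonneg (hφ n _).1]
      simpa using (hφ n _).2
    · rw [hφL n _ h]; simp
  · filter_upwards [ae_comp_add_right μ hφ0 t] with s hs
    refine Tendsto.mul_const _ (tendsto_const_nhds.congr' ?_)
    by_cases h : s + t ∈ U
    · refine Eventually.of_forall fun n => ?_
      simp [Set.indicator_of_mem h, hφ1 n _ h]
    · filter_upwards [hs h] with n hn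
      simp [Set.indicator_of_notMem h, hn]

theorem enorm_reflConv_le (U : Set G) (F : G → ℂ) (t : G) :
    ‖reflConv μ U F t‖ₑ ≤ ∫⁻ s, U.indicator 1 (s + t) * ‖F s‖ₑ ∂μ := by
  rw [reflConv_apply]
  refine (enorm_integral_le_lintegral_enorm _).trans (le_of_eq (lintegral_congr fun s => ?_))
  rw [enorm_mul]
  by_cases h : s + t ∈ U
  · simp [h]
  · simp [h]

theorem lintegral_reflConv_mul_le (ξ : G → ℂ) (U : Set G) (f g : G → ℂ) :
    ∫⁻ t, ‖reflConv μ U (fun s => f s * ξ s) t * g t‖ₑ ∂μ ≤ absForm μ ξ U f g := by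
  refine lintegral_mono fun t => ?_
  rw [enorm_mul, mul_comm]
  gcongr
  exact enorm_reflConv_le U _ t

variable {P : YoungPair} {ω : Weight μ}
  {m : WeightedOrliczSpace P ω →L[ℂ] WeightedOrliczSpace P ω →L[ℂ] WeightedOrliczSpace P ω}

theorem aestronglyMeasurable_reflConv {U : Set G} (hU : IsCompact U) {ξ : G → ℂ}
    (hξ : Continuous ξ) (f : WeightedOrliczSpace P ω) :
    AEStronglyMeasurable (reflConv μ U fun s => (f : G →ₘ[μ] ℂ) s * ξ s) μ :=
  (measurable_reflConv hU ((AEEqFun.aestronglyMeasurable _).mul hξ.aestronglyMeasurable)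
    (WeightedOrliczSpace.locallyIntegrable_mul f hξ)).aestronglyMeasurable

theorem integrable_reflConv_mul {U : Set G} (hU : IsCompact U) {ξ : G → ℂ} (hξ : Continuous ξ)
    {C : ℝ≥0} (hC : ∀ f g : WeightedOrliczSpace P ω,
      absForm μ ξ U (f : G →ₘ[μ] ℂ) (g : G →ₘ[μ] ℂ) ≤ ENNReal.ofReal (C * ‖f‖ * ‖g‖))
    (f g : WeightedOrliczSpace P ω) :
    Integrable (fun t => reflConv μ U (fun s => (f : G →ₘ[μ] ℂ) s * ξ s) t
      * (g : G →ₘ[μ] ℂ) t) μ := by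
  refine ⟨(aestronglyMeasurable_reflConv hU hξ f).mul (AEEqFun.aestronglyMeasurable _), ?_⟩
  rw [hasFiniteIntegral_iff_enorm]
  exact (lintegral_reflConv_mul_le ξ U _ _).trans_lt ((hC f g).trans_lt ENNReal.ofReal_lt_top)

/-- The bilinear form `(f, g) ↦ ∫ (1_U * (f̌ ξ̌)) g`. -/
def derivationForm {U : Set G} (hU : IsCompact U) {ξ : G → ℂ} (hξ : Continuous ξ)
    {C : ℝ≥0} (hC : ∀ f g : WeightedOrliczSpace P ω,
      absForm μ ξ U (f : G →ₘ[μ] ℂ) (g : G →ₘ[μ] ℂ) ≤ ENNReal.ofReal (C * ‖f‖ * ‖g‖)) :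
    WeightedOrliczSpace P ω →L[ℂ] WeightedOrliczSpace P ω →L[ℂ] ℂ :=
  LinearMap.mkContinuous₂
    (LinearMap.mk₂ ℂ (fun f g : WeightedOrliczSpace P ω =>
      ∫ t, reflConv μ U (fun s => (f : G →ₘ[μ] ℂ) s * ξ s) t * (g : G →ₘ[μ] ℂ) t ∂μ)
      (fun f f' g => by
        have h : (fun s => ((f + f' : WeightedOrliczSpace P ω) : G →ₘ[μ] ℂ) s * ξ s) =ᵐ[μ]
            fun s => (f : G →ₘ[μ] ℂ) s * ξ s + (f' : G →ₘ[μ] ℂ) s * ξ s := by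
          filter_upwards [AEEqFun.coeFn_add (f : G →ₘ[μ] ℂ) f'] with s hs
          rw [Submodule.coe_add, hs, Pi.add_apply, add_mul]
        rw [reflConv_congr h, reflConv_add hU (WeightedOrliczSpace.locallyIntegrable_mul f hξ)
          (WeightedOrliczSpace.locallyIntegrable_mul f' hξ), ← integral_add
          (integrable_reflConv_mul hU hξ hC f g) (integrable_reflConv_mul hU hξ hC f' g)]
        simp only [add_mul])
      (fun c f g => by
        have h : (fun s => ((c • f : WeightedOrliczSpace P ω) : G →ₘ[μ] ℂ) s * ξ s) =ᵐ[μ]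
            fun s => c * ((f : G →ₘ[μ] ℂ) s * ξ s) := by
          filter_upwards [AEEqFun.coeFn_smul c (f : G →ₘ[μ] ℂ)] with s hs
          rw [Submodule.coe_smul, hs, Pi.smul_apply, smul_eq_mul, mul_assoc]
        rw [reflConv_congr h, reflConv_const_mul, smul_eq_mul, ← integral_const_mul]
        simp only [mul_assoc])
      (fun f g g' => by
        rw [← integral_add (integrable_reflConv_mul hU hξ hC f g)
          (integrable_reflConv_mul hU hξ hC f g')]
        refine integral_congr_ae ?_
        filter_upwards [AEEqFun.coeFn_add (g : G →ₘ[μ] ℂ) g'] with s hs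
        rw [Submodule.coe_add, hs, Pi.add_apply, mul_add])
      (fun c f g => by
        rw [smul_eq_mul, ← integral_const_mul]
        refine integral_congr_ae ?_
        filter_upwards [AEEqFun.coeFn_smul c (g : G →ₘ[μ] ℂ)] with s hs
        rw [Submodule.coe_smul, hs, Pi.smul_apply, smul_eq_mul, mul_left_comm]))
    C fun f g => by
      rw [LinearMap.mk₂_apply, ← toReal_enorm]
      refine ENNReal.toReal_le_of_le_ofReal (by positivity) ?_
      exact (enorm_integral_le_lintegral_enorm _).trans
        ((lintegral_reflConv_mul_le ξ U _ _).trans (hC f g))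

theorem derivationForm_apply {U : Set G} (hU : IsCompact U) {ξ : G → ℂ} (hξ : Continuous ξ)
    {C : ℝ≥0} (hC : ∀ f g : WeightedOrliczSpace P ω,
      absForm μ ξ U (f : G →ₘ[μ] ℂ) (g : G →ₘ[μ] ℂ) ≤ ENNReal.ofReal (C * ‖f‖ * ‖g‖))
    (f g : WeightedOrliczSpace P ω) :
    derivationForm hU hξ hC f g
      = ∫ t, reflConv μ U (fun s => (f : G →ₘ[μ] ℂ) s * ξ s) t * (g : G →ₘ[μ] ℂ) t ∂μ := rfl

/-- Fubini with $k=1_K$: it identifies $\int_K b*(a\xi)$ with the form, and gives absolute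
convergence of the convolution at almost every point of $K$, although $a\xi$ need not lie in the
algebra. -/
theorem integral_indicator_mul_convolution {ξ : G → ℂ} (hξ : Continuous ξ) {K : Set G}
    (hK : IsCompact K) {a b : WeightedOrliczSpace P ω}
    (hab : absForm μ ξ K (a : G →ₘ[μ] ℂ) (b : G →ₘ[μ] ℂ) < ∞) :
    (∀ᵐ x ∂μ, x ∈ K → Integrable (fun r => (b : G →ₘ[μ] ℂ) r
      * ((a : G →ₘ[μ] ℂ) (x - r) * ξ (x - r))) μ) ∧
    Integrable (fun x => K.indicator (fun _ => (1 : ℂ)) x * ∫ r, (b : G →ₘ[μ] ℂ) r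
      * ((a : G →ₘ[μ] ℂ) (x - r) * ξ (x - r)) ∂μ) μ ∧
    ∫ x, K.indicator (fun _ => (1 : ℂ)) x * ∫ r, (b : G →ₘ[μ] ℂ) r
      * ((a : G →ₘ[μ] ℂ) (x - r) * ξ (x - r)) ∂μ ∂μ
      = ∫ s, (b : G →ₘ[μ] ℂ) s * ∫ x, K.indicator (fun _ => (1 : ℂ)) (x + s)
        * ((a : G →ₘ[μ] ℂ) x * ξ x) ∂μ ∂μ := by
  have hk : AEStronglyMeasurable (K.indicator fun _ => (1 : ℂ)) μ :=
    aestronglyMeasurable_const.indicator hK.measurableSet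
  have hbf := WeightedOrliczSpace.aefinStronglyMeasurable b
  have haf := WeightedOrliczSpace.aefinStronglyMeasurable_mul a hξ.aestronglyMeasurable
  have hind : ∀ x, ‖K.indicator (fun _ => (1 : ℂ)) x‖ₑ = K.indicator 1 x := fun x => by
    by_cases h : x ∈ K <;> simp [h]
  have hfin : ∫⁻ x, ‖K.indicator (fun _ => (1 : ℂ)) x‖ₑ * ∫⁻ r, ‖(b : G →ₘ[μ] ℂ) r‖ₑ
      * ‖(a : G →ₘ[μ] ℂ) (x - r) * ξ (x - r)‖ₑ ∂μ ∂μ < ∞ := by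
    rw [lintegral_mul_lconvolution μ hk.enorm hbf haf]
    simpa only [hind, absForm] using hab
  obtain ⟨h1, -, h3, h4⟩ := integral_mul_convolution μ hk hbf haf hfin
  refine ⟨?_, h3, h4⟩
  filter_upwards [h1] with x hx hxK
  exact hx (by simp [hxK])

/-- The product rule $(a*b)\xi=(a\xi)*b+a*(b\xi)$, from $\xi(x)=\xi(x-r)+\xi(r)$, integrated over
$K=U-t$. Both summands converge for almost every $x\in K$, and Fubini rewrites each integral over
$K$. -/
theorem IsConvolutionProduct.reflConv_mul (hm : IsConvolutionProduct P ω m) {ξ : G →+ ℂ}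
    (hξ : Continuous ξ) {U : Set G} (hU : IsCompact U)
    (hfin : ∀ K : Set G, IsCompact K → ∀ f g : WeightedOrliczSpace P ω,
      absForm μ ξ K (f : G →ₘ[μ] ℂ) (g : G →ₘ[μ] ℂ) < ∞)
    (a b : WeightedOrliczSpace P ω) (t : G) :
    reflConv μ U (fun s => (m a b : G →ₘ[μ] ℂ) s * ξ s) t
      = ∫ s, (b : G →ₘ[μ] ℂ) s * reflConv μ U (fun s => (a : G →ₘ[μ] ℂ) s * ξ s) (s + t) ∂μ
        + ∫ s, (a : G →ₘ[μ] ℂ) s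
          * reflConv μ U (fun s => (b : G →ₘ[μ] ℂ) s * ξ s) (s + t) ∂μ := by
  set K : Set G := (fun s => s + t) ⁻¹' U with hKdef
  have hK : IsCompact K := (Homeomorph.addRight t).isCompact_preimage.2 hU
  have hKU : ∀ x, U.indicator (fun _ => (1 : ℂ)) (x + t) = K.indicator (fun _ => (1 : ℂ)) x :=
    fun x => rfl
  have hrefl : ∀ (F : G → ℂ) (s : G), reflConv μ U F (s + t)
      = ∫ x, K.indicator (fun _ => (1 : ℂ)) (x + s) * F x ∂μ := fun F s => by
    simp only [reflConv_apply, ← add_assoc, hKU]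
  obtain ⟨ha1, ha2, ha3⟩ := integral_indicator_mul_convolution hξ hK (hfin K hK a b)
  obtain ⟨hb1, hb2, hb3⟩ := integral_indicator_mul_convolution hξ hK (hfin K hK b a)
  simp only [hrefl]
  rw [← ha3, ← hb3, ← integral_add ha2 hb2, reflConv_apply]
  refine integral_congr_ae ?_
  filter_upwards [hm.coe_eq a b, ha1, hb1] with x hx hxa hxb
  rw [hKU, hx]
  by_cases hxK : x ∈ K
  · rw [Set.indicator_of_mem hxK, one_mul, one_mul, one_mul]
    have h1 := (hxa hxK).comp_sub_left x
    simp only [sub_sub_cancel] at h1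
    rw [← integral_sub_left_eq_self (fun r => (b : G →ₘ[μ] ℂ) r
      * ((a : G →ₘ[μ] ℂ) (x - r) * ξ (x - r))) μ x, ← integral_mul_const]
    simp only [sub_sub_cancel]
    rw [← integral_add h1 (hxb hxK)]
    refine integral_congr_ae (Eventually.of_forall fun r => ?_)
    simp only [map_sub]
    ring
  · rw [Set.indicator_of_notMem hxK]; simp

/-- The form is a derivation. -/
theorem IsConvolutionProduct.isDerivation (hm : IsConvolutionProduct P ω m) {ξ : G →+ ℂ}
    (hξ : Continuous ξ) {U : Set G} (hU : IsCompact U)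
    (hfin : ∀ K : Set G, IsCompact K → ∀ f g : WeightedOrliczSpace P ω,
      absForm μ ξ K (f : G →ₘ[μ] ℂ) (g : G →ₘ[μ] ℂ) < ∞)
    {C : ℝ≥0} (hC : ∀ f g : WeightedOrliczSpace P ω,
      absForm μ ξ U (f : G →ₘ[μ] ℂ) (g : G →ₘ[μ] ℂ) ≤ ENNReal.ofReal (C * ‖f‖ * ‖g‖)) :
    IsDerivation m (derivationForm hU hξ hC) := by
  have key : ∀ a b c : WeightedOrliczSpace P ω,
      Integrable (fun t => (c : G →ₘ[μ] ℂ) t * ∫ s, (b : G →ₘ[μ] ℂ) s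
        * reflConv μ U (fun s => (a : G →ₘ[μ] ℂ) s * ξ s) (s + t) ∂μ) μ ∧
      derivationForm hU hξ hC a (m c b) = ∫ t, (c : G →ₘ[μ] ℂ) t * ∫ s, (b : G →ₘ[μ] ℂ) s
        * reflConv μ U (fun s => (a : G →ₘ[μ] ℂ) s * ξ s) (s + t) ∂μ ∂μ := by
    intro a b c
    -- Absolute convergence comes from the algebra itself: $|c|$ and $|b|$ belong to it, hence so
    -- does $|c|*|b|$, and the bound on the form applies to that element.
    obtain ⟨b', hb'⟩ := WeightedOrliczSpace.exists_norm b
    obtain ⟨c', hc'⟩ := WeightedOrliczSpace.exists_norm c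
    have hkfin : ∫⁻ x, ‖reflConv μ U (fun s => (a : G →ₘ[μ] ℂ) s * ξ s) x‖ₑ
        * ∫⁻ t, ‖(c : G →ₘ[μ] ℂ) t‖ₑ * ‖(b : G →ₘ[μ] ℂ) (x - t)‖ₑ ∂μ ∂μ < ∞ := by
      refine lt_of_eq_of_lt (lintegral_congr_ae ?_)
        ((lintegral_reflConv_mul_le ξ U _ _).trans_lt (hfin U hU a (m c' b')))
      filter_upwards [hm.coe_eq c' b', (hm c' b').1] with x hx hex
      rw [enorm_mul, hx]
      congr 1
      have hae : (fun t => (c' : G →ₘ[μ] ℂ) t * (b' : G →ₘ[μ] ℂ) (x - t)) =ᵐ[μ]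
          fun t => ((‖(c : G →ₘ[μ] ℂ) t‖ * ‖(b : G →ₘ[μ] ℂ) (x - t)‖ : ℝ) : ℂ) := by
        filter_upwards [hc', ae_comp_sub_left μ hb' x] with t h1 h2
        rw [h1, h2, Complex.ofReal_mul]
      have hint : Integrable (fun t => (c' : G →ₘ[μ] ℂ) t * (b' : G →ₘ[μ] ℂ) (x - t)) μ := hex
      have hint' := (hint.congr hae).re
      simp only [RCLike.re_to_complex, Complex.ofReal_re] at hint'
      rw [integral_congr_ae hae, integral_complex_ofReal, ← ofReal_norm, Complex.norm_real,
        Real.norm_of_nonneg (integral_nonneg fun t => by positivity),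
        ofReal_integral_eq_lintegral_ofReal hint' (Eventually.of_forall fun t => by positivity)]
      refine lintegral_congr fun t => ?_
      rw [ENNReal.ofReal_mul (norm_nonneg _), ofReal_norm, ofReal_norm]
    obtain ⟨-, h2, -, h4⟩ := integral_mul_convolution μ (aestronglyMeasurable_reflConv hU hξ a)
      (WeightedOrliczSpace.aefinStronglyMeasurable c)
      (WeightedOrliczSpace.aefinStronglyMeasurable b) hkfin
    simp only [mul_comm (reflConv μ U _ (_ + _))] at h2 h4
    refine ⟨h2, ?_⟩
    rw [derivationForm_apply, ← h4]
    refine integral_congr_ae ?_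
    filter_upwards [hm.coe_eq c b] with x hx
    rw [hx]
  intro a b c
  -- Both terms on the right are now integrals of $c(t)$ against the two summands that
  -- `IsConvolutionProduct.reflConv_mul` produces for $a*b$.
  rw [hm.comm b c, (key b a c).2, (key a b c).2, ← integral_add (key b a c).1 (key a b c).1,
    derivationForm_apply]
  refine integral_congr_ae (Eventually.of_forall fun t => ?_)
  simp only [hm.reflConv_mul hξ hU hfin a b t]
  ring

end Derivation

/-! ### The derivation is nonzero, hence not inner. -/

section NotInner

variable {A : Type*} [NormedAddCommGroup A] [NormedSpace ℂ A]

theorem not_isInner_of_comm {m : A →L[ℂ] A →L[ℂ] A} (hcomm : ∀ a b, m a b = m b a)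
    {D : A →L[ℂ] A →L[ℂ] ℂ} {a c : A} (h : D a c ≠ 0) : ¬ IsInner m D := by
  rintro ⟨φ, hφ⟩
  exact h (by rw [hφ, hcomm, sub_self])

variable {G : Type*} [AddCommGroup G] [TopologicalSpace G] [IsTopologicalAddGroup G]
  [LocallyCompactSpace G] [T2Space G] [MeasurableSpace G] [BorelSpace G]
  {μ : Measure G} [μ.IsAddHaarMeasure] [μ.Regular] {P : YoungPair} {ω : Weight μ}

/-- Pick $s_0$ with $\xi(s_0)\ne0$ and compact neighbourhoods $W$ of $s_0$, $V$ of $-s_0$ with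
$W+V\subseteq U$ and $\xi\ne0$ on $W$. For $f=\bar\xi1_W$ and $g=1_V$ the indicator of $U$ is 1
throughout $W+V$, and the form equals $\mu(V)\int_W|\xi|^2>0$. -/
theorem exists_integral_reflConv_ne_zero {ξ : G →+ ℂ} (hξ : Continuous ξ) (hξ0 : ξ ≠ 0)
    {U : Set G} (hU : U ∈ 𝓝 (0 : G)) :
    ∃ f ∈ boundedCompact P ω, ∃ g ∈ boundedCompact P ω,
      ∫ t, reflConv μ U (fun s => (f : G →ₘ[μ] ℂ) s * ξ s) t * (g : G →ₘ[μ] ℂ) t ∂μ ≠ 0 := by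
  obtain ⟨s₀, hs₀⟩ : ∃ s, ξ s ≠ 0 := by
    by_contra! h
    exact hξ0 (AddMonoidHom.ext h)
  have hadd : ∀ᶠ p : G × G in 𝓝 s₀ ×ˢ 𝓝 (-s₀), p.1 + p.2 ∈ U := by
    rw [← nhds_prod_eq]
    refine (continuous_fst.add continuous_snd).continuousAt.preimage_mem_nhds ?_
    simpa using hU
  obtain ⟨A, hA, B, hB, hAB⟩ := Filter.eventually_prod_iff.1 hadd
  obtain ⟨W, hW0, hWA, hW⟩ := local_compact_nhds
    (hA.and (hξ.continuousAt.eventually_ne hs₀))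
  obtain ⟨V, hV0, hVB, hV⟩ := local_compact_nhds hB
  obtain ⟨M, hM⟩ := hW.exists_bound_of_continuousOn hξ.continuousOn
  obtain ⟨f, hf, hfe⟩ := exists_boundedCompact (P := P) (ω := ω) (μ := μ) (M := M.toNNReal)
    (f := W.indicator fun s => starRingEnd ℂ (ξ s))
    ((Complex.continuous_conj.comp hξ).aestronglyMeasurable.indicator hW.measurableSet) hW
    (Eventually.of_forall fun x => by
      by_cases hx : x ∈ W
      · rw [Set.indicator_of_mem hx, Set.indicator_of_mem hx, RCLike.nnnorm_conj]
        exact NNReal.le_toNNReal_of_coe_le (hM x hx)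
      · simp [hx])
  obtain ⟨g, hg, hge⟩ := exists_boundedCompact (P := P) (ω := ω) (μ := μ) (M := 1)
    (f := V.indicator fun _ => (1 : ℂ)) (aestronglyMeasurable_const.indicator hV.measurableSet) hV
    (Eventually.of_forall fun x => by by_cases hx : x ∈ V <;> simp [hx])
  refine ⟨f, hf, g, hg, ?_⟩
  set c : ℝ := ∫ s in W, ‖ξ s‖ ^ 2 ∂μ with hc
  have hcpos : 0 < c := by
    have hcont : Continuous fun s => ‖ξ s‖ ^ 2 := by fun_prop
    rw [hc, setIntegral_pos_iff_support_of_nonneg_ae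
      (Eventually.of_forall fun s => by positivity) (hcont.continuousOn.integrableOn_compact hW)]
    have hsub : W ⊆ (Function.support fun s => ‖ξ s‖ ^ 2) ∩ W := fun s hs =>
      ⟨by simpa using (hWA hs).2, hs⟩
    exact (Measure.measure_pos_of_mem_nhds μ hW0).trans_le (measure_mono hsub)
  have hrefl : ∀ t ∈ V, reflConv μ U (fun s => (f : G →ₘ[μ] ℂ) s * ξ s) t = (c : ℂ) := by
    intro t ht
    rw [reflConv_apply, hc, ← integral_complex_ofReal, ← integral_indicator hW.measurableSet]
    refine integral_congr_ae ?_
    filter_upwards [hfe] with s hs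
    rw [hs]
    by_cases hsW : s ∈ W
    · rw [Set.indicator_of_mem hsW, Set.indicator_of_mem hsW,
        Set.indicator_of_mem (hAB (hWA hsW).1 (hVB ht)), one_mul, ← Complex.normSq_eq_conj_mul_self,
        Complex.normSq_eq_norm_sq]
    · rw [Set.indicator_of_notMem hsW, Set.indicator_of_notMem hsW, zero_mul, mul_zero]
  have hval : ∫ t, reflConv μ U (fun s => (f : G →ₘ[μ] ℂ) s * ξ s) t * (g : G →ₘ[μ] ℂ) t ∂μ
      = ∫ t, V.indicator (fun _ => (c : ℂ)) t ∂μ := by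
    refine integral_congr_ae ?_
    filter_upwards [hge] with t ht
    rw [ht]
    by_cases htV : t ∈ V
    · rw [Set.indicator_of_mem htV, Set.indicator_of_mem htV, hrefl t htV, mul_one]
    · rw [Set.indicator_of_notMem htV, Set.indicator_of_notMem htV, mul_zero]
  rw [hval, integral_indicator_const _ hV.measurableSet, smul_ne_zero_iff]
  refine ⟨?_, Complex.ofReal_ne_zero.2 hcpos.ne'⟩
  exact (ENNReal.toReal_pos (Measure.measure_pos_of_mem_nhds μ hV0).ne' hV.measure_lt_top.ne).ne'

end NotInner

end WeightedOrlicz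

end

/-! ### The main theorem. -/

open WeightedOrlicz in
theorem mainTheorem2 {G : Type*} [AddCommGroup G] [TopologicalSpace G] [IsTopologicalAddGroup G]
    [LocallyCompactSpace G] [T2Space G] [MeasurableSpace G] [BorelSpace G]
    (μ : Measure G) [μ.IsAddHaarMeasure] [μ.Regular]
    (P : YoungPair) (ω : Weight μ)
    (m : WeightedOrliczSpace P ω →L[ℂ] WeightedOrliczSpace P ω →L[ℂ] WeightedOrliczSpace P ω)
    (hm : IsConvolutionProduct P ω m)
    (ξ : G →+ ℂ) (hξ : Continuous ξ) (hξ0 : ξ ≠ 0)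
    (hbdd : MemLp (fun s => ξ s / ((ω s * ω (-s) : ℝ) : ℂ)) ∞ μ)
    (hcase : IsYoung (fun x => P.Ψ (NNReal.sqrt x)) ∨
      (IsYoung (fun x => P.Φ (NNReal.sqrt x)) ∧
        MemOrlicz (complementary (fun x => P.Φ (NNReal.sqrt x)))
          (fun s => ξ s / ((ω s * ω (-s) : ℝ) : ℂ)) μ)) :
    ∃ mS : WeightedStepClosure P ω →L[ℂ] WeightedStepClosure P ω →L[ℂ] WeightedStepClosure P ω,
      (∀ f g : WeightedStepClosure P ω, (mS f g : WeightedOrliczSpace P ω) = m f g) ∧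
      ¬ IsWeaklyAmenable m ∧
      ¬ IsWeaklyAmenable mS ∧
      ∀ U : Set G, IsCompact U → U ∈ 𝓝 (0 : G) →
        ∃ (D : WeightedOrliczSpace P ω →L[ℂ] WeightedOrliczSpace P ω →L[ℂ] ℂ)
          (DS : WeightedStepClosure P ω →L[ℂ] WeightedStepClosure P ω →L[ℂ] ℂ),
          (∀ f : WeightedOrliczSpace P ω,
            ConvolutionExists (U.indicator (fun _ => (1 : ℂ)))
              (fun s => (f : G →ₘ[μ] ℂ) (-s) * ξ (-s)) (ContinuousLinearMap.mul ℂ ℂ) μ) ∧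
          (∀ f g : WeightedOrliczSpace P ω,
            Integrable (fun t => (U.indicator (fun _ => (1 : ℂ))
              ⋆[ContinuousLinearMap.mul ℂ ℂ, μ]
                (fun s => (f : G →ₘ[μ] ℂ) (-s) * ξ (-s))) t * (g : G →ₘ[μ] ℂ) t) μ ∧
            D f g = ∫ t, (U.indicator (fun _ => (1 : ℂ))
              ⋆[ContinuousLinearMap.mul ℂ ℂ, μ]
                (fun s => (f : G →ₘ[μ] ℂ) (-s) * ξ (-s))) t * (g : G →ₘ[μ] ℂ) t ∂μ) ∧
          (∀ f g : WeightedStepClosure P ω, DS f g = D f g) ∧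
          IsDerivation m D ∧ ¬ IsInner m D ∧
          IsDerivation mS DS ∧ ¬ IsInner mS DS := by
  have hfin : ∀ K : Set G, IsCompact K → ∀ f g : WeightedOrliczSpace P ω,
      absForm μ ξ K (f : G →ₘ[μ] ℂ) (g : G →ₘ[μ] ℂ) < ∞ := by
    intro K hK f g
    obtain ⟨C, hC⟩ := exists_absForm_le (P := P) hbdd hcase hK
    exact (hC f g).trans_lt ENNReal.ofReal_lt_top
  have main : ∀ U : Set G, IsCompact U → U ∈ 𝓝 (0 : G) →
      ∃ (D : WeightedOrliczSpace P ω →L[ℂ] WeightedOrliczSpace P ω →L[ℂ] ℂ)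
        (DS : WeightedStepClosure P ω →L[ℂ] WeightedStepClosure P ω →L[ℂ] ℂ),
        (∀ f : WeightedOrliczSpace P ω,
          ConvolutionExists (U.indicator (fun _ => (1 : ℂ)))
            (fun s => (f : G →ₘ[μ] ℂ) (-s) * ξ (-s)) (ContinuousLinearMap.mul ℂ ℂ) μ) ∧
        (∀ f g : WeightedOrliczSpace P ω,
          Integrable (fun t => (U.indicator (fun _ => (1 : ℂ))
            ⋆[ContinuousLinearMap.mul ℂ ℂ, μ]
              (fun s => (f : G →ₘ[μ] ℂ) (-s) * ξ (-s))) t * (g : G →ₘ[μ] ℂ) t) μ ∧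
          D f g = ∫ t, (U.indicator (fun _ => (1 : ℂ))
            ⋆[ContinuousLinearMap.mul ℂ ℂ, μ]
              (fun s => (f : G →ₘ[μ] ℂ) (-s) * ξ (-s))) t * (g : G →ₘ[μ] ℂ) t ∂μ) ∧
        (∀ f g : WeightedStepClosure P ω, DS f g = D f g) ∧
        IsDerivation m D ∧ ¬ IsInner m D ∧
        IsDerivation hm.restrict DS ∧ ¬ IsInner hm.restrict DS := by
    intro U hU hU0
    obtain ⟨C, hC⟩ := exists_absForm_le (P := P) hbdd hcase hU
    have hder := hm.isDerivation hξ hU hfin hC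
    -- The two test functions are bounded with compact support, so they lie in $\mathcal
    -- S^\Phi_\omega$ and witness non-innerness for both algebras.
    obtain ⟨f, hf, g, hg, hfg⟩ := exists_integral_reflConv_ne_zero (P := P) (ω := ω) hξ hξ0 hU0
    set D := derivationForm hU hξ hC with hD
    refine ⟨D, D.bilinearComp (WeightedStepClosure P ω).subtypeL (WeightedStepClosure P ω).subtypeL,
      fun f => convolutionExists_indicator hU (WeightedOrliczSpace.locallyIntegrable_mul f hξ),
      fun f g => ⟨integrable_reflConv_mul hU hξ hC f g, derivationForm_apply hU hξ hC f g⟩,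
      fun f g => rfl, hder, ?_, fun a b c => hder a b c, ?_⟩
    · exact not_isInner_of_comm hm.comm (a := f) (c := g) hfg
    · exact not_isInner_of_comm (A := WeightedStepClosure P ω)
        (fun a b => Subtype.ext (hm.comm (a : WeightedOrliczSpace P ω) b))
        (a := (⟨f, boundedCompact_le_weightedStepClosure hf⟩ : WeightedStepClosure P ω))
        (c := (⟨g, boundedCompact_le_weightedStepClosure hg⟩ : WeightedStepClosure P ω)) hfg
  refine ⟨hm.restrict, fun f g => rfl, ?_, ?_, main⟩
  · intro h
    obtain ⟨U, hU, hU0⟩ := exists_compact_mem_nhds (0 : G)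
    obtain ⟨D, -, -, -, -, hd, hi, -, -⟩ := main U hU hU0
    exact hi (h D hd)
  · intro h
    obtain ⟨U, hU, hU0⟩ := exists_compact_mem_nhds (0 : G)
    obtain ⟨-, DS, -, -, -, -, -, hd, hi⟩ := main U hU hU0
    exact hi (h DS hd)
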